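/- **Setting.** Let $\mathbb{R}^d=\mathbb{R}^{1+s}$ be Minkowski spacetime with $p\cdot x=p_0x_0-\mathbf{p}\cdot\mathbf{x}$. Let $O\mapsto\mathcal{A}(O)$ be a Haag–Kastler net: to every bounded open $O\subset\mathbb{R}^d$ belongs a unital $C^*$-subalgebra $\mathcal{A}(O)$ of the $C^*$-algebra $\mathcal{A}$, with isotony, microcausality ($[\mathcal{A}(O_1),\mathcal{A}(O_2)]=\{0\}$ if $O_1$ lies in the causal complement of $O_2$), $\bigcup_O\mathcal{A}(O)$ dense in $\mathcal{A}$, and an action $\alpha$ of the translation group $\mathbb{R}^d$ by automorphisms of $\mathcal{A}$ with $\alpha_x\mathcal{A}(O)=\mathcal{A}(O+x)$. Let $\rho_0$ be an $\alpha$-invariant (vacuum) state with GNS triple $(\pi_0,\mathcal{H},\Omega)$. Suppose that $U$ is a strongly continuous unitary representation of $\mathbb{R}^d$ on $\mathcal{H}$ with $\pi_0(\alpha_xA)=U(x)\pi_0(A)U(x)^*$, that $\Omega$ is up to a scalar the unique $U$-invariant vector, and that for some $m>0$ the joint spectrum $\sigma(P)$ of the generators $P=(H,\mathbf{P})$ of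 $U(x)=e^{iP\cdot x}$ satisfies $\{0\}\cup H_m\subset\sigma(P)\subset\{0\}\cup H_m\cup G_{2m}$, where $H_m=\{p_0=\sqrt{m^2+|\mathbf{p}|^2}\}$ and $G_{2m}=\{p_0\ge\sqrt{(2m)^2+|\mathbf{p}|^2}\}$. Let $\mathcal{R}(O)$ and $\mathcal{R}$ be the von Neumann algebras generated by $\pi_0(\mathcal{A}(O))$ and $\pi_0(\mathcal{A})$. For $A\in\mathcal{R}$ put $A(x)=U(x)AU(x)^*$ and $A(\mathbf{x})=A(0,\mathbf{x})$. The operator $A\in\mathcal{R}$ is *almost local* if there are $A_r\in\mathcal{R}(K_r)$, $r>0$, where $K_r=\{|x_0|+|\mathbf{x}|<r\}$ is the double cone of radius $r$, such that for every $N\in\mathbb{N}$ there is $C_N$ with $\|A-A_r\|\le C_Nr^{-N}$ for all $r>0$. The *Arveson spectrum* of $A$ is the support of the operator-valued distribution $p\mapsto(2\pi)^{-d}\int_{\mathbb{R}^d}e^{-ip\cdot x}A(x)\,dx$. Finally, $\mathcal{H}_{\mathrm{ac}}(P)$ is the set of all $\psi\in\mathcal{H}$ whose spectral measure $\langle\psi,E(\cdot)\psi\rangle$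 on $\mathbb{R}^d$ is absolutely continuous with respect to Lebesgue measure, where $E$ is the joint spectral measure of $P$. **Proposition.** Let $B_1^*,B_2^*\in\mathcal{R}$ be almost local operators with compact Arveson spectrum such that $B_1^*\Omega=0$. Then, for every $\psi\in\mathcal{H}_{\mathrm{ac}}(P)$, the function $(\mathbf{x},\mathbf{y})\mapsto|\langle\psi,e^{itH}B_1^*(\mathbf{x})B_2^*(\mathbf{y})\Omega\rangle|^2$ is integrable on $\mathbb{R}^{s}\times\mathbb{R}^s$ for every $t\in\mathbb{R}$, and $$\lim_{t\to\infty}\int_{\mathbb{R}^s}\int_{\mathbb{R}^s}\bigl|\langle\psi,e^{itH}B_1^*(\mathbf{x})B_2^*(\mathbf{y})\Omega\rangle\bigr|^2\,d\mathbf{x}\,d\mathbf{y}=0 .$$ -/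

import Mathlib

open MeasureTheory Filter Topology Set
open scoped ContDiff

noncomputable section

namespace HaagKastler

/-! ### Minkowski spacetime -/

/-- Space `ℝ^s` with the Euclidean norm. -/
abbrev Space (s : ℕ) : Type := EuclideanSpace ℝ (Fin s)

/-- Spacetime (and energy-momentum space) `ℝ^d = ℝ^{1+s}`; points are pairs `(x₀, 𝐱)`.
Its `volume` is Lebesgue measure. -/
abbrev Spacetime (s : ℕ) : Type := ℝ × Space s

variable {s : ℕ}

/-- The Minkowski product `p · x = p₀ x₀ - 𝐩 · 𝐱`. -/
def minkowski (p x : Spacetime s) : ℝ := p.1 * x.1 - inner ℝ p.2 x.2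

/-- The causal complement of `O`: all points that are space-like to every point of `O`. -/
def causalComplement (O : Set (Spacetime s)) : Set (Spacetime s) :=
  {x | ∀ y ∈ O, |x.1 - y.1| < ‖x.2 - y.2‖}

/-- The (open) double cone of radius `r`, centred at the origin. -/
def doubleCone (s : ℕ) (r : ℝ) : Set (Spacetime s) := {x | |x.1| + ‖x.2‖ < r}

/-- The mass hyperboloid `H_m`. -/
def massHyperboloid (s : ℕ) (m : ℝ) : Set (Spacetime s) :=
  {p | p.1 = Real.sqrt (m ^ 2 + ‖p.2‖ ^ 2)}

/-- The set `G_μ = {p | p₀ ≥ √(μ² + |𝐩|²)}`; the multi-particle spectrum is `G_{2m}`. -/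
def aboveHyperboloid (s : ℕ) (μ : ℝ) : Set (Spacetime s) :=
  {p | Real.sqrt (μ ^ 2 + ‖p.2‖ ^ 2) ≤ p.1}

/-! ### Operator-valued distributions, spectra, spectral measures -/

section Operators

variable {H : Type*} [NormedAddCommGroup H] [InnerProductSpace ℂ H]

/-- For an operator-valued function `F` (bounded and weakly continuous in all uses below), the
matrix element `⟨φ, F̌(g) χ⟩` of the operator-valued distribution
`F̌(p) = (2π)^{-d} ∫ e^{-i p·x} F(x) dx`, smeared with the test function `g`:
`⟨φ, F̌(g) χ⟩ = (2π)^{-d} ∫ (∫ g(p) e^{-i p·x} dp) ⟨φ, F(x) χ⟩ dx`. -/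
def fourierPairing (F : Spacetime s → H →L[ℂ] H) (g : Spacetime s → ℂ) (φ χ : H) : ℂ :=
  ((2 * Real.pi : ℝ) : ℂ)⁻¹ ^ (s + 1) *
    ∫ x : Spacetime s,
      (∫ p : Spacetime s, g p * Complex.exp (-(Complex.I * (minkowski p x : ℂ)))) *
        inner ℂ φ (F x χ)

/-- The support of the operator-valued distribution `F̌`: the complement of the largest open set
`V` such that `F̌(g) = 0` for all test functions `g ∈ C_c^∞(V)`. -/
def fourierSupport (F : Spacetime s → H →L[ℂ] H) : Set (Spacetime s) :=
  {p | ∀ V : Set (Spacetime s), IsOpen V → p ∈ V →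
    ∃ g : Spacetime s → ℂ, ContDiff ℝ ∞ g ∧ HasCompactSupport g ∧ tsupport g ⊆ V ∧
      ∃ φ χ : H, fourierPairing F g φ χ ≠ 0}

variable [CompleteSpace H]

/-- The von Neumann algebra generated by a set `S` of bounded operators: the double commutant of
`S ∪ S*`. -/
def generatedVonNeumann (S : Set (H →L[ℂ] H)) : VonNeumannAlgebra H where
  toStarSubalgebra :=
    StarSubalgebra.centralizer ℂ (StarSubalgebra.centralizer ℂ S : Set (H →L[ℂ] H))
  centralizer_centralizer' := by
    change Set.centralizer (Set.centralizer
        (StarSubalgebra.centralizer ℂ (StarSubalgebra.centralizer ℂ S : Set (H →L[ℂ] H)) :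
          Set (H →L[ℂ] H))) =
      (StarSubalgebra.centralizer ℂ (StarSubalgebra.centralizer ℂ S : Set (H →L[ℂ] H)) :
          Set (H →L[ℂ] H))
    rw [StarSubalgebra.coe_centralizer_centralizer, Set.centralizer_centralizer_centralizer]

/-- `U` is a strongly continuous unitary representation of the translation group `ℝ^d`. -/
def StronglyContinuous (U : Multiplicative (Spacetime s) →* unitary (H →L[ℂ] H)) : Prop :=
  ∀ ψ : H, Continuous fun x : Spacetime s => (U (.ofAdd x) : H →L[ℂ] H) ψ

/-- The joint spectrum `σ(P)` of the energy-momentum operator `P = (H, 𝐏)`, the generators of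
`U(x) = e^{i P·x} = ∫ e^{i p·x} dE(p)`. As the inverse Fourier transform of `x ↦ U(x)` is the
spectral measure `E` of `P` (as a distribution), `σ(P) = supp E` is its support. -/
def jointSpectrum (U : Multiplicative (Spacetime s) →* unitary (H →L[ℂ] H)) :
    Set (Spacetime s) :=
  fourierSupport fun x => (U (.ofAdd x) : H →L[ℂ] H)

/-- `μ` is the spectral measure `⟨ψ, E(·) ψ⟩` of the vector `ψ` with respect to `P`: the (unique)
finite Borel measure with `⟨ψ, U(x) ψ⟩ = ∫ e^{i p·x} dμ(p)` for all `x`. -/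
def IsSpectralMeasure (U : Multiplicative (Spacetime s) →* unitary (H →L[ℂ] H)) (ψ : H)
    (μ : Measure (Spacetime s)) : Prop :=
  IsFiniteMeasure μ ∧ ∀ x : Spacetime s,
    inner ℂ ψ ((U (.ofAdd x) : H →L[ℂ] H) ψ) =
      ∫ p : Spacetime s, Complex.exp (Complex.I * (minkowski p x : ℂ)) ∂μ

/-- The jointly absolutely continuous spectral subspace `H_ac(P)`: the vectors whose spectral
measure `⟨ψ, E(·) ψ⟩` on `ℝ^d` is absolutely continuous with respect to Lebesgue measure. -/
def absolutelyContinuousSubspace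
    (U : Multiplicative (Spacetime s) →* unitary (H →L[ℂ] H)) : Set H :=
  {ψ | ∃ μ : Measure (Spacetime s), IsSpectralMeasure U ψ μ ∧ μ ≪ volume}

end Operators

/-! ### Haag–Kastler nets and their vacuum representations -/

/-- A translation-covariant Haag–Kastler net on `ℝ^{1+s}` with global algebra `𝒜`. Only the values
of `alg` at bounded open sets matter. -/
structure Net (s : ℕ) (𝒜 : Type*) [CStarAlgebra 𝒜] where
  /-- The local algebra `𝒜(O)` of a bounded open set `O`. -/
  alg : Set (Spacetime s) → StarSubalgebra ℂ 𝒜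
  isClosed_alg : ∀ O, IsOpen O → Bornology.IsBounded O → IsClosed (alg O : Set 𝒜)
  isotony : ∀ O₁ O₂, IsOpen O₁ → Bornology.IsBounded O₁ → IsOpen O₂ → Bornology.IsBounded O₂ →
    O₁ ⊆ O₂ → alg O₁ ≤ alg O₂
  microcausality : ∀ O₁ O₂, IsOpen O₁ → Bornology.IsBounded O₁ → IsOpen O₂ →
    Bornology.IsBounded O₂ → O₁ ⊆ causalComplement O₂ →
    ∀ a ∈ alg O₁, ∀ b ∈ alg O₂, a * b = b * a
  /-- `𝒜` is the C*-inductive limit of the local algebras. -/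
  dense_local : Dense {a : 𝒜 | ∃ O, IsOpen O ∧ Bornology.IsBounded O ∧ a ∈ alg O}
  /-- The action of the translation group by automorphisms. -/
  α : Multiplicative (Spacetime s) →* (𝒜 ≃⋆ₐ[ℂ] 𝒜)
  covariance : ∀ O, IsOpen O → Bornology.IsBounded O → ∀ x : Spacetime s,
    α (.ofAdd x) '' (alg O : Set 𝒜) = (alg ((fun y => y + x) '' O) : Set 𝒜)

/-- A translation-invariant vacuum state on a Haag–Kastler net, its GNS triple `(π, H, Ω)`, and the
unitary implementation `U` of the translations, with unique vacuum vector and the strong spectrum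
condition for a mass `m > 0`. -/
structure VacuumSector (s : ℕ) (m : ℝ) (𝒜 : Type*) [CStarAlgebra 𝒜]
    (H : Type*) [NormedAddCommGroup H] [InnerProductSpace ℂ H] [CompleteSpace H]
    extends Net s 𝒜 where
  mass_pos : 0 < m
  /-- The vacuum state. -/
  ρ : 𝒜 →ₗ[ℂ] ℂ
  ρ_pos : ∀ a : 𝒜, ∃ r : ℝ, 0 ≤ r ∧ ρ (star a * a) = (r : ℂ)
  ρ_one : ρ 1 = 1
  ρ_invariant : ∀ (x : Spacetime s) (a : 𝒜), ρ (α (.ofAdd x) a) = ρ a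
  /-- The GNS representation. -/
  π : 𝒜 →⋆ₐ[ℂ] (H →L[ℂ] H)
  /-- The vacuum vector. -/
  Ω : H
  ρ_eq : ∀ a : 𝒜, ρ a = inner ℂ Ω (π a Ω)
  cyclic : Dense (Set.range fun a : 𝒜 => π a Ω)
  /-- The unitary representation of the spacetime translations. -/
  U : Multiplicative (Spacetime s) →* unitary (H →L[ℂ] H)
  U_continuous : StronglyContinuous U
  U_implements : ∀ (x : Spacetime s) (a : 𝒜),
    π (α (.ofAdd x) a) = (U (.ofAdd x) : H →L[ℂ] H) * π a * star (U (.ofAdd x) : H →L[ℂ] H)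
  vacuum_unique : ∀ φ : H,
    (∀ x : Spacetime s, (U (.ofAdd x) : H →L[ℂ] H) φ = φ) ↔ ∃ c : ℂ, φ = c • Ω
  subset_spectrum : {0} ∪ massHyperboloid s m ⊆ jointSpectrum U
  spectrum_subset :
    jointSpectrum U ⊆ {0} ∪ massHyperboloid s m ∪ aboveHyperboloid s (2 * m)

namespace VacuumSector

variable {m : ℝ} {𝒜 : Type*} [CStarAlgebra 𝒜]
  {H : Type*} [NormedAddCommGroup H] [InnerProductSpace ℂ H] [CompleteSpace H]

/-- The local observable algebra `ℛ(O)`, the von Neumann algebra generated by `π(𝒜(O))`. -/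
def localAlgebra (Q : VacuumSector s m 𝒜 H) (O : Set (Spacetime s)) : VonNeumannAlgebra H :=
  generatedVonNeumann (Q.π '' (Q.alg O : Set 𝒜))

/-- The global observable algebra `ℛ`, the von Neumann algebra generated by `π(𝒜)`. -/
def globalAlgebra (Q : VacuumSector s m 𝒜 H) : VonNeumannAlgebra H :=
  generatedVonNeumann (Set.range Q.π)

/-- The translated operator `A(x) = U(x) A U(x)*`. -/
def translate (Q : VacuumSector s m 𝒜 H) (A : H →L[ℂ] H) (x : Spacetime s) : H →L[ℂ] H :=
  (Q.U (.ofAdd x) : H →L[ℂ] H) * A * star (Q.U (.ofAdd x) : H →L[ℂ] H)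

/-- The unitary time evolution `e^{i t H} = U(t, 0)`. -/
def timeEvolution (Q : VacuumSector s m 𝒜 H) (t : ℝ) : H →L[ℂ] H :=
  (Q.U (.ofAdd ((t, 0) : Spacetime s)) : H →L[ℂ] H)

/-- `A ∈ ℛ` is almost local: there are `A_r ∈ ℛ(K_r)`, `r > 0`, with
`‖A - A_r‖ ≤ C_N r^{-N}` for every `N`. -/
def IsAlmostLocal (Q : VacuumSector s m 𝒜 H) (A : H →L[ℂ] H) : Prop :=
  A ∈ Q.globalAlgebra ∧
    ∃ Ar : ℝ → H →L[ℂ] H,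
      (∀ r : ℝ, 0 < r → Ar r ∈ Q.localAlgebra (doubleCone s r)) ∧
      ∀ N : ℕ, ∃ C : ℝ, ∀ r : ℝ, 0 < r → ‖A - Ar r‖ ≤ C * (r ^ N)⁻¹

/-- The Arveson spectrum (energy-momentum transfer) `σ_α(A)` of `A`: the support of the
operator-valued distribution `p ↦ (2π)^{-d} ∫ e^{-i p·x} A(x) dx`. -/
def arvesonSpectrum (Q : VacuumSector s m 𝒜 H) (A : H →L[ℂ] H) : Set (Spacetime s) :=
  fourierSupport (Q.translate A)

/-- The function `(𝐱, 𝐲) ↦ ⟨ψ, e^{i t H} B₁*(𝐱) B₂*(𝐲) Ω⟩` on `ℝ^s × ℝ^s`. -/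
def twoPointAmplitude (Q : VacuumSector s m 𝒜 H) (B₁ B₂ : H →L[ℂ] H) (ψ : H) (t : ℝ)
    (x y : Space s) : ℂ :=
  inner ℂ ψ
    (Q.timeEvolution t (Q.translate (star B₁) (0, x) (Q.translate (star B₂) (0, y) Q.Ω)))

end VacuumSector

end HaagKastler

end

/-! Write `A = B₁*`, `B = B₂*`, `u = y - x`. The amplitude is `⟨ψ, U(t,x) A B(u) Ω⟩`. A vector with
absolutely continuous spectral measure is orthogonal to `Ω` (`inner_Ω_eq_zero`), so `A B(u) Ω` may
be replaced by its component `φ_u` orthogonal to the vacuum (`pairVector`). After the shear `(x, y)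
↦ (x, u)` the claim concerns `∫ du ∫ dx |⟨ψ, U(t,x) φ_u⟩|²`.

A bound uniform in `t`: by Schur's test (`lintegral_inner_shift_sq_le`) the inner integral is at
most `‖ψ‖²` times the `L¹` norm of `k_u(x) = ⟨φ_u, U(0,x) φ_u⟩`, so rapid decay of `k_u(x)` in both
`x` and `u` suffices (`exists_norm_inner_pairVector_le`). Since `A Ω = 0`, `A B(u) Ω = C_u Ω` with
`C_u = [A, B(u)]`, which is small for large `u` by almost locality. Decay in `x` is clustering with
a mass gap: compact Arveson spectra and the gap confine the energies of `φ_u` to a compact interval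
of positive numbers. A test function `g` that is one near this interval and supported in positive
energies writes `2π k_u(x)` as the time average of `⟨Ω, [C_u*, C_u(t,x)] Ω⟩` against the Fourier
transform of `g`, because the opposite operator order carries only energies `≤ 0` and drops out. The
commutator is small when `|x|` is large compared with `|t|`, and the Fourier transform of `g`
controls large `|t|`.

Dispersion at fixed `u` (`tendsto_lintegral_inner_shift`): the cyclic subspace of `ψ` is `L²(μ)`
with translations acting as plane waves. After truncation the amplitude is the Fourier transform of
a bounded, compactly supported function; Plancherel in space and Riemann-Lebesgue in energy make its
`L²` norm in `x` vanish as `t → ∞`. The uniform bound removes the truncation, and dominated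
convergence in `u` concludes.

Spectral information is used in distributional form: a statement about energies says that a matrix
element, smeared with suitable test functions, is zero (`VanishesOn`). -/

namespace HaagKastler

open scoped Manifold FourierTransform

/-! ### Test functions -/

section TestFunctions

variable {E : Type*} [NormedAddCommGroup E] [NormedSpace ℝ E]

/-- `g ∈ C_c^∞(W)`. -/
structure IsTestFunction (g : E → ℂ) (W : Set E) : Prop where
  contDiff : ContDiff ℝ ∞ g
  hasCompactSupport : HasCompactSupport g
  tsupport_subset : tsupport g ⊆ W

theorem IsTestFunction.mono {g : E → ℂ} {W W' : Set E} (hg : IsTestFunction g W) (h : W ⊆ W') :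
    IsTestFunction g W' :=
  ⟨hg.1, hg.2, hg.3.trans h⟩

theorem IsTestFunction.continuous {g : E → ℂ} {W : Set E} (hg : IsTestFunction g W) :
    Continuous g := hg.1.continuous

theorem IsTestFunction.integrable [MeasurableSpace E] [OpensMeasurableSpace E] {g : E → ℂ}
    {W : Set E} (hg : IsTestFunction g W) (μ : Measure E) [IsFiniteMeasureOnCompacts μ] :
    Integrable g μ :=
  hg.continuous.integrable_of_hasCompactSupport hg.2

theorem IsTestFunction.sub {g h : E → ℂ} {W : Set E} (hg : IsTestFunction g W)
    (hh : IsTestFunction h W) : IsTestFunction (g - h) W :=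
  ⟨hg.1.sub hh.1, hg.2.sub hh.2, (tsupport_sub g h).trans (union_subset hg.3 hh.3)⟩

theorem IsTestFunction.mul_left {g h : E → ℂ} {W : Set E} (hh : ContDiff ℝ ∞ h)
    (hg : IsTestFunction g W) : IsTestFunction (h * g) W :=
  ⟨hh.mul hg.1, hg.2.mul_left, (tsupport_mul_subset_right).trans hg.3⟩

theorem IsTestFunction.comp_homeomorph {g : E → ℂ} {W : Set E} (hg : IsTestFunction g W)
    {E' : Type*} [NormedAddCommGroup E'] [NormedSpace ℝ E'] (e : E' ≃ₜ E)
    (he : ContDiff ℝ ∞ e) : IsTestFunction (g ∘ e) (e ⁻¹' W) :=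
  ⟨hg.1.comp he, hg.2.comp_homeomorph e, by
    rw [tsupport_comp_eq_preimage g e]
    exact preimage_mono hg.3⟩

theorem IsTestFunction.comp_smul {g : E → ℂ} (hg : IsTestFunction g univ) {c : ℝ} (hc : c ≠ 0) :
    IsTestFunction (fun x => g (c • x)) univ := by
  have := hg.comp_homeomorph (Homeomorph.smulOfNeZero c hc) (contDiff_const_smul c)
  exact this.mono (subset_univ _)

variable [FiniteDimensional ℝ E]

/-- The value one is attained on a neighbourhood of `K`, so that the support of `1 - χ` stays away
from `K`. The splitting arguments below depend on this. -/
theorem exists_testFunction_eq_one {K O : Set E} (hK : IsCompact K) (hO : IsOpen O)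
    (hKO : K ⊆ O) : ∃ χ : E → ℂ, IsTestFunction χ O ∧
      ∃ N : Set E, IsOpen N ∧ K ⊆ N ∧ ∀ x ∈ N, χ x = 1 := by
  obtain ⟨L, hL, hKL, hLO⟩ := exists_compact_between hK hO hKO
  obtain ⟨f, hf1, hf0, -⟩ := exists_contMDiffMap_one_nhds_of_subset_interior (n := (⊤ : ℕ∞)) 𝓘(ℝ, E)
    hK.isClosed hKL
  have hsub : tsupport (fun x => (f x : ℂ)) ⊆ L := by
    refine closure_minimal (fun x hx => ?_) hL.isClosed
    by_contra hxL
    exact hx (by simp [hf0 x hxL])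
  rw [eventually_nhdsSet_iff_exists] at hf1
  obtain ⟨N, hN, hKN, hN1⟩ := hf1
  refine ⟨fun x => (f x : ℂ), ⟨?_, hL.of_isClosed_subset (isClosed_tsupport _) hsub,
    hsub.trans hLO⟩, N, hN, hKN, fun x hx => by simp [hN1 x hx]⟩
  exact Complex.ofRealCLM.contDiff.comp f.contMDiff.contDiff

/-- Cut off with a function equal to one near the part of the support outside `O₂`; what remains is
supported in `O₂`. -/
theorem IsTestFunction.exists_add_of_union {g : E → ℂ} {O₁ O₂ : Set E}
    (hg : IsTestFunction g (O₁ ∪ O₂)) (h₁ : IsOpen O₁) (h₂ : IsOpen O₂) :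
    ∃ g₁ g₂, IsTestFunction g₁ O₁ ∧ IsTestFunction g₂ O₂ ∧ g = g₁ + g₂ := by
  obtain ⟨χ, hχ, N, hN, hKN, hN1⟩ := exists_testFunction_eq_one (K := tsupport g \ O₂)
    (hg.2.isCompact.diff h₂) h₁ (fun x hx => (hg.3 hx.1).resolve_right hx.2)
  refine ⟨g * χ, (1 - χ) * g, hχ.mul_left hg.1, ⟨(contDiff_const.sub hχ.1).mul hg.1,
    hg.2.mul_left, fun x hx => ?_⟩, by ext x; simp; ring⟩
  by_contra hx2
  have hxg : x ∈ tsupport g := tsupport_mul_subset_right hx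
  have hxN : x ∈ tsupport (1 - χ) := tsupport_mul_subset_left hx
  refine notMem_tsupport_iff_eventuallyEq.2 ?_ hxN
  filter_upwards [hN.mem_nhds (hKN ⟨hxg, hx2⟩)] with y hy
  simp [hN1 y hy]

/-- The sheaf property of distributions, for a functional that is merely additive: compactness
reduces to gluing two open sets, which is the splitting above. -/
theorem eq_zero_of_locally_eq_zero (L : (E → ℂ) → ℂ) (h0 : L 0 = 0)
    (hadd : ∀ g h, IsTestFunction g univ → IsTestFunction h univ → L (g + h) = L g + L h)
    {W : Set E}
    (hloc : ∀ p ∈ W, ∃ V, IsOpen V ∧ p ∈ V ∧ ∀ g, IsTestFunction g V → L g = 0)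
    {g : E → ℂ} (hg : IsTestFunction g W) : L g = 0 := by
  obtain ⟨O, -, hO, h⟩ := hg.2.isCompact.induction_on
    (p := fun K => ∃ O, IsOpen O ∧ K ⊆ O ∧ ∀ g, IsTestFunction g O → L g = 0)
    ⟨∅, isOpen_empty, subset_rfl, fun g hg => by
      have : g = 0 := by
        have := subset_empty_iff.1 hg.3
        rwa [tsupport_eq_empty_iff] at this
      rw [this, h0]⟩
    (fun K K' h ⟨O, h1, h2, h3⟩ => ⟨O, h1, h.trans h2, h3⟩)
    (fun K K' ⟨O, h1, h2, h3⟩ ⟨O', h1', h2', h3'⟩ => ⟨O ∪ O', h1.union h1',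
      union_subset_union h2 h2', fun g hg => by
        obtain ⟨g₁, g₂, hg₁, hg₂, rfl⟩ := hg.exists_add_of_union h1 h1'
        rw [hadd _ _ (hg₁.mono (subset_univ _)) (hg₂.mono (subset_univ _)), h3 _ hg₁,
          h3' _ hg₂, add_zero]⟩)
    (fun p hp => by
      obtain ⟨V, hV, hpV, h⟩ := hloc p (hg.3 hp)
      exact ⟨V, mem_nhdsWithin_of_mem_nhds (hV.mem_nhds hpV), V, hV, subset_rfl, h⟩)
  exact h g ⟨hg.1, hg.2, hO⟩

end TestFunctions

/-! ### Fourier transforms of test functions -/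

section Fourier

theorem IsTestFunction.exists_schwartz {V : Type*} [NormedAddCommGroup V]
    [InnerProductSpace ℝ V] {g : V → ℂ} {W : Set V} (hg : IsTestFunction g W) :
    ∃ f : SchwartzMap V ℂ, (f : V → ℂ) = g :=
  ⟨hg.2.toSchwartzMap hg.1, rfl⟩

variable {V : Type*} [NormedAddCommGroup V] [InnerProductSpace ℝ V] [FiniteDimensional ℝ V]
  [MeasurableSpace V] [BorelSpace V]

/-- The Fourier transform `x ↦ ∫ w(p) e^{i ⟨p, x⟩} dp`. -/
noncomputable def expFourier (w : V → ℂ) (x : V) : ℂ :=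
  ∫ p : V, w p * Complex.exp (Complex.I * (inner ℝ p x : ℝ))

theorem expFourier_eq (w : V → ℂ) (x : V) :
    expFourier w x = 𝓕 w (-(2 * Real.pi)⁻¹ • x) := by
  rw [expFourier, Real.fourier_eq']
  refine integral_congr_ae (.of_forall fun p => ?_)
  simp only [inner_smul_right, smul_eq_mul]
  rw [mul_comm]
  congr 2
  push_cast
  field_simp

theorem IsTestFunction.integrable_expFourier {g : V → ℂ} {W : Set V} (hg : IsTestFunction g W) :
    Integrable (expFourier g) := by
  obtain ⟨f, rfl⟩ := hg.exists_schwartz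
  have h : Integrable (𝓕 (f : V → ℂ)) := by
    rw [← SchwartzMap.fourier_coe]; exact (𝓕 f).integrable
  simp_rw [funext (expFourier_eq (f : V → ℂ))]
  exact h.comp_smul (by simp [Real.pi_ne_zero])

theorem continuous_expFourier {g : V → ℂ} (hg : Integrable g) : Continuous (expFourier g) := by
  refine continuous_of_dominated (bound := fun p => ‖g p‖) (fun x => ?_) (fun x => ?_) hg.norm ?_
  · exact hg.aestronglyMeasurable.mul (by fun_prop)
  · refine .of_forall fun p => ?_
    rw [norm_mul, mul_comm Complex.I, Complex.norm_exp_ofReal_mul_I, mul_one]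
  · exact .of_forall fun p => by fun_prop

theorem IsTestFunction.integral_expFourier_mul_exp {g : V → ℂ} {W : Set V}
    (hg : IsTestFunction g W) (p : V) :
    ∫ x, expFourier g x * Complex.exp (-(Complex.I * (inner ℝ p x : ℝ))) =
      ((2 * Real.pi : ℝ) : ℂ) ^ Module.finrank ℝ V * g p := by
  obtain ⟨f, rfl⟩ := hg.exists_schwartz
  have h : Integrable (𝓕 (f : V → ℂ)) := by
    rw [← SchwartzMap.fourier_coe]; exact (𝓕 f).integrable
  have h1 := congrFun (f.continuous.fourierInv_fourier_eq f.integrable h) p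
  rw [Real.fourierInv_eq'] at h1
  rw [← h1]
  have h2 := Measure.integral_comp_smul (volume : Measure V)
    (fun v => Complex.exp ((2 * Real.pi * inner ℝ v p : ℝ) * Complex.I) • 𝓕 (f : V → ℂ) v)
    (-(2 * Real.pi)⁻¹)
  have hpi : (0:ℝ) < (2 * Real.pi)⁻¹ := by positivity
  have h3 : |((-(2 * Real.pi)⁻¹) ^ Module.finrank ℝ V)⁻¹| =
      (2 * Real.pi) ^ Module.finrank ℝ V := by
    rw [abs_inv, abs_pow, abs_neg, abs_of_pos hpi, inv_pow, inv_inv]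
  rw [h3, Complex.real_smul] at h2
  push_cast at h2 ⊢
  rw [← h2]
  refine integral_congr_ae (.of_forall fun x => ?_)
  simp only [expFourier_eq, smul_eq_mul]
  rw [mul_comm]
  congr 2
  rw [inner_smul_left, real_inner_comm]
  simp
  field_simp

theorem IsTestFunction.integral_expFourier {g : V → ℂ} {W : Set V} (hg : IsTestFunction g W) :
    ∫ x, expFourier g x = ((2 * Real.pi : ℝ) : ℂ) ^ Module.finrank ℝ V * g 0 := by
  rw [← hg.integral_expFourier_mul_exp 0]
  simp

theorem expFourier_comp_smul (g : V → ℂ) {c : ℝ} (hc : c ≠ 0) (x : V) :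
    expFourier (fun p => g (c • p)) x =
      |(c ^ Module.finrank ℝ V)⁻¹| • expFourier g (c⁻¹ • x) := by
  rw [expFourier, expFourier, ← Measure.integral_comp_smul]
  refine integral_congr_ae (.of_forall fun p => ?_)
  simp only [inner_smul_left, inner_smul_right]
  simp [hc]

theorem integral_expFourier_comp_smul_mul (g a : V → ℂ) {c : ℝ} (hc : c ≠ 0) :
    ∫ x, expFourier (fun p => g (c • p)) x * a x = ∫ x, expFourier g x * a (c • x) := by
  have h := Measure.integral_comp_smul (volume : Measure V)
    (fun x => expFourier g x * a (c • x)) c⁻¹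
  simp only [smul_inv_smul₀ hc] at h
  simp_rw [expFourier_comp_smul g hc, smul_mul_assoc]
  rw [integral_smul, h, smul_smul]
  rw [inv_pow, inv_inv, ← abs_mul, inv_mul_cancel₀ (pow_ne_zero _ hc)]
  simp

/-- Widening a cutoff turns its Fourier transform into an approximate delta function at the origin.
-/
theorem tendsto_integral_expFourier_mul {g : V → ℂ} {W : Set V} (hg : IsTestFunction g W)
    {a : V → ℂ} (ha : Continuous a) {C : ℝ} (hC : ∀ x, ‖a x‖ ≤ C) :
    Tendsto (fun n : ℕ => ∫ x, expFourier (fun p => g ((n + 1 : ℝ)⁻¹ • p)) x * a x) atTop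
      (𝓝 (((2 * Real.pi : ℝ) : ℂ) ^ Module.finrank ℝ V * g 0 * a 0)) := by
  simp_rw [fun n : ℕ => integral_expFourier_comp_smul_mul g a
    (c := (n + 1 : ℝ)⁻¹) (by positivity)]
  rw [← hg.integral_expFourier, ← integral_mul_const]
  refine tendsto_integral_of_dominated_convergence (fun x => ‖expFourier g x‖ * C)
    (fun n => ?_) (hg.integrable_expFourier.norm.mul_const _) (fun n => .of_forall fun x => ?_)
    (.of_forall fun x => ?_)
  · exact (hg.integrable_expFourier.aestronglyMeasurable).mul
      (ha.comp (continuous_const_smul _)).aestronglyMeasurable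
  · rw [norm_mul]; gcongr; exact hC _
  · refine tendsto_const_nhds.mul ((ha.tendsto' 0 _ rfl).comp ?_)
    have : Tendsto (fun n : ℕ => ((n : ℝ) + 1)⁻¹ • x) atTop (𝓝 ((0:ℝ) • x)) :=
      (tendsto_inv_atTop_zero.comp (tendsto_atTop_add_const_right _ _
        tendsto_natCast_atTop_atTop)).smul_const x
    simpa using this

end Fourier

end HaagKastler

namespace HaagKastler

/-! ### Fourier transforms on spacetime -/

section SpacetimeFourier

variable {s : ℕ}

/-- The Fourier transform `x ↦ ∫ G(p) e^{-i p·x} dp` with the Minkowski product. -/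
noncomputable def spacetimeFourier (G : Spacetime s → ℂ) (x : Spacetime s) : ℂ :=
  ∫ p : Spacetime s, G p * Complex.exp (-(Complex.I * (minkowski p x : ℂ)))

/-- Spacetime with the Euclidean inner product. -/
abbrev EuclideanSpacetime (s : ℕ) : Type := WithLp 2 (ℝ × Space s)

/-- The reflection `z ↦ (-z₀, 𝐳)`, which turns the Euclidean into the Minkowski product. -/
def timeReflection (z : EuclideanSpacetime s) : Spacetime s := (-z.fst, z.snd)

theorem measurePreserving_timeReflection :
    MeasurePreserving (timeReflection : EuclideanSpacetime s → Spacetime s) := by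
  have h1 : MeasurePreserving (fun z : Spacetime s => ((-z.1, z.2) : Spacetime s)) :=
    (Measure.measurePreserving_neg (volume : Measure ℝ)).prod
      (MeasurePreserving.id (volume : Measure (Space s)))
  exact h1.comp (WithLp.volume_preserving_ofLp ℝ (Space s))

theorem continuous_timeReflection :
    Continuous (timeReflection : EuclideanSpacetime s → Spacetime s) := by
  unfold timeReflection; fun_prop

theorem measurableEmbedding_timeReflection :
    MeasurableEmbedding (timeReflection : EuclideanSpacetime s → Spacetime s) := by
  refine continuous_timeReflection.measurableEmbedding fun a b h => ?_
  simp only [timeReflection, Prod.mk.injEq, neg_inj] at h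
  exact WithLp.ofLp_injective 2 (Prod.ext h.1 h.2)

theorem spacetimeFourier_timeReflection (G : Spacetime s → ℂ) (z : EuclideanSpacetime s) :
    spacetimeFourier G (timeReflection z) = expFourier (fun q => G q.ofLp) z := by
  rw [spacetimeFourier, expFourier, ← (WithLp.volume_preserving_ofLp ℝ (Space s)).integral_comp
    (MeasurableEquiv.toLp 2 (ℝ × Space s)).symm.measurableEmbedding]
  refine integral_congr_ae (.of_forall fun q => ?_)
  simp only [minkowski, timeReflection, WithLp.prod_inner_apply]
  congr 2
  rw [← mul_neg, ← Complex.ofReal_neg]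
  congr 2
  simp [mul_comm]
  ring

theorem integral_spacetimeFourier_mul (G a : Spacetime s → ℂ) :
    ∫ y, spacetimeFourier G y * a y =
      ∫ z : EuclideanSpacetime s, expFourier (fun q => G q.ofLp) z * a (timeReflection z) := by
  rw [← measurePreserving_timeReflection.integral_comp measurableEmbedding_timeReflection]
  simp_rw [spacetimeFourier_timeReflection]

theorem IsTestFunction.comp_ofLp {G : Spacetime s → ℂ} {W : Set (Spacetime s)}
    (hG : IsTestFunction G W) :
    IsTestFunction (fun q : EuclideanSpacetime s => G q.ofLp) univ := by
  have := hG.comp_homeomorph (WithLp.prodContinuousLinearEquiv 2 ℝ ℝ (Space s)).toHomeomorph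
    (WithLp.prodContinuousLinearEquiv 2 ℝ ℝ (Space s)).contDiff
  exact this.mono (subset_univ _)

theorem IsTestFunction.integrable_spacetimeFourier {G : Spacetime s → ℂ}
    {W : Set (Spacetime s)} (hG : IsTestFunction G W) : Integrable (spacetimeFourier G) := by
  rw [← measurePreserving_timeReflection.integrable_comp_emb measurableEmbedding_timeReflection]
  refine hG.comp_ofLp.integrable_expFourier.congr (.of_forall fun z => ?_)
  exact (spacetimeFourier_timeReflection G z).symm

theorem IsTestFunction.integral_spacetimeFourier {G : Spacetime s → ℂ}
    {W : Set (Spacetime s)} (hG : IsTestFunction G W) :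
    ∫ y, spacetimeFourier G y = ((2 * Real.pi : ℝ) : ℂ) ^ (s + 1) * G 0 := by
  have h := integral_spacetimeFourier_mul G 1
  simp only [Pi.one_apply, mul_one] at h
  rw [h, hG.comp_ofLp.integral_expFourier]
  congr 2
  have : Module.finrank ℝ (EuclideanSpacetime s) = Module.finrank ℝ (ℝ × Space s) :=
    (WithLp.linearEquiv 2 ℝ (ℝ × Space s)).finrank_eq
  rw [this]
  simp [add_comm]

theorem integral_spacetimeFourier_comp_smul_mul (G a : Spacetime s → ℂ) {c : ℝ} (hc : c ≠ 0) :
    ∫ y, spacetimeFourier (fun p => G (c • p)) y * a y =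
      ∫ y, spacetimeFourier G y * a (c • y) := by
  rw [integral_spacetimeFourier_mul, integral_spacetimeFourier_mul]
  have h := integral_expFourier_comp_smul_mul (fun q : EuclideanSpacetime s => G q.ofLp)
    (fun z => a (timeReflection z)) hc
  simp only [WithLp.ofLp_smul] at h
  rw [h]
  refine integral_congr_ae (.of_forall fun z => ?_)
  simp [timeReflection]

theorem spacetimeFourier_mul (g : ℝ → ℂ) (w : Space s → ℂ) (x : Spacetime s) :
    spacetimeFourier (fun p => g p.1 * w p.2) x = expFourier g (-x.1) * expFourier w x.2 := by
  rw [spacetimeFourier, expFourier, expFourier, ← integral_prod_mul]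
  refine integral_congr_ae (.of_forall fun p => ?_)
  simp only [minkowski]
  rw [mul_mul_mul_comm, ← Complex.exp_add]
  congr 2
  simp
  ring

theorem norm_exp_minkowski (p x : Spacetime s) :
    ‖Complex.exp (-(Complex.I * (minkowski p x : ℂ)))‖ = 1 := by
  rw [← mul_neg, mul_comm, ← Complex.ofReal_neg, Complex.norm_exp_ofReal_mul_I]

theorem spacetimeFourier_add {G K : Spacetime s → ℂ} (hG : Integrable G) (hK : Integrable K)
    (x : Spacetime s) :
    spacetimeFourier (G + K) x = spacetimeFourier G x + spacetimeFourier K x := by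
  have hint : ∀ {G : Spacetime s → ℂ}, Integrable G → Integrable fun p : Spacetime s =>
      G p * Complex.exp (-(Complex.I * (minkowski p x : ℂ))) := fun hG => by
    refine hG.mul_of_top_left (memLp_top_of_bound (C := 1) ?_ (.of_forall fun p => ?_))
    · exact Continuous.aestronglyMeasurable (by unfold minkowski; fun_prop)
    · rw [norm_exp_minkowski]
  simp only [spacetimeFourier, Pi.add_apply, add_mul]
  exact integral_add (hint hG) (hint hK)

theorem continuous_spacetimeFourier {G : Spacetime s → ℂ} (hG : Integrable G) :
    Continuous (spacetimeFourier G) := by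
  refine continuous_of_dominated (bound := fun p => ‖G p‖) (fun x => ?_) (fun x => ?_) hG.norm ?_
  · exact hG.aestronglyMeasurable.mul
      (Continuous.aestronglyMeasurable (by unfold minkowski; fun_prop))
  · refine .of_forall fun p => ?_
    rw [norm_mul, norm_exp_minkowski, mul_one]
  · exact .of_forall fun p => by unfold minkowski; fun_prop

theorem Integrable.mul_continuous_bounded {X : Type*} [TopologicalSpace X] [MeasurableSpace X]
    [OpensMeasurableSpace X] [SecondCountableTopology X] {μ : Measure X} {f a : X → ℂ}
    (hf : Integrable f μ) (ha : Continuous a) {C : ℝ} (hC : ∀ x, ‖a x‖ ≤ C) :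
    Integrable (fun x => f x * a x) μ :=
  hf.mul_of_top_left (memLp_top_of_bound (C := C) ha.aestronglyMeasurable (.of_forall hC))

end SpacetimeFourier

/-! ### Vanishing of distributions off their support -/

section Support

variable {s : ℕ} {H : Type*} [NormedAddCommGroup H] [InnerProductSpace ℂ H]

/-- The definition of the support gives vanishing near each single point; the sheaf property makes
it global on `W`. -/
theorem integral_spacetimeFourier_eq_zero (F : Spacetime s → H →L[ℂ] H)
    (hF : ∀ φ χ, Continuous fun x => inner ℂ φ (F x χ))
    (hFb : ∀ φ χ, ∃ C : ℝ, ∀ x, ‖inner ℂ φ (F x χ)‖ ≤ C)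
    {G : Spacetime s → ℂ} {W : Set (Spacetime s)} (hG : IsTestFunction G W)
    (hW : ∀ p ∈ W, p ∉ fourierSupport F) (φ χ : H) :
    ∫ x, spacetimeFourier G x * inner ℂ φ (F x χ) = 0 := by
  obtain ⟨C, hC⟩ := hFb φ χ
  refine eq_zero_of_locally_eq_zero
    (fun G => ∫ x, spacetimeFourier G x * inner ℂ φ (F x χ)) ?_ ?_ (W := W) ?_ hG
  · simp [spacetimeFourier]
  · intro g h hg hh
    rw [← integral_add (Integrable.mul_continuous_bounded hg.integrable_spacetimeFourier (hF φ χ) hC)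
      (Integrable.mul_continuous_bounded hh.integrable_spacetimeFourier (hF φ χ) hC)]
    refine integral_congr_ae (.of_forall fun x => ?_)
    simp only
    rw [spacetimeFourier_add (hg.integrable _) (hh.integrable _), add_mul]
  · intro p hp
    have := hW p hp
    simp only [fourierSupport, mem_ofPred_eq, not_forall] at this
    obtain ⟨V, hV, hpV, h⟩ := this
    refine ⟨V, hV, hpV, fun g hg => ?_⟩
    by_contra hne
    refine h ⟨g, hg.1, hg.2, hg.3, φ, χ, ?_⟩
    refine mul_ne_zero (pow_ne_zero _ (inv_ne_zero ?_)) hne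
    exact_mod_cast (by positivity : (2 * Real.pi : ℝ) ≠ 0)

/-- The inverse Fourier transform of `a` vanishes on `W`. -/
def VanishesOn (a : ℝ → ℂ) (W : Set ℝ) : Prop :=
  ∀ g, IsTestFunction g W → ∫ t, expFourier g (-t) * a t = 0

theorem VanishesOn.mono {a : ℝ → ℂ} {W W' : Set ℝ} (h : VanishesOn a W) (hW : W' ⊆ W) :
    VanishesOn a W' := fun g hg => h g (hg.mono hW)

theorem exists_bump (E : Type*) [NormedAddCommGroup E] [NormedSpace ℝ E]
    [FiniteDimensional ℝ E] : ∃ χ : E → ℂ, IsTestFunction χ univ ∧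
      ∃ δ > 0, ∀ x ∈ Metric.ball (0 : E) δ, χ x = 1 := by
  obtain ⟨χ, hχ, N, hN, h0, h1⟩ := exists_testFunction_eq_one (isCompact_singleton (x := (0 : E)))
    isOpen_univ (subset_univ _)
  obtain ⟨δ, hδ, hb⟩ := Metric.isOpen_iff.1 hN 0 (h0 rfl)
  exact ⟨χ, hχ, δ, hδ, fun x hx => h1 x (hb hx)⟩

theorem IsTestFunction.prod_mul {g : ℝ → ℂ} {w : Space s → ℂ} {W : Set ℝ} {W' : Set (Space s)}
    (hg : IsTestFunction g W) (hw : IsTestFunction w W') :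
    IsTestFunction (fun p : Spacetime s => g p.1 * w p.2) (W ×ˢ W') := by
  have hsub : tsupport (fun p : Spacetime s => g p.1 * w p.2) ⊆ tsupport g ×ˢ tsupport w := by
    refine closure_minimal (fun p hp => ?_) ((isClosed_tsupport g).prod (isClosed_tsupport w))
    exact ⟨subset_tsupport g (left_ne_zero_of_mul hp), subset_tsupport w (right_ne_zero_of_mul hp)⟩
  refine ⟨(hg.1.comp contDiff_fst).mul (hw.1.comp contDiff_snd),
    (hg.2.isCompact.prod hw.2.isCompact).of_isClosed_subset (isClosed_tsupport _) hsub,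
    hsub.trans (prod_mono hg.3 hw.3)⟩

/-- Energy support: only the energy component of the Fourier support matters for the restriction
to the time axis. -/
theorem vanishesOn_of_fourierSupport (F : Spacetime s → H →L[ℂ] H)
    (hF : ∀ φ χ, Continuous fun x => inner ℂ φ (F x χ))
    (hFb : ∀ φ χ, ∃ C : ℝ, ∀ x, ‖inner ℂ φ (F x χ)‖ ≤ C) {W : Set ℝ}
    (hW : ∀ p : Spacetime s, p.1 ∈ W → p ∉ fourierSupport F) (φ χ : H) :
    VanishesOn (fun t => inner ℂ φ (F (t, 0) χ)) W := by
  intro g hg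
  obtain ⟨C, hC⟩ := hFb φ χ
  obtain ⟨w, hw, δ, hδ, hw1⟩ := exists_bump (Space s)
  set a : Spacetime s → ℂ := fun y => inner ℂ φ (F y χ) with ha
  have hac : Continuous a := hF φ χ
  have hgi : Integrable fun t => expFourier g (-t) := hg.integrable_expFourier.comp_neg
  -- Smeared in time only, the matrix element is a function of space whose value at `0` is wanted.
  -- Momentum cutoffs `w(p / (n + 1))` concentrate the spatial integral there.
  set b : Space s → ℂ := fun x => ∫ t, expFourier g (-t) * a (t, x) with hb
  have hbc : Continuous b := by
    refine continuous_of_dominated (bound := fun t => ‖expFourier g (-t)‖ * C) (fun x => ?_)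
      (fun x => .of_forall fun t => ?_) (hgi.norm.mul_const _) (.of_forall fun t => ?_)
    · exact hgi.aestronglyMeasurable.mul (Continuous.aestronglyMeasurable (by fun_prop))
    · rw [norm_mul]; gcongr; exact hC _
    · fun_prop
  have hbb : ∀ x, ‖b x‖ ≤ ∫ t, ‖expFourier g (-t)‖ * C := fun x => by
    refine norm_integral_le_of_norm_le (hgi.norm.mul_const _) (.of_forall fun t => ?_)
    rw [norm_mul]; gcongr; exact hC _
  have hlim := tendsto_integral_expFourier_mul hw hbc hbb
  have hzero : ∀ n : ℕ, ∫ x, expFourier (fun p => w ((n + 1 : ℝ)⁻¹ • p)) x * b x = 0 := by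
    intro n
    have hwn : IsTestFunction (fun p => w ((n + 1 : ℝ)⁻¹ • p)) univ :=
      hw.comp_smul (by positivity)
    have := integral_spacetimeFourier_eq_zero F hF hFb (hg.prod_mul hwn)
      (fun p hp => hW p hp.1) φ χ
    simp_rw [spacetimeFourier_mul g (fun p => w ((n + 1 : ℝ)⁻¹ • p))] at this
    rw [← this]
    have hprod : Integrable (fun z : Spacetime s => (expFourier g (-z.1) *
        expFourier (fun p => w ((n + 1 : ℝ)⁻¹ • p)) z.2) * a z) :=
      Integrable.mul_continuous_bounded (hgi.mul_prod hwn.integrable_expFourier) hac hC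
    rw [Measure.volume_eq_prod, integral_prod_symm _ hprod]
    refine integral_congr_ae (.of_forall fun x => ?_)
    simp only [hb]
    rw [← integral_const_mul]
    refine integral_congr_ae (.of_forall fun t => ?_)
    simp only
    ring
  simp_rw [hzero] at hlim
  have := tendsto_nhds_unique hlim tendsto_const_nhds
  rw [hw1 0 (Metric.mem_ball_self hδ)] at this
  have hpi : ((2 * Real.pi : ℝ) : ℂ) ^ Module.finrank ℝ (Space s) ≠ 0 :=
    pow_ne_zero _ (by exact_mod_cast (by positivity : (2 * Real.pi : ℝ) ≠ 0))
  simpa [hpi] using this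

theorem expFourier_add {V : Type*} [NormedAddCommGroup V] [InnerProductSpace ℝ V]
    [FiniteDimensional ℝ V] [MeasurableSpace V] [BorelSpace V] {g h : V → ℂ} (hg : Integrable g)
    (hh : Integrable h) (x : V) : expFourier (g + h) x = expFourier g x + expFourier h x := by
  have hint : ∀ {g : V → ℂ}, Integrable g → Integrable fun p : V =>
      g p * Complex.exp (Complex.I * (inner ℝ p x : ℝ)) := fun hg =>
    Integrable.mul_continuous_bounded hg (by fun_prop) (C := 1) fun p => by
      rw [mul_comm Complex.I, Complex.norm_exp_ofReal_mul_I]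
  simp only [expFourier, Pi.add_apply, add_mul]
  exact integral_add (hint hg) (hint hh)

theorem VanishesOn.union {a : ℝ → ℂ} (ha : Continuous a) {C : ℝ} (hC : ∀ t, ‖a t‖ ≤ C)
    {W W' : Set ℝ} (hW : IsOpen W) (hW' : IsOpen W') (h : VanishesOn a W) (h' : VanishesOn a W') :
    VanishesOn a (W ∪ W') := by
  intro g hg
  obtain ⟨g₁, g₂, h₁, h₂, rfl⟩ := hg.exists_add_of_union hW hW'
  simp_rw [expFourier_add (h₁.integrable _) (h₂.integrable _), add_mul]
  rw [integral_add (Integrable.mul_continuous_bounded h₁.integrable_expFourier.comp_neg ha hC)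
    (Integrable.mul_continuous_bounded h₂.integrable_expFourier.comp_neg ha hC), h g₁ h₁,
    h' g₂ h₂, add_zero]

/-- Multiplication by `e^{iEt}` translates the energy support by `E`. -/
theorem VanishesOn.modulate {a : ℝ → ℂ} {W : Set ℝ} (h : VanishesOn a W) (E : ℝ) {g : ℝ → ℂ}
    (hg : IsTestFunction g ((fun p => p - E) ⁻¹' W)) :
    ∫ t, expFourier g (-t) * (Complex.exp (Complex.I * (E * t : ℝ)) * a t) = 0 := by
  have hg' : IsTestFunction (fun p => g (p + E)) W := by
    refine (hg.comp_homeomorph (Homeomorph.addRight E) (by simp; fun_prop)).mono fun p hp => ?_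
    simpa using hp
  rw [← h _ hg']
  refine integral_congr_ae (.of_forall fun t => ?_)
  simp only
  rw [← mul_assoc]
  congr 1
  rw [expFourier, expFourier, ← integral_add_right_eq_self _ E, ← integral_mul_const]
  refine integral_congr_ae (.of_forall fun p => ?_)
  simp only
  rw [mul_assoc, ← Complex.exp_add]
  congr 2
  simp
  ring

/-- A reproducing formula: `g` is one near the bounded energy support of `a`, so it may be exchanged
for arbitrarily wide cutoffs, whose transforms concentrate at `t = 0`. -/
theorem VanishesOn.integral_eq {a : ℝ → ℂ} (ha : Continuous a) {C : ℝ} (hC : ∀ t, ‖a t‖ ≤ C)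
    {W N : Set ℝ} (h : VanishesOn a W) (hN : IsOpen N) (hWN : ∀ p, p ∈ W ∨ p ∈ N)
    (hb : Bornology.IsBounded Wᶜ) {g : ℝ → ℂ} (hg : IsTestFunction g univ)
    (hg1 : ∀ p ∈ N, g p = 1) :
    ∫ t, expFourier g (-t) * a t = 2 * Real.pi * a 0 := by
  obtain ⟨χ, hχ, δ, hδ, hχ1⟩ := exists_bump ℝ
  have hlim := tendsto_integral_expFourier_mul hχ (a := fun t => a (-t)) (by fun_prop)
    (fun t => hC _)
  obtain ⟨R, hR⟩ := hb.subset_ball 0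
  have hev : ∀ᶠ n : ℕ in atTop, ∫ t, expFourier (fun p => χ ((n + 1 : ℝ)⁻¹ • p)) t * a (-t) =
      ∫ t, expFourier g (-t) * a t := by
    obtain ⟨n₀, hn₀⟩ := exists_nat_gt (R / δ)
    filter_upwards [eventually_ge_atTop n₀] with n hn
    have hχn : IsTestFunction (fun p => χ ((n + 1 : ℝ)⁻¹ • p)) univ :=
      hχ.comp_smul (by positivity)
    -- Near a point outside `W` both functions are equal to one, the wide cutoff because `n + 1 > R
    -- / δ`.
    have hd : IsTestFunction ((fun p => χ ((n + 1 : ℝ)⁻¹ • p)) - g) W := by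
      refine ⟨(hχn.sub hg).1, (hχn.sub hg).2, fun p hp => ?_⟩
      by_contra hpW
      refine notMem_tsupport_iff_eventuallyEq.2 ?_ hp
      filter_upwards [hN.mem_nhds ((hWN p).resolve_left hpW),
        Metric.isOpen_ball.mem_nhds (hR hpW)] with q hq hqR
      have : χ ((n + 1 : ℝ)⁻¹ • q) = 1 := by
        refine hχ1 _ ?_
        rw [mem_ball_zero_iff] at hqR ⊢
        rw [norm_smul, norm_inv, Real.norm_of_nonneg (by positivity), inv_mul_lt_iff₀ (by positivity)]
        have : (n₀ : ℝ) ≤ n := by exact_mod_cast hn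
        rw [div_lt_iff₀ hδ] at hn₀
        nlinarith
      simp only [Pi.sub_apply, this, hg1 q hq, sub_self, Pi.zero_apply]
    have h0 := h _ hd
    have hsplit : (fun p => χ ((n + 1 : ℝ)⁻¹ • p)) =
        ((fun p => χ ((n + 1 : ℝ)⁻¹ • p)) - g) + g := by simp
    rw [← integral_neg_eq_self (fun t => expFourier (fun p => χ ((n + 1 : ℝ)⁻¹ • p)) t * a (-t))]
    simp only [neg_neg]
    rw [hsplit]
    simp_rw [expFourier_add (hd.integrable _) (hg.integrable _), add_mul]
    rw [integral_add (Integrable.mul_continuous_bounded hd.integrable_expFourier.comp_neg ha hC)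
      (Integrable.mul_continuous_bounded hg.integrable_expFourier.comp_neg ha hC), h0, zero_add]
  have := tendsto_nhds_unique (hlim.congr' hev) tendsto_const_nhds
  rw [← this, hχ1 0 (Metric.mem_ball_self hδ)]
  simp

end Support

end HaagKastler

/-! ### The translation group, the vacuum and the mass gap. -/

namespace HaagKastler

/-- Continuity of translations in `L¹`. It serves to show that a vector with spectral support at the
origin is translation invariant. -/
theorem tendsto_integral_norm_add_sub {V : Type*} [NormedAddCommGroup V] [NormedSpace ℝ V]
    [FiniteDimensional ℝ V] [MeasurableSpace V] [BorelSpace V] (μ : Measure V)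
    [μ.IsAddHaarMeasure] {f : V → ℂ} (hf : Integrable f μ) :
    Tendsto (fun h => ∫ y, ‖f (y + h) - f y‖ ∂μ) (𝓝 0) (𝓝 0) := by
  have hc : Continuous fun h : V => (⟨fun y => y + h, by fun_prop⟩ : C(V, V)) :=
    ContinuousMap.continuous_of_continuous_uncurry _ (continuous_snd.add continuous_fst)
  have hm : ∀ h : V, MeasurePreserving ((⟨fun y => y + h, by fun_prop⟩ : C(V, V)) : V → V) μ μ :=
    fun h => measurePreserving_add_right μ h
  have hf1 : MemLp f 1 μ := memLp_one_iff_integrable.2 hf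
  have h1 := (tendsto_const_nhds (x := hf1.toLp f)).compMeasurePreservingLp (hc.tendsto 0) hm
    (hm 0) (by simp)
  have h2 := (h1.sub (tendsto_const_nhds (x := hf1.toLp f))).norm
  have h3 : ∀ h, Lp.compMeasurePreserving _ (hm h) (hf1.toLp f) - hf1.toLp f =
      ((hf1.comp_measurePreserving (hm h)).sub hf1).toLp _ := fun h => by
    rw [Lp.toLp_compMeasurePreserving hf1 (hm h), ← MemLp.toLp_sub]
  have h4 : ∀ h, ‖Lp.compMeasurePreserving _ (hm h) (hf1.toLp f) - hf1.toLp f‖ =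
      ∫ y, ‖f (y + h) - f y‖ ∂μ := fun h => by
    rw [h3, Lp.norm_toLp, eLpNorm_one_eq_lintegral_enorm, ← integral_norm_eq_lintegral_enorm]
    · rfl
    · exact ((hf1.comp_measurePreserving (hm h)).sub hf1).1
  simp_rw [h4] at h2
  simpa using h2

instance (s : ℕ) : (volume : Measure (Spacetime s)).IsAddHaarMeasure :=
  inferInstanceAs (Measure.IsAddHaarMeasure ((volume : Measure ℝ).prod (volume : Measure (Space s))))

namespace VacuumSector

variable {s : ℕ} {m : ℝ} {𝒜 : Type*} [CStarAlgebra 𝒜]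
  {H : Type*} [NormedAddCommGroup H] [InnerProductSpace ℂ H] [CompleteSpace H]

/-- The unitary `U(x)` as an operator. -/
noncomputable def shift (Q : VacuumSector s m 𝒜 H) (x : Spacetime s) : H →L[ℂ] H :=
  (Q.U (.ofAdd x) : H →L[ℂ] H)

variable (Q : VacuumSector s m 𝒜 H)

theorem shift_zero : Q.shift 0 = 1 := by
  simp [shift]

theorem shift_add (x y : Spacetime s) : Q.shift (x + y) = Q.shift x * Q.shift y := by
  simp [shift, ofAdd_add]

theorem shift_add_apply (x y : Spacetime s) (χ : H) :
    Q.shift (x + y) χ = Q.shift x (Q.shift y χ) := by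
  rw [shift_add]; rfl

theorem shift_neg_mul_shift (x : Spacetime s) : Q.shift (-x) * Q.shift x = 1 := by
  rw [← shift_add, neg_add_cancel, shift_zero]

theorem star_shift (x : Spacetime s) : star (Q.shift x) = Q.shift (-x) := by
  rw [shift, shift, ofAdd_neg, map_inv, ← Unitary.star_eq_inv, Unitary.coe_star]

theorem inner_shift_left (x : Spacetime s) (φ χ : H) :
    inner ℂ (Q.shift x φ) χ = inner ℂ φ (Q.shift (-x) χ) := by
  rw [← star_shift, ContinuousLinearMap.star_eq_adjoint, ContinuousLinearMap.adjoint_inner_right]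

theorem inner_shift_right (x : Spacetime s) (φ χ : H) :
    inner ℂ φ (Q.shift x χ) = inner ℂ (Q.shift (-x) φ) χ := by
  rw [inner_shift_left, neg_neg]

theorem norm_shift_apply (x : Spacetime s) (χ : H) : ‖Q.shift x χ‖ = ‖χ‖ := by
  have h : inner ℂ (Q.shift x χ) (Q.shift x χ) = inner ℂ χ χ := by
    rw [inner_shift_left, ← shift_add_apply, neg_add_cancel, shift_zero]; rfl
  rw [inner_self_eq_norm_sq_to_K, inner_self_eq_norm_sq_to_K] at h
  have h' : ‖Q.shift x χ‖ ^ 2 = ‖χ‖ ^ 2 := by exact_mod_cast h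
  exact (pow_left_inj₀ (norm_nonneg _) (norm_nonneg _) two_ne_zero).1 h'

theorem norm_shift_le (x : Spacetime s) : ‖Q.shift x‖ ≤ 1 :=
  ContinuousLinearMap.opNorm_le_bound _ zero_le_one fun χ => by rw [norm_shift_apply, one_mul]

theorem continuous_shift {X : Type*} [TopologicalSpace X] {f : X → Spacetime s} {v : X → H}
    (hf : Continuous f) (hv : Continuous v) : Continuous fun z => Q.shift (f z) (v z) := by
  rw [continuous_iff_continuousAt]
  intro z₀
  rw [ContinuousAt, tendsto_iff_norm_sub_tendsto_zero]
  have h1 : Tendsto (fun z => ‖v z - v z₀‖ + ‖Q.shift (f z) (v z₀) - Q.shift (f z₀) (v z₀)‖)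
      (𝓝 z₀) (𝓝 (0 + 0)) := by
    refine (tendsto_iff_norm_sub_tendsto_zero.1 hv.continuousAt).add
      (tendsto_iff_norm_sub_tendsto_zero.1 ?_)
    exact ((Q.U_continuous (v z₀)).comp hf).tendsto z₀
  rw [add_zero] at h1
  refine squeeze_zero (fun _ => norm_nonneg _) (fun z => ?_) h1
  rw [← Q.norm_shift_apply (f z) (v z - v z₀), map_sub]
  convert! norm_add_le _ _ using 2
  abel

theorem norm_inner_shift_le (φ χ : H) (x : Spacetime s) :
    ‖inner ℂ φ (Q.shift x χ)‖ ≤ ‖φ‖ * ‖χ‖ :=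
  (norm_inner_le_norm _ _).trans_eq (by rw [norm_shift_apply])

theorem translate_eq (A : H →L[ℂ] H) (x : Spacetime s) :
    Q.translate A x = Q.shift x * A * Q.shift (-x) := by
  rw [← star_shift]; rfl

theorem translate_apply (A : H →L[ℂ] H) (x : Spacetime s) (χ : H) :
    Q.translate A x χ = Q.shift x (A (Q.shift (-x) χ)) := by
  rw [translate_eq]; rfl

theorem shift_Ω (x : Spacetime s) : Q.shift x Q.Ω = Q.Ω :=
  (Q.vacuum_unique Q.Ω).2 ⟨1, by simp⟩ x

theorem inner_Ω_Ω : inner ℂ Q.Ω Q.Ω = (1 : ℂ) := by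
  have := Q.ρ_eq 1
  rw [Q.ρ_one, map_one] at this
  exact this.symm

theorem norm_Ω : ‖Q.Ω‖ = 1 := by
  have h := Q.inner_Ω_Ω
  rw [inner_self_eq_norm_sq_to_K] at h
  have h' : ‖Q.Ω‖ ^ 2 = 1 := by
    apply Complex.ofReal_injective
    push_cast
    exact h
  exact (pow_eq_one_iff_of_nonneg (norm_nonneg _) two_ne_zero).1 h'

/-! ### Energy support -/

/-- The mass gap: the form in which the spectrum condition enters the proof. -/
theorem le_of_mem_jointSpectrum {p : Spacetime s} (hp : p ∈ jointSpectrum Q.U) :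
    p = 0 ∨ m ≤ p.1 := by
  have hm := Q.mass_pos
  rcases Q.spectrum_subset hp with (h | h) | h
  · exact .inl h
  · right
    rw [show p.1 = _ from h]
    exact Real.le_sqrt_of_sq_le (by nlinarith [sq_nonneg ‖p.2‖])
  · right
    refine le_trans (Real.le_sqrt_of_sq_le ?_) (show _ ≤ p.1 from h)
    nlinarith [sq_nonneg ‖p.2‖]

theorem integral_spacetimeFourier_shift_eq_zero {G : Spacetime s → ℂ}
    (hG : IsTestFunction G {p | p.1 < m ∧ p ≠ 0}) (φ χ : H) :
    ∫ x, spacetimeFourier G x * inner ℂ φ (Q.shift x χ) = 0 := by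
  refine integral_spacetimeFourier_eq_zero Q.shift (fun φ χ => ?_)
    (fun φ χ => ⟨_, Q.norm_inner_shift_le φ χ⟩) hG (fun p hp h => ?_) φ χ
  · exact continuous_const.inner (Q.continuous_shift continuous_id continuous_const)
  · rcases Q.le_of_mem_jointSpectrum h with h' | h'
    · exact hp.2 h'
    · exact absurd hp.1 (not_lt.2 h')

theorem continuous_inner_shift_time (φ χ : H) :
    Continuous fun t : ℝ => inner ℂ φ (Q.shift (t, 0) χ) :=
  continuous_const.inner (Q.continuous_shift (by fun_prop) continuous_const)

theorem vanishesOn_shift (φ χ : H) :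
    VanishesOn (fun t => inner ℂ φ (Q.shift (t, 0) χ)) {E | E < m ∧ E ≠ 0} := by
  refine vanishesOn_of_fourierSupport Q.shift (fun φ χ => ?_)
    (fun φ χ => ⟨_, Q.norm_inner_shift_le φ χ⟩) (fun p hp h => ?_) φ χ
  · exact continuous_const.inner (Q.continuous_shift continuous_id continuous_const)
  · rcases Q.le_of_mem_jointSpectrum h with h' | h'
    · exact hp.2 (by rw [h']; rfl)
    · exact absurd hp.1 (not_lt.2 h')

/-- Convolution in time is multiplication by `g(p₀)` in momentum space. -/
theorem integral_expFourier_mul_spacetimeFourier_sub {g : ℝ → ℂ} {W : Set ℝ}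
    (hg : IsTestFunction g W) {G : Spacetime s → ℂ} (hG : Integrable G) (y : Spacetime s) :
    ∫ t, expFourier g (-t) * spacetimeFourier G (y - (t, 0)) =
      2 * Real.pi * spacetimeFourier (fun p => g p.1 * G p) y := by
  have hgi : Integrable fun t => expFourier g (-t) := hg.integrable_expFourier.comp_neg
  have hint : Integrable (fun z : ℝ × Spacetime s => (expFourier g (-z.1) * G z.2) *
      (Complex.exp (-(Complex.I * (minkowski z.2 (y - (z.1, 0)) : ℂ)))))
      (volume.prod volume) :=
    Integrable.mul_continuous_bounded (hgi.mul_prod hG) (by unfold minkowski; fun_prop) (C := 1)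
      fun z => (norm_exp_minkowski _ _).le
  have h1 : ∫ t, expFourier g (-t) * spacetimeFourier G (y - (t, 0)) =
      ∫ t, ∫ p, (expFourier g (-t) * G p) *
        (Complex.exp (-(Complex.I * (minkowski p (y - (t, 0)) : ℂ)))) := by
    refine integral_congr_ae (.of_forall fun t => ?_)
    simp only [spacetimeFourier]
    rw [← integral_const_mul]
    simp_rw [mul_assoc]
  rw [h1, integral_integral_swap hint, spacetimeFourier, ← integral_const_mul]
  refine integral_congr_ae (.of_forall fun p => ?_)
  have h2 := hg.integral_expFourier_mul_exp p.1
  rw [← integral_neg_eq_self] at h2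
  simp only [Module.finrank_self, pow_one] at h2
  calc _ = ∫ t, (expFourier g (-t) * Complex.exp (-(Complex.I * (inner ℝ p.1 (-t) : ℝ)))) *
        (G p * Complex.exp (-(Complex.I * (minkowski p y : ℂ)))) := by
        refine integral_congr_ae (.of_forall fun t => ?_)
        simp only
        rw [mul_mul_mul_comm, ← Complex.exp_add, mul_assoc, mul_assoc]
        congr 3
        simp [minkowski]
        ring
    _ = _ := by
        rw [integral_mul_const, h2]
        push_cast
        ring

/-- The integrals `I c η` do not depend on `c > 0`, since two rescaled cutoffs agree near the
origin, where the spectral support lies. Small `c` evaluates them as a multiple of `⟨η, ξ⟩`. For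
large `c` a translation by `x` displaces the kernel by only `x / c`, which is negligible in `L¹`.
Hence `ξ` is invariant, and the vacuum is unique. -/
theorem eq_smul_Ω_of_integral_eq_zero {ξ : H}
    (h : ∀ G : Spacetime s → ℂ, IsTestFunction G {0}ᶜ → ∀ η : H,
      ∫ y, spacetimeFourier G y * inner ℂ η (Q.shift y ξ) = 0) : ∃ c : ℂ, ξ = c • Q.Ω := by
  obtain ⟨G, hG, δ, hδ, hG1⟩ := exists_bump (Spacetime s)
  set I : ℝ → H → ℂ := fun c η => ∫ y, spacetimeFourier G y * inner ℂ η (Q.shift (c • y) ξ) with hI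
  have hcont : ∀ η : H, Continuous fun y => inner ℂ η (Q.shift y ξ) := fun η =>
    continuous_const.inner (Q.continuous_shift continuous_id continuous_const)
  have hbd : ∀ η : H, ∀ y, ‖inner ℂ η (Q.shift y ξ)‖ ≤ ‖η‖ * ‖ξ‖ := fun η y =>
    Q.norm_inner_shift_le η ξ y
  have hGi := hG.integrable_spacetimeFourier
  have hconst : ∀ c > 0, ∀ η, I c η = I 1 η := by
    intro c hc η
    have hGc : IsTestFunction (fun p => G (c • p)) univ := hG.comp_smul hc.ne'
    have hd : IsTestFunction ((fun p => G (c • p)) - G) {0}ᶜ := by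
      refine ⟨(hGc.sub hG).1, (hGc.sub hG).2, fun p hp hp0 => ?_⟩
      rw [mem_singleton_iff] at hp0
      subst hp0
      refine notMem_tsupport_iff_eventuallyEq.2 ?_ hp
      have hc0 : Tendsto (fun p : Spacetime s => c • p) (𝓝 0) (𝓝 0) :=
        (continuous_const_smul c).tendsto' _ _ (smul_zero c)
      filter_upwards [Metric.ball_mem_nhds (0 : Spacetime s) hδ,
        hc0 (Metric.ball_mem_nhds (0 : Spacetime s) hδ)] with q hq hq'
      simp only [Pi.sub_apply, hG1 q hq, hG1 (c • q) hq', sub_self, Pi.zero_apply]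
    have h0 := h _ hd η
    have hsplit : (fun p => G (c • p)) = ((fun p => G (c • p)) - G) + G := by simp
    have hA := integral_spacetimeFourier_comp_smul_mul G (fun y => inner ℂ η (Q.shift y ξ)) hc.ne'
    simp only [hI]
    rw [← hA, hsplit]
    simp_rw [spacetimeFourier_add (hd.integrable _) (hG.integrable _), add_mul]
    rw [integral_add
      (Integrable.mul_continuous_bounded hd.integrable_spacetimeFourier (hcont η) (hbd η))
      (Integrable.mul_continuous_bounded hGi (hcont η) (hbd η)), h0, zero_add]
    simp
  set K : ℂ := ((2 * Real.pi : ℝ) : ℂ) ^ (s + 1) with hK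
  have hK0 : K ≠ 0 :=
    pow_ne_zero _ (by exact_mod_cast (by positivity : (2 * Real.pi : ℝ) ≠ 0))
  have hI1 : ∀ η, I 1 η = K * inner ℂ η ξ := by
    intro η
    have hG0 : ∫ y, spacetimeFourier G y = K := by
      rw [hG.integral_spacetimeFourier, hG1 0 (Metric.mem_ball_self hδ), mul_one]
    have hlim : Tendsto (fun n : ℕ => I ((n : ℝ) + 1)⁻¹ η) atTop (𝓝 (K * inner ℂ η ξ)) := by
      rw [← hG0, ← integral_mul_const]
      refine tendsto_integral_of_dominated_convergence
        (fun x => ‖spacetimeFourier G x‖ * (‖η‖ * ‖ξ‖)) (fun n => ?_) (hGi.norm.mul_const _)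
        (fun n => .of_forall fun x => ?_) (.of_forall fun x => ?_)
      · exact hGi.aestronglyMeasurable.mul
          ((hcont η).comp (continuous_const_smul _)).aestronglyMeasurable
      · rw [norm_mul]; gcongr; exact hbd _ _
      · refine tendsto_const_nhds.mul (((hcont η).tendsto' 0 _ (by simp [shift_zero])).comp ?_)
        have : Tendsto (fun n : ℕ => ((n : ℝ) + 1)⁻¹ • x) atTop (𝓝 ((0:ℝ) • x)) :=
          (tendsto_inv_atTop_zero.comp (tendsto_atTop_add_const_right _ _
            tendsto_natCast_atTop_atTop)).smul_const x
        simpa using this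
    refine tendsto_nhds_unique (hlim.congr fun n => hconst _ (by positivity) η)
      tendsto_const_nhds |>.symm ▸ rfl
  refine (Q.vacuum_unique ξ).1 fun x => ?_
  refine ext_inner_left ℂ fun η => ?_
  change inner ℂ η (Q.shift x ξ) = inner ℂ η ξ
  have hbound : ∀ c : ℝ, 0 < c → ‖K * (inner ℂ η (Q.shift x ξ) - inner ℂ η ξ)‖ ≤
      (∫ y, ‖spacetimeFourier G (y + -(c⁻¹ • x)) - spacetimeFourier G y‖) * (‖η‖ * ‖ξ‖) := by
    intro c hc
    have e1 : K * inner ℂ η (Q.shift x ξ) =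
        ∫ y, spacetimeFourier G (y + -(c⁻¹ • x)) * inner ℂ η (Q.shift (c • y) ξ) := by
      rw [inner_shift_right, ← hI1, ← hconst c hc]
      rw [← integral_add_right_eq_self _ (c⁻¹ • x)]
      refine integral_congr_ae (.of_forall fun y => ?_)
      simp only [add_neg_cancel_right, smul_add, smul_inv_smul₀ hc.ne']
      rw [← inner_shift_right, ← shift_add_apply, add_comm]
    have hcc : Continuous fun y : Spacetime s => inner ℂ η (Q.shift (c • y) ξ) :=
      (hcont η).comp (continuous_const_smul _)
    have hi2 : Integrable fun y => spacetimeFourier G (y + -(c⁻¹ • x)) := hGi.comp_add_right _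
    rw [mul_sub, e1, ← hI1, ← hconst c hc, ← integral_sub
      (Integrable.mul_continuous_bounded hi2 hcc fun y => hbd _ _)
      (Integrable.mul_continuous_bounded hGi hcc fun y => hbd _ _), ← integral_mul_const]
    refine norm_integral_le_of_norm_le ((hi2.sub hGi).norm.mul_const _) (.of_forall fun y => ?_)
    rw [← sub_mul, norm_mul]
    exact mul_le_mul_of_nonneg_left (hbd _ _) (norm_nonneg _)
  have hlim : Tendsto (fun c : ℝ =>
      (∫ y, ‖spacetimeFourier G (y + -(c⁻¹ • x)) - spacetimeFourier G y‖) * (‖η‖ * ‖ξ‖))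
      atTop (𝓝 (0 * (‖η‖ * ‖ξ‖))) := by
    refine Tendsto.mul_const _ ((tendsto_integral_norm_add_sub volume hGi).comp ?_)
    have : Tendsto (fun c : ℝ => -(c⁻¹ • x)) atTop (𝓝 (-((0:ℝ) • x))) :=
      (tendsto_inv_atTop_zero.smul_const x).neg
    simpa using this
  rw [zero_mul] at hlim
  have := ge_of_tendsto hlim ((eventually_gt_atTop 0).mono hbound)
  rw [norm_le_zero_iff, mul_eq_zero, or_iff_right hK0, sub_eq_zero] at this
  exact this

/-- The delicate point is energy zero, which `vanishesOn_shift` leaves out. Smearing in time with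
`g` supported below `m` yields a vector `ξ` with spectral support at the origin, hence a multiple of
`Ω`; orthogonality to `Ω` makes it zero. -/
theorem vanishesOn_shift_of_inner_Ω_eq_zero {χ : H} (hχ : inner ℂ Q.Ω χ = 0) (φ : H) :
    VanishesOn (fun t => inner ℂ φ (Q.shift (t, 0) χ)) (Iio m) := by
  intro g hg
  have hgi : Integrable fun t => expFourier g (-t) := hg.integrable_expFourier.comp_neg
  have hgs : Integrable fun t => expFourier g (-t) • Q.shift (t, 0) χ := by
    refine Integrable.mono' (hgi.norm.mul_const ‖χ‖) ?_ (.of_forall fun t => ?_)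
    · exact hgi.aestronglyMeasurable.smul
        (Q.continuous_shift (by fun_prop) continuous_const).aestronglyMeasurable
    · rw [norm_smul, norm_shift_apply]
  set ξ : H := ∫ t, expFourier g (-t) • Q.shift (t, 0) χ with hξ
  have hinner : ∀ η : H, inner ℂ η ξ = ∫ t, expFourier g (-t) * inner ℂ η (Q.shift (t, 0) χ) := by
    intro η
    rw [hξ, ← integral_inner hgs]
    simp_rw [inner_smul_right]
  obtain ⟨c, hc⟩ : ∃ c : ℂ, ξ = c • Q.Ω := by
    refine Q.eq_smul_Ω_of_integral_eq_zero fun G hG η => ?_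
    have hGi := hG.integrable_spacetimeFourier
    have hcont : Continuous fun y => inner ℂ η (Q.shift y χ) :=
      continuous_const.inner (Q.continuous_shift continuous_id continuous_const)
    have hprod : Integrable (fun z : Spacetime s × ℝ => (spacetimeFourier G z.1 *
        expFourier g (-z.2)) * inner ℂ η (Q.shift (z.1 + (z.2, 0)) χ)) (volume.prod volume) :=
      Integrable.mul_continuous_bounded (hGi.mul_prod hgi) (hcont.comp (by fun_prop))
        (fun z => Q.norm_inner_shift_le η χ _)
    have hGc := continuous_spacetimeFourier (hG.integrable volume)
    have hgc : Continuous (expFourier g) := continuous_expFourier (hg.integrable volume)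
    have hprod2 : Integrable (fun z : ℝ × Spacetime s => (expFourier g (-z.1) *
        spacetimeFourier G (z.2 - (z.1, 0))) * inner ℂ η (Q.shift z.2 χ)) (volume.prod volume) := by
      refine Integrable.mul_continuous_bounded ?_ (hcont.comp continuous_snd)
        (fun z => Q.norm_inner_shift_le η χ _)
      rw [integrable_prod_iff (Continuous.aestronglyMeasurable (by fun_prop))]
      refine ⟨.of_forall fun t => ?_, ?_⟩
      · exact (hGi.comp_sub_right ((t, 0) : Spacetime s)).const_mul (expFourier g (-t))
      simp_rw [norm_mul, integral_const_mul]
      refine (hgi.norm.mul_const (∫ y, ‖spacetimeFourier G y‖)).congr (.of_forall fun t => ?_)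
      simp only
      rw [integral_sub_right_eq_self (fun y => ‖spacetimeFourier G y‖)]
    -- The product lives at energies below `m` and away from the origin, where there is no spectrum.
    have hGg : IsTestFunction (fun p : Spacetime s => g p.1 * G p) {p | p.1 < m ∧ p ≠ 0} := by
      refine ⟨(hg.1.comp contDiff_fst).mul hG.1, hG.2.mul_left, fun p hp => ⟨?_, ?_⟩⟩
      · refine hg.3 ?_
        have h1 : p ∈ tsupport (fun p : Spacetime s => g p.1) := tsupport_mul_subset_left hp
        exact (closure_minimal (t := Prod.fst ⁻¹' tsupport g) (fun q hq => subset_tsupport g hq)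
          ((isClosed_tsupport g).preimage continuous_fst)) h1
      · exact hG.3 (tsupport_mul_subset_right hp)
    calc ∫ y, spacetimeFourier G y * inner ℂ η (Q.shift y ξ)
        = ∫ y, ∫ t, (spacetimeFourier G y * expFourier g (-t)) *
            inner ℂ η (Q.shift (y + (t, 0)) χ) := by
          refine integral_congr_ae (.of_forall fun y => ?_)
          simp only
          rw [inner_shift_right, hinner, ← integral_const_mul]
          refine integral_congr_ae (.of_forall fun t => ?_)
          simp only
          rw [← inner_shift_right, ← shift_add_apply, mul_assoc]
      _ = ∫ t, ∫ y, (spacetimeFourier G y * expFourier g (-t)) *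
            inner ℂ η (Q.shift (y + (t, 0)) χ) := integral_integral_swap hprod
      _ = ∫ t, ∫ y, (expFourier g (-t) * spacetimeFourier G (y - (t, 0))) *
            inner ℂ η (Q.shift y χ) := by
          refine integral_congr_ae (.of_forall fun t => ?_)
          simp only
          rw [← integral_add_right_eq_self (fun y => (expFourier g (-t) *
            spacetimeFourier G (y - (t, 0))) * inner ℂ η (Q.shift y χ)) ((t, 0) : Spacetime s)]
          simp_rw [add_sub_cancel_right, mul_comm]
      _ = ∫ y, ∫ t, (expFourier g (-t) * spacetimeFourier G (y - (t, 0))) *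
            inner ℂ η (Q.shift y χ) := integral_integral_swap hprod2
      _ = ∫ y, 2 * Real.pi * (spacetimeFourier (fun p => g p.1 * G p) y *
            inner ℂ η (Q.shift y χ)) := by
          refine integral_congr_ae (.of_forall fun y => ?_)
          simp only
          rw [integral_mul_const,
            integral_expFourier_mul_spacetimeFourier_sub hg (hG.integrable volume), mul_assoc]
      _ = 0 := by
          rw [integral_const_mul, Q.integral_spacetimeFourier_shift_eq_zero hGg, mul_zero]
  have h0 : inner ℂ Q.Ω ξ = 0 := by
    rw [hinner]
    simp_rw [inner_shift_right, shift_Ω, hχ, mul_zero]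
    simp
  rw [← hinner, hc]
  rw [hc, inner_smul_right, inner_Ω_Ω, mul_one] at h0
  rw [h0, zero_smul, inner_zero_right]

end VacuumSector

end HaagKastler

/-! ### Energy transfer of operators. -/

namespace HaagKastler

-- Schwartz decay pays for the polynomial growth in `t` of the commutator bounds.
open scoped FourierTransform in
theorem IsTestFunction.integrable_expFourier_mul_pow {g : ℝ → ℂ} {W : Set ℝ}
    (hg : IsTestFunction g W) (N : ℕ) :
    Integrable fun t => ‖expFourier g (-t)‖ * (1 + |t|) ^ N := by
  obtain ⟨f, rfl⟩ := hg.exists_schwartz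
  have h1 : Integrable fun v : ℝ => ‖𝓕 (f : ℝ → ℂ) v‖ * (1 + |2 * Real.pi * v|) ^ N := by
    rw [← SchwartzMap.fourier_coe]
    have h2 := ((𝓕 f).integrable.norm.const_mul ((2:ℝ) ^ (N - 1))).add
      (((𝓕 f).integrable_pow_mul volume N).const_mul ((2:ℝ) ^ (N - 1) * (2 * Real.pi) ^ N))
    refine h2.mono' ?_ (.of_forall fun v => ?_)
    · exact ((𝓕 f).continuous.norm.mul (by fun_prop)).aestronglyMeasurable
    · rw [Real.norm_of_nonneg (by positivity)]
      have := add_pow_le zero_le_one (abs_nonneg (2 * Real.pi * v)) N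
      calc _ ≤ ‖𝓕 f v‖ * (2 ^ (N - 1) * (1 ^ N + |2 * Real.pi * v| ^ N)) := by gcongr
        _ = _ := by
          rw [abs_mul, abs_of_nonneg (by positivity : (0:ℝ) ≤ 2 * Real.pi)]
          simp only [Pi.add_apply, Real.norm_eq_abs, mul_pow, one_pow]
          ring
  have h3 := h1.comp_smul (R := (2 * Real.pi)⁻¹) (by simp [Real.pi_ne_zero])
  refine h3.congr (.of_forall fun t => ?_)
  simp only [expFourier_eq, smul_eq_mul]
  congr 3
  · ring_nf
  · field_simp

namespace VacuumSector

variable {s : ℕ} {m : ℝ} {𝒜 : Type*} [CStarAlgebra 𝒜]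
  {H : Type*} [NormedAddCommGroup H] [InnerProductSpace ℂ H] [CompleteSpace H]
  (Q : VacuumSector s m 𝒜 H)

theorem norm_translate_le (A : H →L[ℂ] H) (x : Spacetime s) : ‖Q.translate A x‖ ≤ ‖A‖ := by
  rw [translate_eq]
  calc _ ≤ ‖Q.shift x‖ * ‖A‖ * ‖Q.shift (-x)‖ :=
        (norm_mul_le _ _).trans (by gcongr; exact norm_mul_le _ _)
    _ ≤ 1 * ‖A‖ * 1 := by gcongr <;> exact Q.norm_shift_le _
    _ = ‖A‖ := by ring

theorem continuous_translate {X : Type*} [TopologicalSpace X] (A : H →L[ℂ] H)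
    {f : X → Spacetime s} {v : X → H} (hf : Continuous f) (hv : Continuous v) :
    Continuous fun z => Q.translate A (f z) (v z) := by
  simp_rw [translate_apply]
  exact Q.continuous_shift hf (A.continuous.comp (Q.continuous_shift hf.neg hv))

theorem norm_inner_translate_le (A : H →L[ℂ] H) (x : Spacetime s) (φ χ : H) :
    ‖inner ℂ φ (Q.translate A x χ)‖ ≤ ‖φ‖ * (‖A‖ * ‖χ‖) :=
  (norm_inner_le_norm _ _).trans (by
    gcongr
    exact ((Q.translate A x).le_opNorm χ).trans (by gcongr; exact Q.norm_translate_le A x))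

/-- The vector `χ` has energy in `[-R, R]`. -/
def HasEnergyIn (χ : H) (R : ℝ) : Prop :=
  ∀ φ : H, VanishesOn (fun t => inner ℂ φ (Q.shift (t, 0) χ)) {E | R < |E|}

/-- The operator `A` transfers energy in `[-R, R]`. -/
def TransfersEnergyIn (A : H →L[ℂ] H) (R : ℝ) : Prop :=
  ∀ φ χ : H, VanishesOn (fun t => inner ℂ φ (Q.translate A (t, 0) χ)) {E | R < |E|}

theorem TransfersEnergyIn.mono {Q : VacuumSector s m 𝒜 H} {A : H →L[ℂ] H} {R R' : ℝ}
    (h : Q.TransfersEnergyIn A R) (hR : R ≤ R') : Q.TransfersEnergyIn A R' :=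
  fun φ χ => (h φ χ).mono fun _ hE => lt_of_le_of_lt hR hE

theorem exists_transfersEnergyIn {A : H →L[ℂ] H} (hA : IsCompact (Q.arvesonSpectrum A)) :
    ∃ R, Q.TransfersEnergyIn A R := by
  obtain ⟨R, hR⟩ := hA.isBounded.subset_closedBall 0
  refine ⟨R, fun φ χ => vanishesOn_of_fourierSupport (Q.translate A) (fun φ χ => ?_)
    (fun φ χ => ⟨_, fun x => Q.norm_inner_translate_le A x φ χ⟩) (fun p hp h => ?_) φ χ⟩
  · exact continuous_const.inner (Q.continuous_translate A continuous_id continuous_const)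
  · have h1 := hR h
    rw [mem_closedBall_zero_iff] at h1
    exact absurd ((norm_fst_le p).trans h1) (not_le.2 hp)

theorem TransfersEnergyIn.hasEnergyIn {Q : VacuumSector s m 𝒜 H} {A : H →L[ℂ] H} {R : ℝ}
    (h : Q.TransfersEnergyIn A R) : Q.HasEnergyIn (A Q.Ω) R := fun φ => by
  have := h φ Q.Ω
  simpa only [translate_apply, shift_Ω] using this

theorem HasEnergyIn.shift {Q : VacuumSector s m 𝒜 H} {χ : H} {R : ℝ} (h : Q.HasEnergyIn χ R)
    (x : Spacetime s) : Q.HasEnergyIn (Q.shift x χ) R := fun φ => by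
  convert h (Q.shift (-x) φ) using 2 with t
  rw [← inner_shift_right, ← shift_add_apply, ← shift_add_apply, add_comm]

/-- Energies add. The time in `U(t) A ζ = A(t) U(t) ζ` is split into two independent variables, `b
(t, r) = ⟨φ, A(t) U(r) ζ⟩`. The constant `3` instead of `2` leaves room for the smooth cutoff `h`.
-/
theorem TransfersEnergyIn.hasEnergyIn_apply {Q : VacuumSector s m 𝒜 H} {A : H →L[ℂ] H} {R : ℝ}
    (hR : 0 < R) (hA : Q.TransfersEnergyIn A R) {ζ : H} (hζ : Q.HasEnergyIn ζ R) :
    Q.HasEnergyIn (A ζ) (3 * R) := by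
  intro φ g hg
  obtain ⟨h, hh, N, hN, hKN, hN1⟩ := exists_testFunction_eq_one
    (isCompact_closedBall (0 : ℝ) R) (Metric.isOpen_ball (x := (0 : ℝ)) (ε := 2 * R))
    (Metric.closedBall_subset_ball (by linarith))
  have hgi : Integrable fun t => expFourier g (-t) := hg.integrable_expFourier.comp_neg
  have hhi : Integrable (expFourier h) := hh.integrable_expFourier
  have hgc : Continuous (expFourier g) := continuous_expFourier (hg.integrable volume)
  have hhc : Continuous (expFourier h) := continuous_expFourier (hh.integrable volume)
  set b : ℝ × ℝ → ℂ := fun z => inner ℂ φ (Q.translate A (z.1, 0) (Q.shift (z.2, 0) ζ)) with hb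
  have hbc : Continuous b := continuous_const.inner
    (Q.continuous_translate A (by fun_prop) (Q.continuous_shift (by fun_prop) continuous_const))
  set M : ℝ := ‖φ‖ * (‖A‖ * ‖ζ‖) with hM
  have hbM : ∀ z, ‖b z‖ ≤ M := fun z => by
    have := Q.norm_inner_translate_le A (z.1, 0) φ (Q.shift (z.2, 0) ζ)
    rwa [norm_shift_apply] at this
  -- `h` is one near the energies of `ζ`, so the diagonal value is reproduced by an integral over
  -- `r`.
  have hrep : ∀ t : ℝ, 2 * Real.pi * b (t, t) = ∫ r, expFourier h (t - r) * b (t, r) := by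
    intro t
    have hv : VanishesOn (fun r => b (t, t + r)) {E | R < |E|} := by
      convert hζ (Q.shift (-(t, 0)) (ContinuousLinearMap.adjoint (Q.translate A (t, 0)) φ))
        using 2 with r
      rw [← inner_shift_right, ContinuousLinearMap.adjoint_inner_left, ← shift_add_apply]
      simp [hb]
    have h1 := hv.integral_eq (by fun_prop) (fun r => hbM _) hN (fun p => ?_) ?_
      (hh.mono (subset_univ _)) hN1
    · rw [add_zero] at h1
      rw [← h1, ← integral_sub_right_eq_self _ t]
      simp
    · by_cases hp : R < |p|
      · exact .inl hp
      · exact .inr (hKN (by simpa using hp))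
    · refine (Metric.isBounded_closedBall (x := (0 : ℝ)) (r := R)).subset fun p hp => ?_
      simpa using hp
  have hprod : Integrable (fun z : ℝ × ℝ => (expFourier g (-z.1) * expFourier h (z.1 - z.2)) *
      b z) (volume.prod volume) := by
    refine Integrable.mul_continuous_bounded ?_ hbc hbM
    rw [integrable_prod_iff (Continuous.aestronglyMeasurable (by fun_prop))]
    refine ⟨.of_forall fun t => (hhi.comp_sub_left t).const_mul (expFourier g (-t)), ?_⟩
    simp_rw [norm_mul, integral_const_mul]
    refine (hgi.norm.mul_const (∫ y, ‖expFourier h y‖)).congr (.of_forall fun t => ?_)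
    simp only
    rw [integral_sub_left_eq_self (fun y => ‖expFourier h y‖)]
  -- At fixed `r`, write the transform of `h` as a superposition over `|E| < 2R`. On the support of
  -- `g`, `|p| > 3R` and hence `|p - E| > R`, outside the energy transfer of `A`.
  have hin : ∀ r : ℝ, ∫ t, (expFourier g (-t) * expFourier h (t - r)) * b (t, r) = 0 := by
    intro r
    have hp2 : Integrable (fun z : ℝ × ℝ => (expFourier g (-z.1) * h z.2) *
        (Complex.exp (Complex.I * ((z.2 * (z.1 - r) : ℝ) : ℂ)) * b (z.1, r)))
        (volume.prod volume) := by
      refine Integrable.mul_continuous_bounded (hgi.mul_prod (hh.integrable volume))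
        (by fun_prop) (C := M) fun z => ?_
      rw [norm_mul, mul_comm Complex.I, Complex.norm_exp_ofReal_mul_I, one_mul]
      exact hbM _
    calc _ = ∫ t, ∫ E, (expFourier g (-t) * h E) *
          (Complex.exp (Complex.I * ((E * (t - r) : ℝ) : ℂ)) * b (t, r)) := by
          refine integral_congr_ae (.of_forall fun t => ?_)
          simp only
          rw [mul_assoc, expFourier.eq_1 h, ← integral_mul_const, ← integral_const_mul]
          refine integral_congr_ae (.of_forall fun E => ?_)
          have : inner ℝ E (t - r) = E * (t - r) := by simp [mul_comm]
          simp only [this, mul_assoc]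
      _ = ∫ E, ∫ t, (expFourier g (-t) * h E) *
          (Complex.exp (Complex.I * ((E * (t - r) : ℝ) : ℂ)) * b (t, r)) :=
          integral_integral_swap hp2
      _ = ∫ E : ℝ, (0 : ℂ) := by
          refine integral_congr_ae (.of_forall fun E => ?_)
          simp only
          by_cases hE : E ∈ Metric.ball (0 : ℝ) (2 * R)
          · have h1 := (hA φ (Q.shift (r, 0) ζ)).modulate E (g := g) (hg.mono fun p hp => ?_)
            · have h2 : ∀ t : ℝ, (expFourier g (-t) * h E) *
                  (Complex.exp (Complex.I * ((E * (t - r) : ℝ) : ℂ)) * b (t, r)) =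
                  (h E * Complex.exp (-(Complex.I * (E * r : ℝ)))) * (expFourier g (-t) *
                  (Complex.exp (Complex.I * (E * t : ℝ)) *
                    inner ℂ φ (Q.translate A (t, 0) (Q.shift (r, 0) ζ)))) := fun t => by
                have : Complex.exp (Complex.I * ((E * (t - r) : ℝ) : ℂ)) =
                    Complex.exp (-(Complex.I * (E * r : ℝ))) *
                    Complex.exp (Complex.I * (E * t : ℝ)) := by
                  rw [← Complex.exp_add]
                  congr 1
                  push_cast
                  ring
                rw [this]
                simp only [hb]
                ring
              simp_rw [h2]
              rw [integral_const_mul, h1, mul_zero]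
            · simp only [mem_preimage, mem_ofPred_eq] at hp ⊢
              rw [mem_ball_zero_iff, Real.norm_eq_abs] at hE
              have := abs_sub_abs_le_abs_sub p E
              linarith
          · have : h E = 0 := by
              by_contra h0
              exact hE (hh.3 (subset_tsupport h h0))
            simp [this]
      _ = 0 := by simp
  have hfin : 2 * Real.pi * ∫ t, expFourier g (-t) * b (t, t) = 0 := by
    calc _ = ∫ t, ∫ r, (expFourier g (-t) * expFourier h (t - r)) * b (t, r) := by
          rw [← integral_const_mul]
          refine integral_congr_ae (.of_forall fun t => ?_)
          simp only
          rw [mul_left_comm, hrep, ← integral_const_mul]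
          simp_rw [mul_assoc]
      _ = ∫ r, ∫ t, (expFourier g (-t) * expFourier h (t - r)) * b (t, r) :=
          integral_integral_swap hprod
      _ = 0 := by simp [hin]
  have hpi : (2 * Real.pi : ℂ) ≠ 0 := by exact_mod_cast (by positivity : (2 * Real.pi : ℝ) ≠ 0)
  rw [← (mul_eq_zero.1 hfin).resolve_left hpi]
  refine integral_congr_ae (.of_forall fun t => ?_)
  simp only [hb]
  rw [translate_apply, ← shift_add_apply, neg_add_cancel, shift_zero]
  rfl

/-! ### Clustering -/

/-- The component of `χ` orthogonal to the vacuum. -/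
noncomputable def truncate (χ : H) : H := χ - (inner ℂ Q.Ω χ : ℂ) • Q.Ω

theorem inner_Ω_truncate (χ : H) : inner ℂ Q.Ω (Q.truncate χ) = 0 := by
  rw [truncate, inner_sub_right, inner_smul_right, inner_Ω_Ω, mul_one, sub_self]

theorem norm_truncate_le (χ : H) : ‖Q.truncate χ‖ ≤ 2 * ‖χ‖ := by
  calc _ ≤ ‖χ‖ + ‖(inner ℂ Q.Ω χ : ℂ) • Q.Ω‖ := norm_sub_le _ _
    _ ≤ ‖χ‖ + (‖Q.Ω‖ * ‖χ‖) * ‖Q.Ω‖ := by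
        rw [norm_smul]; gcongr; exact norm_inner_le_norm _ _
    _ = _ := by rw [norm_Ω]; ring

theorem inner_truncate_shift (χ : H) (x : Spacetime s) :
    inner ℂ (Q.truncate χ) (Q.shift x (Q.truncate χ)) =
      inner ℂ (Q.shift (-x) χ) (Q.truncate χ) := by
  rw [inner_shift_right]
  conv_lhs => enter [2]; rw [truncate]
  rw [map_sub, map_smul, shift_Ω, inner_sub_left, inner_smul_left, inner_Ω_truncate, mul_zero,
    sub_zero]

/-- Since `g` vanishes at energy zero it does not see the vacuum component, and the rest of `χ` has
energies in `[m, ρ]`, where `g` is one. Smearing with `g` thus acts as the projection off the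
vacuum. -/
theorem integral_expFourier_mul_inner_shift {g : ℝ → ℂ} {N : Set ℝ} {ρ : ℝ}
    (hg : IsTestFunction g (Ioi 0)) (hN : IsOpen N) (hρN : Icc m ρ ⊆ N)
    (hN1 : ∀ p ∈ N, g p = 1) {χ : H} (hχ : Q.HasEnergyIn χ ρ) (hρ : 0 < ρ) (φ : H) :
    ∫ t, expFourier g (-t) * inner ℂ φ (Q.shift (t, 0) χ) =
      2 * Real.pi * inner ℂ φ (Q.truncate χ) := by
  have hconst : ∀ {k : ℝ → ℂ} {W : Set ℝ}, IsTestFunction k W → (0 : ℝ) ∉ W →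
      ∀ c : ℂ, ∫ t, expFourier k (-t) * c = 0 := fun {k W} hk h0 c => by
    rw [integral_mul_const, integral_neg_eq_self (expFourier k), hk.integral_expFourier,
      image_eq_zero_of_notMem_tsupport fun h => h0 (hk.3 h), mul_zero, zero_mul]
  have hsplit : ∀ {k : ℝ → ℂ} {W : Set ℝ}, IsTestFunction k W → (0 : ℝ) ∉ W →
      ∫ t, expFourier k (-t) * inner ℂ φ (Q.shift (t, 0) (Q.truncate χ)) =
        ∫ t, expFourier k (-t) * inner ℂ φ (Q.shift (t, 0) χ) := fun {k W} hk h0 => by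
    have h1 := integral_sub
      (Integrable.mul_continuous_bounded hk.integrable_expFourier.comp_neg
        (Q.continuous_inner_shift_time φ χ) fun t => Q.norm_inner_shift_le φ χ _)
      (hk.integrable_expFourier.comp_neg.mul_const
        (inner ℂ φ ((inner ℂ Q.Ω χ : ℂ) • Q.Ω)))
    rw [hconst hk h0, sub_zero] at h1
    rw [← h1]
    refine integral_congr_ae (.of_forall fun t => ?_)
    simp only [truncate]
    rw [map_sub, map_smul, shift_Ω, inner_sub_right, mul_sub]
  have hv1 := Q.vanishesOn_shift_of_inner_Ω_eq_zero (Q.inner_Ω_truncate χ) φ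
  -- Truncation changes the matrix element by a constant, which is invisible to test functions
  -- supported away from zero.
  have hv2 : VanishesOn (fun t => inner ℂ φ (Q.shift (t, 0) (Q.truncate χ))) {E | ρ < |E|} := by
    intro k hk
    rw [hsplit hk (by simp [hρ.le]), hχ φ k hk]
  have hv := VanishesOn.union (Q.continuous_inner_shift_time φ (Q.truncate χ))
    (fun t => Q.norm_inner_shift_le φ _ _) isOpen_Iio
    (isOpen_lt continuous_const continuous_abs) hv1 hv2
  rw [← hsplit hg (by simp)]
  have := hv.integral_eq (Q.continuous_inner_shift_time φ (Q.truncate χ))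
    (fun t => Q.norm_inner_shift_le φ _ _) hN (fun p => ?_) ?_ (hg.mono (subset_univ _)) hN1
  · rw [this]
    congr 2
    change Q.shift 0 _ = _
    rw [shift_zero]; rfl
  · by_contra! hp
    refine hp.2 (hρN ⟨?_, ?_⟩)
    · exact not_lt.1 fun h => hp.1 (.inl h)
    · exact (le_abs_self p).trans (not_lt.1 fun h => hp.1 (.inr h))
  · refine (Metric.isBounded_closedBall (x := (0 : ℝ)) (r := ρ)).subset fun p hp => ?_
    rw [mem_closedBall_zero_iff]
    exact not_lt.1 fun h => hp (.inr h)

/-- Clustering from the mass gap. `K` is a weighted `L¹` norm of the transform of a cutoff depending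
only on `m` and `ρ`; its independence of `C` matters, as the estimate is applied to a family of
operators with a common energy bound. -/
theorem norm_inner_truncate_shift_le {ρ : ℝ} (hρ : 0 < ρ) (N : ℕ) : ∃ K : ℝ, 0 ≤ K ∧
    ∀ (C : H →L[ℂ] H), Q.HasEnergyIn (C Q.Ω) ρ → ∀ (x : Space s) (κ : ℝ),
      (∀ t : ℝ, ‖star C * Q.translate C (t, x) - Q.translate C (t, x) * star C‖ ≤
        κ * (1 + |t|) ^ N) →
      ‖inner ℂ (Q.truncate (C Q.Ω)) (Q.shift (0, x) (Q.truncate (C Q.Ω)))‖ ≤ K * κ := by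
  obtain ⟨g, hg, O, hO, hρO, hO1⟩ := exists_testFunction_eq_one (isCompact_Icc (a := m) (b := ρ))
    isOpen_Ioi (fun p hp => Q.mass_pos.trans_le hp.1 : Icc m ρ ⊆ Ioi (0 : ℝ))
  refine ⟨∫ t, ‖expFourier g (-t)‖ * (1 + |t|) ^ N, integral_nonneg fun t => by positivity,
    fun C hC x κ hκ => ?_⟩
  have hgi : Integrable fun t => expFourier g (-t) := hg.integrable_expFourier.comp_neg
  have h1 := Q.integral_expFourier_mul_inner_shift hg hO hρO hO1 hC hρ (Q.shift (-(0, x)) (C Q.Ω))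
  rw [← inner_truncate_shift] at h1
  set η : H := star C Q.Ω with hη
  -- In the opposite operator order the energies enter with reversed sign and are all `≤ 0`, outside
  -- the support of `g`.
  have h2 : ∫ t, expFourier g (-t) * inner ℂ η (Q.shift (-(t, x)) η) = 0 := by
    have hg' : IsTestFunction (fun p => g (-p)) {E | E < m ∧ E ≠ 0} := by
      refine (hg.comp_homeomorph (Homeomorph.neg ℝ) contDiff_neg).mono fun p hp => ?_
      have hp' : 0 < -p := hp
      have := Q.mass_pos
      exact ⟨by linarith, by rintro rfl; simp at hp'⟩
    rw [← Q.vanishesOn_shift (Q.shift (0, x) η) η _ hg', ← integral_neg_eq_self]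
    refine integral_congr_ae (.of_forall fun t => ?_)
    simp only [neg_neg]
    congr 1
    · rw [expFourier, expFourier, ← integral_neg_eq_self]
      simp
    · rw [inner_shift_left, ← shift_add_apply]
      simp
  -- The difference of the two orders is the vacuum expectation of a commutator, the only quantity
  -- that locality controls.
  have hcomm : ∀ t : ℝ, inner ℂ (Q.shift (-(0, x)) (C Q.Ω)) (Q.shift (t, 0) (C Q.Ω)) -
      inner ℂ η (Q.shift (-(t, x)) η) = inner ℂ Q.Ω
        ((star C * Q.translate C (t, x) - Q.translate C (t, x) * star C) Q.Ω) := by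
    intro t
    rw [_root_.sub_apply, inner_sub_right]
    congr 1
    · rw [inner_shift_left, neg_neg, ← shift_add_apply, mul_apply_eq_comp,
        ContinuousLinearMap.star_eq_adjoint, ContinuousLinearMap.adjoint_inner_right,
        translate_apply, shift_Ω]
      simp
    · rw [mul_apply_eq_comp, translate_apply, Q.inner_shift_right _ Q.Ω, shift_Ω, hη,
        ContinuousLinearMap.star_eq_adjoint, ContinuousLinearMap.adjoint_inner_left]
  have h3 : 2 * Real.pi * inner ℂ (Q.truncate (C Q.Ω)) (Q.shift (0, x) (Q.truncate (C Q.Ω))) =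
      ∫ t, expFourier g (-t) * inner ℂ Q.Ω
        ((star C * Q.translate C (t, x) - Q.translate C (t, x) * star C) Q.Ω) := by
    rw [← h1, ← sub_zero (∫ t, expFourier g (-t) * _), ← h2, ← integral_sub]
    · simp_rw [← mul_sub, hcomm]
    · exact Integrable.mul_continuous_bounded hgi (Q.continuous_inner_shift_time _ _)
        fun t => Q.norm_inner_shift_le _ _ _
    · exact Integrable.mul_continuous_bounded hgi
        (continuous_const.inner (Q.continuous_shift (by fun_prop) continuous_const))
        fun t => Q.norm_inner_shift_le _ _ _
  have h4 : ‖2 * Real.pi * inner ℂ (Q.truncate (C Q.Ω)) (Q.shift (0, x) (Q.truncate (C Q.Ω)))‖ ≤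
      (∫ t, ‖expFourier g (-t)‖ * (1 + |t|) ^ N) * κ := by
    rw [h3, ← integral_mul_const]
    refine norm_integral_le_of_norm_le ((hg.integrable_expFourier_mul_pow N).mul_const _)
      (.of_forall fun t => ?_)
    rw [norm_mul, mul_assoc]
    refine mul_le_mul_of_nonneg_left ?_ (norm_nonneg _)
    refine (norm_inner_le_norm _ _).trans ?_
    rw [norm_Ω, one_mul]
    refine (ContinuousLinearMap.le_opNorm _ _).trans ?_
    rw [norm_Ω, mul_one, mul_comm]
    exact hκ t
  refine le_trans ?_ h4
  rw [norm_mul]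
  -- The factor `2π ≥ 1` on the left is simply dropped.
  refine le_mul_of_one_le_left (norm_nonneg _) ?_
  rw [show (2 * Real.pi : ℂ) = ((2 * Real.pi : ℝ) : ℂ) by push_cast; rfl, Complex.norm_real,
    Real.norm_of_nonneg (by positivity)]
  linarith [Real.two_le_pi]

end VacuumSector

end HaagKastler

/-! ### Commutators of almost local operators. -/

namespace HaagKastler

/-- For a star-closed set the adjoint conditions in both centralizers are automatic. -/
theorem mem_generatedVonNeumann_iff {H : Type*} [NormedAddCommGroup H] [InnerProductSpace ℂ H]
    [CompleteSpace H] {S : Set (H →L[ℂ] H)} (hS : ∀ a ∈ S, star a ∈ S) {X : H →L[ℂ] H} :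
    X ∈ generatedVonNeumann S ↔ ∀ T : H →L[ℂ] H, (∀ a ∈ S, a * T = T * a) → T * X = X * T := by
  have hcent : ∀ T : H →L[ℂ] H, (∀ a ∈ S, a * T = T * a) → ∀ a ∈ S, a * star T = star T * a := by
    intro T hT a ha
    have := congrArg star (hT _ (hS a ha))
    simpa using this.symm
  have hmem : ∀ T : H →L[ℂ] H, T ∈ StarSubalgebra.centralizer ℂ S ↔ ∀ a ∈ S, a * T = T * a := by
    intro T
    rw [StarSubalgebra.mem_centralizer_iff]
    exact ⟨fun h a ha => (h a ha).1, fun h a ha => ⟨h a ha, h _ (hS a ha)⟩⟩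
  change X ∈ StarSubalgebra.centralizer ℂ (StarSubalgebra.centralizer ℂ S : Set (H →L[ℂ] H)) ↔ _
  rw [StarSubalgebra.mem_centralizer_iff]
  constructor
  · intro h T hT
    exact (h T ((hmem T).2 hT)).1
  · intro h T hT
    have hT' := (hmem T).1 hT
    exact ⟨h T hT', h _ (hcent T hT')⟩

theorem isOpen_doubleCone (s : ℕ) (r : ℝ) : IsOpen (doubleCone s r) :=
  isOpen_lt (by fun_prop) continuous_const

theorem isBounded_doubleCone (s : ℕ) (r : ℝ) : Bornology.IsBounded (doubleCone s r) := by
  refine (Metric.isBounded_closedBall (x := (0 : Spacetime s)) (r := r)).subset fun x hx => ?_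
  have hx : |x.1| + ‖x.2‖ < r := hx
  rw [mem_closedBall_zero_iff, Prod.norm_def, Real.norm_eq_abs]
  exact max_le (by linarith [norm_nonneg x.2]) (by linarith [abs_nonneg x.1])

theorem norm_mul_sub_mul_le {R : Type*} [NormedRing R] (P P' Y : R) :
    ‖P * P' * Y - Y * (P * P')‖ ≤ ‖P‖ * ‖P' * Y - Y * P'‖ + ‖P * Y - Y * P‖ * ‖P'‖ := by
  have : P * P' * Y - Y * (P * P') = P * (P' * Y - Y * P') + (P * Y - Y * P) * P' := by
    noncomm_ring
  rw [this]
  exact (norm_add_le _ _).trans (add_le_add (norm_mul_le _ _) (norm_mul_le _ _))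

/-- The commutator of two commutators is controlled by the commutators of the entries. -/
theorem norm_commutator_commutator_le {R : Type*} [NormedRing R] {P P' Y Y' : R} {a κ : ℝ}
    (hP : ‖P‖ ≤ a) (hP' : ‖P'‖ ≤ a) (hY : ‖Y‖ ≤ a) (hY' : ‖Y'‖ ≤ a)
    (h₁ : ‖P * Y - Y * P‖ ≤ κ) (h₂ : ‖P * Y' - Y' * P‖ ≤ κ)
    (h₃ : ‖P' * Y - Y * P'‖ ≤ κ) (h₄ : ‖P' * Y' - Y' * P'‖ ≤ κ) :
    ‖(P * P' - P' * P) * (Y * Y' - Y' * Y) - (Y * Y' - Y' * Y) * (P * P' - P' * P)‖ ≤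
      16 * a ^ 2 * κ := by
  have ha : 0 ≤ a := (norm_nonneg _).trans hP
  have hκ : 0 ≤ κ := (norm_nonneg _).trans h₁
  -- A commutator of two products is a sum of four single commutators, each multiplied by two
  -- factors of norm at most `a`. Four such terms give the constant `16`.
  have key : ∀ {P P' Y Y' : R}, ‖P‖ ≤ a → ‖P'‖ ≤ a → ‖Y‖ ≤ a → ‖Y'‖ ≤ a →
      ‖P * Y - Y * P‖ ≤ κ → ‖P * Y' - Y' * P‖ ≤ κ → ‖P' * Y - Y * P'‖ ≤ κ →
      ‖P' * Y' - Y' * P'‖ ≤ κ → ‖P * P' * (Y * Y') - Y * Y' * (P * P')‖ ≤ 4 * a ^ 2 * κ := by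
    intro P P' Y Y' hP hP' hY hY' h₁ h₂ h₃ h₄
    have sw : ∀ {Z : R}, ‖Z * Y - Y * Z‖ ≤ κ → ‖Z * Y' - Y' * Z‖ ≤ κ →
        ‖Z * (Y * Y') - Y * Y' * Z‖ ≤ 2 * a * κ := by
      intro Z h h'
      rw [norm_sub_rev]
      refine (norm_mul_sub_mul_le Y Y' Z).trans ?_
      rw [norm_sub_rev (Y' * Z), norm_sub_rev (Y * Z)]
      calc _ ≤ a * κ + κ * a := by gcongr
        _ = _ := by ring
    refine (norm_mul_sub_mul_le P P' (Y * Y')).trans ?_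
    calc _ ≤ a * (2 * a * κ) + (2 * a * κ) * a := by
          gcongr
          · exact sw h₃ h₄
          · exact sw h₁ h₂
      _ = _ := by ring
  have e : (P * P' - P' * P) * (Y * Y' - Y' * Y) - (Y * Y' - Y' * Y) * (P * P' - P' * P) =
      (P * P' * (Y * Y') - Y * Y' * (P * P')) - (P * P' * (Y' * Y) - Y' * Y * (P * P')) -
      ((P' * P * (Y * Y') - Y * Y' * (P' * P)) - (P' * P * (Y' * Y) - Y' * Y * (P' * P))) := by
    noncomm_ring
  rw [e]
  have k1 := key hP hP' hY hY' h₁ h₂ h₃ h₄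
  have k2 := key hP hP' hY' hY h₂ h₁ h₄ h₃
  have k3 := key hP' hP hY hY' h₃ h₄ h₁ h₂
  have k4 := key hP' hP hY' hY h₄ h₃ h₂ h₁
  refine (norm_sub_le _ _).trans ?_
  have j1 := (norm_sub_le (P * P' * (Y * Y') - Y * Y' * (P * P'))
    (P * P' * (Y' * Y) - Y' * Y * (P * P')))
  have j2 := (norm_sub_le (P' * P * (Y * Y') - Y * Y' * (P' * P))
    (P' * P * (Y' * Y) - Y' * Y * (P' * P)))
  linarith

namespace VacuumSector

variable {s : ℕ} {m : ℝ} {𝒜 : Type*} [CStarAlgebra 𝒜]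
  {H : Type*} [NormedAddCommGroup H] [InnerProductSpace ℂ H] [CompleteSpace H]
  (Q : VacuumSector s m 𝒜 H)

theorem translate_mul (A B : H →L[ℂ] H) (x : Spacetime s) :
    Q.translate (A * B) x = Q.translate A x * Q.translate B x := by
  simp only [translate_eq]
  calc _ = Q.shift x * A * (Q.shift (-x) * Q.shift x) * B * Q.shift (-x) := by
        rw [shift_neg_mul_shift]; noncomm_ring
    _ = _ := by noncomm_ring

theorem translate_sub (A B : H →L[ℂ] H) (x : Spacetime s) :
    Q.translate (A - B) x = Q.translate A x - Q.translate B x := by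
  simp only [translate_eq]
  noncomm_ring

theorem star_translate (A : H →L[ℂ] H) (x : Spacetime s) :
    star (Q.translate A x) = Q.translate (star A) x := by
  simp only [translate_eq, star_mul, star_shift, neg_neg, mul_assoc]

theorem translate_translate (A : H →L[ℂ] H) (x y : Spacetime s) :
    Q.translate (Q.translate A x) y = Q.translate A (y + x) := by
  simp only [translate_eq, shift_add, neg_add_rev, mul_assoc]

theorem translate_zero (A : H →L[ℂ] H) : Q.translate A 0 = A := by
  simp [translate_eq, shift_zero]

theorem translate_π (a : 𝒜) (x : Spacetime s) :
    Q.translate (Q.π a) x = Q.π (Q.α (.ofAdd x) a) := (Q.U_implements x a).symm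

theorem star_mem_image_alg (O : Set (Spacetime s)) :
    ∀ a ∈ Q.π '' (Q.alg O : Set 𝒜), star a ∈ Q.π '' (Q.alg O : Set 𝒜) := by
  rintro _ ⟨a, ha, rfl⟩
  exact ⟨star a, star_mem ha, map_star Q.π a⟩

/-- Microcausality compares only elements of the net. The double commutant criterion is therefore
applied twice: for `Y`, with the other operator translated back by `-z`, and then for `X`. -/
theorem commute_translate_of_spacelike {O₁ O₂ : Set (Spacetime s)} (h₁ : IsOpen O₁)
    (hb₁ : Bornology.IsBounded O₁) (h₂ : IsOpen O₂) (hb₂ : Bornology.IsBounded O₂)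
    {z : Spacetime s} (hz : O₁ ⊆ causalComplement ((fun y => y + z) '' O₂)) {X Y : H →L[ℂ] H}
    (hX : X ∈ Q.localAlgebra O₁) (hY : Y ∈ Q.localAlgebra O₂) :
    X * Q.translate Y z = Q.translate Y z * X := by
  rw [localAlgebra, mem_generatedVonNeumann_iff (Q.star_mem_image_alg _)] at hX hY
  have h₂' : IsOpen ((fun y => y + z) '' O₂) := (Homeomorph.addRight z).isOpenMap _ h₂
  have hb₂' : Bornology.IsBounded ((fun y => y + z) '' O₂) := by
    obtain ⟨R, hR⟩ := hb₂.subset_closedBall 0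
    refine (Metric.isBounded_closedBall (x := (0 : Spacetime s)) (r := R + ‖z‖)).subset ?_
    rintro _ ⟨y, hy, rfl⟩
    have := hR hy
    rw [mem_closedBall_zero_iff] at this ⊢
    exact (norm_add_le _ _).trans (by linarith)
  refine (hX _ ?_).symm
  rintro _ ⟨a, ha, rfl⟩
  have hT : Q.translate (Q.π a) (-z) * Y = Y * Q.translate (Q.π a) (-z) := by
    refine hY _ ?_
    rintro _ ⟨b, hb, rfl⟩
    have hb' : Q.α (.ofAdd z) b ∈ Q.alg ((fun y => y + z) '' O₂) := by
      have := Q.covariance O₂ h₂ hb₂ z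
      rw [← SetLike.mem_coe, ← this]
      exact ⟨b, hb, rfl⟩
    have hc := Q.microcausality _ _ h₁ hb₁ h₂' hb₂' hz a ha _ hb'
    have hc' := congrArg (fun c => Q.translate (Q.π c) (-z)) hc
    simp only [map_mul, translate_mul, ← translate_π, translate_translate, neg_add_cancel,
      translate_zero] at hc'
    exact hc'.symm
  have := congrArg (fun c => Q.translate c z) hT
  simpa only [translate_mul, translate_translate, add_neg_cancel, translate_zero] using this

theorem doubleCone_subset_causalComplement {r : ℝ} {z : Spacetime s}
    (hz : |z.1| + 2 * r < ‖z.2‖) :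
    doubleCone s r ⊆ causalComplement ((fun y => y + z) '' doubleCone s r) := by
  rintro x hx _ ⟨y, hy, rfl⟩
  have hx : |x.1| + ‖x.2‖ < r := hx
  have hy : |y.1| + ‖y.2‖ < r := hy
  simp only [Prod.fst_add, Prod.snd_add]
  have h1 : |x.1 - (y.1 + z.1)| ≤ |x.1| + |y.1| + |z.1| := by
    rw [sub_eq_add_neg, neg_add, ← add_assoc]
    exact (abs_add_three _ _ _).trans_eq (by simp)
  have h2 : ‖z.2‖ ≤ ‖x.2 - (y.2 + z.2)‖ + ‖x.2‖ + ‖y.2‖ := by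
    have : z.2 = -(x.2 - (y.2 + z.2)) + x.2 + -y.2 := by abel
    conv_lhs => rw [this]
    exact (norm_add₃_le).trans_eq (by simp only [norm_neg])
  linarith

theorem IsAlmostLocal.star {Q : VacuumSector s m 𝒜 H} {A : H →L[ℂ] H} (hA : Q.IsAlmostLocal A) :
    Q.IsAlmostLocal (star A) := by
  obtain ⟨h, Ar, hAr, hN⟩ := hA
  refine ⟨star_mem h, fun r => Star.star (Ar r), fun r hr => star_mem (hAr r hr), fun N => ?_⟩
  obtain ⟨C, hC⟩ := hN N
  exact ⟨C, fun r hr => by rw [← star_sub, norm_star]; exact hC r hr⟩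

theorem norm_commutator_le {B : H →L[ℂ] H} (A : H →L[ℂ] H) {a b : ℝ} (hA : ‖A‖ ≤ a)
    (hB : ‖B‖ ≤ b) : ‖A * B - B * A‖ ≤ 2 * (a * b) := by
  have ha : 0 ≤ a := (norm_nonneg _).trans hA
  calc _ ≤ ‖A‖ * ‖B‖ + ‖B‖ * ‖A‖ :=
        (norm_sub_le _ _).trans (add_le_add (norm_mul_le _ _) (norm_mul_le _ _))
    _ ≤ a * b + b * a := by
        gcongr
        exact (norm_nonneg _).trans hB
    _ = _ := by ring

/-- If `|x|` is not large compared with `|t|`, the trivial bound suffices. Otherwise approximants in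
double cones of radius `r = (1 + ‖x‖) / 8` are still space-like separated after the translation,
because `|t| + 2r < ‖x‖`; they commute, and the error is of order `r^{-N}`. -/
theorem IsAlmostLocal.norm_commutator_le {Q : VacuumSector s m 𝒜 H} {X Y : H →L[ℂ] H}
    (hX : Q.IsAlmostLocal X) (hY : Q.IsAlmostLocal Y) (N : ℕ) : ∃ K : ℝ, 0 ≤ K ∧
      ∀ (t : ℝ) (x : Space s), ‖X * Q.translate Y (t, x) - Q.translate Y (t, x) * X‖ *
        (1 + ‖x‖) ^ N ≤ K * (1 + |t|) ^ N := by
  obtain ⟨-, Xr, hXr, hXN⟩ := hX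
  obtain ⟨-, Yr, hYr, hYN⟩ := hY
  obtain ⟨C₀, hC₀⟩ := hXN 0
  obtain ⟨C₁, hC₁⟩ := hXN N
  obtain ⟨C₂, hC₂⟩ := hYN N
  have hC₀' : 0 ≤ C₀ := by simpa using (norm_nonneg _).trans (hC₀ 1 one_pos)
  have hC₁' : 0 ≤ C₁ := by simpa using (norm_nonneg _).trans (hC₁ 1 one_pos)
  have hC₂' : 0 ≤ C₂ := by simpa using (norm_nonneg _).trans (hC₂ 1 one_pos)
  set K₁ := 2 * (‖X‖ * ‖Y‖) * 4 ^ N with hK₁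
  set K₂ := (2 * (C₁ * ‖Y‖) + 2 * ((‖X‖ + C₀) * C₂)) * 8 ^ N with hK₂
  refine ⟨K₁ + K₂, by positivity, fun t x => ?_⟩
  have hK₁0 : 0 ≤ K₁ := by positivity
  have hK₂0 : 0 ≤ K₂ := by positivity
  rcases le_or_gt (1 + ‖x‖) (4 * (1 + |t|)) with h | h
  · calc _ ≤ (2 * (‖X‖ * ‖Y‖)) * (4 * (1 + |t|)) ^ N := by
          gcongr
          exact VacuumSector.norm_commutator_le X le_rfl (Q.norm_translate_le Y _)
      _ = K₁ * (1 + |t|) ^ N := by rw [mul_pow, hK₁]; ring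
      _ ≤ _ := by gcongr; linarith
  · set r : ℝ := (1 + ‖x‖) / 8 with hr
    have hr0 : 0 < r := by positivity
    have hcomm : Xr r * Q.translate (Yr r) (t, x) = Q.translate (Yr r) (t, x) * Xr r :=
      Q.commute_translate_of_spacelike (isOpen_doubleCone s r) (isBounded_doubleCone s r)
        (isOpen_doubleCone s r) (isBounded_doubleCone s r)
        (doubleCone_subset_causalComplement (by
          change |t| + 2 * r < ‖x‖
          rw [hr]
          linarith [abs_nonneg t])) (hXr r hr0) (hYr r hr0)
    have hXrn : ‖Xr r‖ ≤ ‖X‖ + C₀ := by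
      have h1 := hC₀ r hr0
      have h2 := norm_sub_norm_le (Xr r) X
      rw [norm_sub_rev] at h2
      simp at h1
      linarith
    have e : X * Q.translate Y (t, x) - Q.translate Y (t, x) * X =
        ((X - Xr r) * Q.translate Y (t, x) - Q.translate Y (t, x) * (X - Xr r)) +
        (Xr r * Q.translate (Y - Yr r) (t, x) - Q.translate (Y - Yr r) (t, x) * Xr r) := by
      rw [translate_sub]
      have : Xr r * (Q.translate Y (t, x) - Q.translate (Yr r) (t, x)) -
          (Q.translate Y (t, x) - Q.translate (Yr r) (t, x)) * Xr r =
          Xr r * Q.translate Y (t, x) - Q.translate Y (t, x) * Xr r := by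
        rw [mul_sub, sub_mul, hcomm]; abel
      rw [this]
      noncomm_ring
    have hb : ‖X * Q.translate Y (t, x) - Q.translate Y (t, x) * X‖ ≤
        (2 * (C₁ * ‖Y‖) + 2 * ((‖X‖ + C₀) * C₂)) * (r ^ N)⁻¹ := by
      rw [e]
      refine (norm_add_le _ _).trans ?_
      have h1 := VacuumSector.norm_commutator_le _ (hC₁ r hr0) (Q.norm_translate_le Y (t, x))
      have h2 := VacuumSector.norm_commutator_le _ hXrn
        ((Q.norm_translate_le (Y - Yr r) (t, x)).trans (hC₂ r hr0))
      calc _ ≤ 2 * (C₁ * (r ^ N)⁻¹ * ‖Y‖) + 2 * ((‖X‖ + C₀) * (C₂ * (r ^ N)⁻¹)) := add_le_add h1 h2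
        _ = _ := by ring
    have hrN : (r ^ N)⁻¹ * (1 + ‖x‖) ^ N = 8 ^ N := by
      rw [hr, div_pow, inv_div, div_mul_cancel₀ _ (by positivity)]
    calc _ ≤ (2 * (C₁ * ‖Y‖) + 2 * ((‖X‖ + C₀) * C₂)) * (r ^ N)⁻¹ * (1 + ‖x‖) ^ N := by gcongr
      _ = K₂ * 1 := by rw [mul_assoc, hrN, mul_one]
      _ ≤ (K₁ + K₂) * (1 + |t|) ^ N := by
          gcongr
          · linarith
          · exact one_le_pow₀ (by linarith [abs_nonneg t])

/-- The two-particle vectors `A B(𝐮) Ω`, minus their vacuum component. -/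
noncomputable def pairVector (A B : H →L[ℂ] H) (u : Space s) : H :=
  Q.truncate (A (Q.translate B (0, u) Q.Ω))

/-- As `A Ω = 0`, the pair vector comes from the commutator `C u`. Clustering gives decay in `x` at
the price of growth in `u`, whereas the norm of `C u` alone decays in `u`; the two estimates are
then interpolated. -/
theorem exists_norm_inner_pairVector_le {A B : H →L[ℂ] H} (hA : Q.IsAlmostLocal A)
    (hB : Q.IsAlmostLocal B) (hσA : IsCompact (Q.arvesonSpectrum A))
    (hσB : IsCompact (Q.arvesonSpectrum B)) (hΩ : A Q.Ω = 0) (N : ℕ) :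
    ∃ K : ℝ, 0 ≤ K ∧ ∀ x u : Space s,
      ‖inner ℂ (Q.pairVector A B u) (Q.shift (0, x) (Q.pairVector A B u))‖ *
        ((1 + ‖x‖) ^ N * (1 + ‖u‖) ^ N) ≤ K := by
  obtain ⟨R₁, hR₁⟩ := Q.exists_transfersEnergyIn hσA
  obtain ⟨R₂, hR₂⟩ := Q.exists_transfersEnergyIn hσB
  set R := max (max R₁ R₂) 1 with hRdef
  have hR : 0 < R := lt_of_lt_of_le one_pos (le_max_right _ _)
  have hRA := hR₁.mono ((le_max_left R₁ R₂).trans (le_max_left _ 1))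
  have hRB := hR₂.mono ((le_max_right R₁ R₂).trans (le_max_left _ 1))
  set C : Space s → H →L[ℂ] H := fun u =>
    A * Q.translate B (0, u) - Q.translate B (0, u) * A with hCdef
  have hCΩ : ∀ u, C u Q.Ω = A (Q.translate B (0, u) Q.Ω) := fun u => by
    simp [hCdef, hΩ]
  have hen : ∀ u, Q.HasEnergyIn (C u Q.Ω) (3 * R) := fun u => by
    rw [hCΩ, translate_apply, shift_Ω]
    exact hRA.hasEnergyIn_apply hR (hRB.hasEnergyIn.shift _)
  -- The exponent is doubled because a square root is taken in the final interpolation.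
  obtain ⟨K₀, hK₀, hcl⟩ := Q.norm_inner_truncate_shift_le (ρ := 3 * R) (by positivity) (2 * N)
  obtain ⟨k₁, hk₁, h₁⟩ := hA.star.norm_commutator_le hA (2 * N)
  obtain ⟨k₂, hk₂, h₂⟩ := hA.star.norm_commutator_le hB (2 * N)
  obtain ⟨k₃, hk₃, h₃⟩ := hB.star.norm_commutator_le hA (2 * N)
  obtain ⟨k₄, hk₄, h₄⟩ := hB.star.norm_commutator_le hB (2 * N)
  obtain ⟨k₅, hk₅, h₅⟩ := hA.norm_commutator_le hB (2 * N)
  set k := max (max k₁ k₂) (max k₃ k₄) with hk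
  have hk0 : 0 ≤ k := hk₁.trans ((le_max_left _ _).trans (le_max_left _ _))
  set a := max ‖A‖ ‖B‖ with ha
  have haA : ‖A‖ ≤ a := le_max_left _ _
  have haB : ‖B‖ ≤ a := le_max_right _ _
  have ha0 : 0 ≤ a := (norm_nonneg _).trans haA
  -- localization in `x`
  have hcomm : ∀ (u x : Space s) (t : ℝ),
      ‖star (C u) * Q.translate (C u) (t, x) - Q.translate (C u) (t, x) * star (C u)‖ ≤
        (16 * a ^ 2 * k * (1 + ‖u‖) ^ (2 * N) * ((1 + ‖x‖) ^ (2 * N))⁻¹) *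
          (1 + |t|) ^ (2 * N) := by
    intro u x t
    -- Peetre's inequality `1 + ‖x‖ ≤ (1 + ‖y‖)(1 + ‖u‖)`. The spatial separations `y` that occur
    -- are `x - u`, `x`, `x` and `x + u`.
    have hpeetre : ∀ y : Space s, ‖x‖ ≤ ‖y‖ + ‖u‖ → ∀ {c q : ℝ}, 0 ≤ c → q ≤ k →
        c * (1 + ‖y‖) ^ (2 * N) ≤ q * (1 + |t|) ^ (2 * N) →
        c ≤ k * (1 + ‖u‖) ^ (2 * N) * ((1 + ‖x‖) ^ (2 * N))⁻¹ * (1 + |t|) ^ (2 * N) := by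
      intro y hy c q hc hq h
      rw [mul_right_comm, ← div_eq_mul_inv, le_div_iff₀ (by positivity)]
      calc c * (1 + ‖x‖) ^ (2 * N) ≤ c * ((1 + ‖y‖) * (1 + ‖u‖)) ^ (2 * N) := by
            gcongr
            nlinarith [norm_nonneg y, norm_nonneg u]
        _ = c * (1 + ‖y‖) ^ (2 * N) * (1 + ‖u‖) ^ (2 * N) := by rw [mul_pow]; ring
        _ ≤ (k * (1 + |t|) ^ (2 * N)) * (1 + ‖u‖) ^ (2 * N) := by
            exact mul_le_mul_of_nonneg_right
              (h.trans (mul_le_mul_of_nonneg_right hq (by positivity))) (by positivity)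
        _ = _ := by ring
    have hst : star (C u) = star (Q.translate B (0, u)) * star A -
        star A * star (Q.translate B (0, u)) := by
      simp [hCdef]
    have htr : Q.translate (C u) (t, x) = Q.translate A (t, x) * Q.translate B (t, x + u) -
        Q.translate B (t, x + u) * Q.translate A (t, x) := by
      simp only [hCdef, translate_sub, translate_mul, translate_translate, Prod.mk_add_mk, add_zero]
    rw [hst, htr]
    have hcov : ∀ (X Y : H →L[ℂ] H) (y z : Spacetime s),
        ‖Q.translate X y * Q.translate Y z - Q.translate Y z * Q.translate X y‖ ≤
          ‖X * Q.translate Y (z - y) - Q.translate Y (z - y) * X‖ := fun X Y y z => by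
      have := Q.norm_translate_le (X * Q.translate Y (z - y) - Q.translate Y (z - y) * X) y
      simpa only [translate_sub, translate_mul, translate_translate, add_sub_cancel] using this
    refine (norm_commutator_commutator_le (a := a)
      (κ := k * (1 + ‖u‖) ^ (2 * N) * ((1 + ‖x‖) ^ (2 * N))⁻¹ * (1 + |t|) ^ (2 * N))
      ?_ ?_ ?_ ?_ ?_ ?_ ?_ ?_).trans_eq (by ring)
    · rw [norm_star]; exact (Q.norm_translate_le _ _).trans haB
    · rw [norm_star]; exact haA
    · exact (Q.norm_translate_le _ _).trans haA
    · exact (Q.norm_translate_le _ _).trans haB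
    · rw [star_translate]
      refine (hcov _ _ _ _).trans (hpeetre (x - u) ?_ (norm_nonneg _) ?_ (h₃ t (x - u)) |> fun h =>
        by simpa using h)
      · simpa using norm_add_le (x - u) u
      · exact (le_max_left _ _).trans (le_max_right _ _)
    · rw [star_translate]
      refine (hcov _ _ _ _).trans (hpeetre x (by simp) (norm_nonneg _) ?_ (h₄ t x) |> fun h =>
        by simpa using h)
      exact (le_max_right _ _).trans (le_max_right _ _)
    · refine hpeetre x (by simp) (norm_nonneg _) ?_ (h₁ t x)
      exact (le_max_left _ _).trans (le_max_left _ _)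
    · refine hpeetre (x + u) ?_ (norm_nonneg _) ?_ (h₂ t (x + u))
      · simpa using norm_sub_le (x + u) u
      · exact (le_max_right _ _).trans (le_max_left _ _)
  set K₁ := K₀ * (16 * a ^ 2 * k) with hK₁
  have hK₁0 : 0 ≤ K₁ := by positivity
  have hx : ∀ x u : Space s,
      ‖inner ℂ (Q.pairVector A B u) (Q.shift (0, x) (Q.pairVector A B u))‖ *
        (1 + ‖x‖) ^ (2 * N) ≤ K₁ * (1 + ‖u‖) ^ (2 * N) := by
    intro x u
    have := hcl (C u) (hen u) x _ (hcomm u x)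
    rw [hCΩ] at this
    calc _ ≤ (K₀ * (16 * a ^ 2 * k * (1 + ‖u‖) ^ (2 * N) * ((1 + ‖x‖) ^ (2 * N))⁻¹)) *
          (1 + ‖x‖) ^ (2 * N) := by gcongr; exact this
      _ = K₁ * (1 + ‖u‖) ^ (2 * N) * (((1 + ‖x‖) ^ (2 * N))⁻¹ * (1 + ‖x‖) ^ (2 * N)) := by
          rw [hK₁]; ring
      _ = _ := by rw [inv_mul_cancel₀ (by positivity), mul_one]
  -- decay in `u`
  have hu : ∀ x u : Space s,
      ‖inner ℂ (Q.pairVector A B u) (Q.shift (0, x) (Q.pairVector A B u))‖ *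
        (1 + ‖u‖) ^ (4 * N) ≤ 4 * k₅ ^ 2 := by
    intro x u
    have hn : ‖Q.pairVector A B u‖ * (1 + ‖u‖) ^ (2 * N) ≤ 2 * k₅ := by
      have h1 := h₅ 0 u
      simp only [abs_zero, add_zero, one_pow, mul_one] at h1
      have h2 : ‖Q.pairVector A B u‖ ≤ 2 * ‖C u‖ := by
        rw [pairVector, ← hCΩ]
        refine (Q.norm_truncate_le _).trans ?_
        gcongr
        refine ((C u).le_opNorm _).trans_eq ?_
        rw [norm_Ω, mul_one]
      calc _ ≤ 2 * ‖C u‖ * (1 + ‖u‖) ^ (2 * N) := by gcongr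
        _ = 2 * (‖C u‖ * (1 + ‖u‖) ^ (2 * N)) := by ring
        _ ≤ _ := by gcongr
    calc _ ≤ (‖Q.pairVector A B u‖ * ‖Q.pairVector A B u‖) * (1 + ‖u‖) ^ (4 * N) := by
          gcongr; exact Q.norm_inner_shift_le _ _ _
      _ = (‖Q.pairVector A B u‖ * (1 + ‖u‖) ^ (2 * N)) ^ 2 := by
          rw [show 4 * N = 2 * N + 2 * N by ring, pow_add]; ring
      _ ≤ (2 * k₅) ^ 2 := by gcongr
      _ = _ := by ring
  -- Geometric mean: multiplying `hx` and `hu` bounds `q² (1 + ‖x‖)^{2N} (1 + ‖u‖)^{4N}` by a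
  -- multiple of `(1 + ‖u‖)^{2N}`, one power of which cancels.
  refine ⟨Real.sqrt (K₁ * (4 * k₅ ^ 2)), Real.sqrt_nonneg _, fun x u => ?_⟩
  refine Real.le_sqrt_of_sq_le ?_
  set q := ‖inner ℂ (Q.pairVector A B u) (Q.shift (0, x) (Q.pairVector A B u))‖
  have hq : 0 ≤ q := norm_nonneg _
  have hpos : 0 < (1 + ‖u‖) ^ (2 * N) := by positivity
  refine le_of_mul_le_mul_right ?_ hpos
  calc _ = (q * (1 + ‖x‖) ^ (2 * N)) * (q * (1 + ‖u‖) ^ (4 * N)) := by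
        have e₂ : ∀ y : ℝ, y ^ (2 * N) = (y ^ N) ^ 2 := fun y => by rw [mul_comm, pow_mul]
        have e₄ : ∀ y : ℝ, y ^ (4 * N) = (y ^ N) ^ 4 := fun y => by rw [mul_comm, pow_mul]
        rw [e₂, e₂, e₄]
        generalize (1 + ‖x‖) ^ N = X
        generalize (1 + ‖u‖) ^ N = Z
        ring
    _ ≤ (K₁ * (1 + ‖u‖) ^ (2 * N)) * (4 * k₅ ^ 2) :=
        mul_le_mul (hx x u) (hu x u) (by positivity) (by positivity)
    _ = _ := by ring

end VacuumSector

end HaagKastler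

namespace HaagKastler

/-! ### Plancherel and Riemann-Lebesgue -/

section Plancherel

open scoped FourierTransform

variable {V : Type*} [NormedAddCommGroup V] [InnerProductSpace ℝ V] [FiniteDimensional ℝ V]
  [MeasurableSpace V] [BorelSpace V]

theorem enorm_sq_eq_ofReal {E : Type*} [SeminormedAddCommGroup E] (z : E) :
    ‖z‖ₑ ^ 2 = ENNReal.ofReal (‖z‖ ^ 2) := by
  rw [ENNReal.ofReal_pow (norm_nonneg _), ofReal_norm]

theorem enorm_add_sq_le {E : Type*} [SeminormedAddCommGroup E] (a b : E) :
    ‖a + b‖ₑ ^ 2 ≤ 2 * ‖a‖ₑ ^ 2 + 2 * ‖b‖ₑ ^ 2 := by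
  simp only [enorm_sq_eq_ofReal]
  rw [← ENNReal.ofReal_ofNat 2, ← ENNReal.ofReal_mul (by norm_num),
    ← ENNReal.ofReal_mul (by norm_num), ← ENNReal.ofReal_add (by positivity) (by positivity)]
  refine ENNReal.ofReal_le_ofReal ?_
  have h1 := norm_add_le a b
  have h2 : ‖a + b‖ ^ 2 ≤ (‖a‖ + ‖b‖) ^ 2 := by gcongr
  linarith [add_sq_le (a := ‖a‖) (b := ‖b‖)]

theorem eLpNorm_two_sq {α E : Type*} [MeasurableSpace α] [NormedAddCommGroup E] (μ : Measure α)
    (f : α → E) : eLpNorm f 2 μ ^ 2 = ∫⁻ x, ‖f x‖ₑ ^ 2 ∂μ := by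
  have := eLpNorm_nnreal_pow_eq_lintegral (μ := μ) (f := f) (p := 2) two_ne_zero
  simpa using this

/-- Plancherel's theorem on `L¹ ∩ L²`. -/
theorem lintegral_enorm_fourier_sq {f : V → ℂ} (hf : Integrable f) (hf2 : MemLp f 2) :
    ∫⁻ x, ‖𝓕 f x‖ₑ ^ 2 = ∫⁻ x, ‖f x‖ₑ ^ 2 := by
  set F : Lp ℂ 2 (volume : Measure V) := hf2.toLp f with hF
  have hcont : Continuous (𝓕 f) :=
    VectorFourier.fourierIntegral_continuous Real.continuous_fourierChar
      (by exact continuous_inner) hf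
  -- The abstract `L²` transform agrees with the Fourier integral: both have the same pairing with
  -- every smooth compactly supported function.
  have hae : ∀ᵐ x, (𝓕 F : Lp ℂ 2 (volume : Measure V)) x = 𝓕 f x := by
    refine ae_eq_of_integral_contDiff_smul_eq ((Lp.memLp (𝓕 F)).locallyIntegrable (by norm_num))
      hcont.locallyIntegrable fun g hg hgc => ?_
    have hg₁ : HasCompactSupport (Complex.ofRealCLM ∘ g) := hgc.comp_left rfl
    have hg₂ : ContDiff ℝ ∞ (Complex.ofRealCLM ∘ g) := by fun_prop
    set G := hg₁.toSchwartzMap hg₂ with hG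
    calc ∫ x, g x • (𝓕 F : Lp ℂ 2 (volume : Measure V)) x
        = Lp.toTemperedDistribution (𝓕 F) G := by
          rw [Lp.toTemperedDistribution_apply]; simp [hG]
      _ = Lp.toTemperedDistribution F (𝓕 G) := by
          rw [← Lp.fourier_toTemperedDistribution_eq, TemperedDistribution.fourier_apply]
      _ = ∫ x, 𝓕 (G : V → ℂ) x • f x := by
          rw [Lp.toTemperedDistribution_apply, SchwartzMap.fourier_coe]
          refine integral_congr_ae ?_
          filter_upwards [hf2.coeFn_toLp] with x hx
          rw [hx]
      _ = ∫ x, G x • 𝓕 f x := by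
          simpa using! (VectorFourier.integral_fourierIntegral_smul_eq_flip (L := innerₗ V)
            Real.continuous_fourierChar continuous_inner G.integrable hf)
      _ = ∫ x, g x • 𝓕 f x := by simp [hG]
  have h1 : ∫⁻ x, ‖𝓕 f x‖ₑ ^ 2 = ∫⁻ x, ‖(𝓕 F : Lp ℂ 2 (volume : Measure V)) x‖ₑ ^ 2 := by
    refine lintegral_congr_ae ?_
    filter_upwards [hae] with x hx
    rw [hx]
  rw [h1, ← eLpNorm_two_sq, ← eLpNorm_two_sq, ← Lp.enorm_def, ← eLpNorm_congr_ae hf2.coeFn_toLp,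
    ← Lp.enorm_def, ← ofReal_norm, ← ofReal_norm, Lp.norm_fourier_eq]

theorem lintegral_comp_smul_real (F : V → ENNReal) {c : ℝ} (hc : c ≠ 0) :
    ∫⁻ x, F (c • x) = ENNReal.ofReal |(c ^ Module.finrank ℝ V)⁻¹| * ∫⁻ x, F x := by
  rw [← smul_eq_mul, ← lintegral_smul_measure, ← Measure.map_addHaar_smul _ hc,
    show (fun x : V => c • x) = Homeomorph.smulOfNeZero c hc from rfl,
    (Homeomorph.smulOfNeZero c hc).measurableEmbedding.lintegral_map]
  rfl

theorem exists_lintegral_expFourier_sq_le (V : Type*) [NormedAddCommGroup V]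
    [InnerProductSpace ℝ V] [FiniteDimensional ℝ V] [MeasurableSpace V] [BorelSpace V] :
    ∃ c : ENNReal, c ≠ ⊤ ∧ ∀ f : V → ℂ, Integrable f → MemLp f 2 →
      ∫⁻ x, ‖expFourier f (-x)‖ₑ ^ 2 ≤ c * ∫⁻ x, ‖f x‖ₑ ^ 2 := by
  refine ⟨ENNReal.ofReal |((2 * Real.pi)⁻¹ ^ Module.finrank ℝ V)⁻¹|, ENNReal.ofReal_ne_top,
    fun f hf hf2 => ?_⟩
  rw [← lintegral_enorm_fourier_sq hf hf2]
  refine le_of_eq ?_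
  rw [← lintegral_comp_smul_real _ (c := (2 * Real.pi)⁻¹) (by simp [Real.pi_ne_zero])]
  refine lintegral_congr fun x => ?_
  rw [expFourier_eq]
  simp

end Plancherel

/-- A wave packet with bounded, compactly supported momentum-space density disperses: its Fourier
transform at fixed time tends to zero in `L²`. -/
theorem tendsto_lintegral_fourier_bounded {s : ℕ} {h : Spacetime s → ℂ} (hm : Measurable h)
    {M R : ℝ} (hM : ∀ p, ‖h p‖ ≤ M) (hR : ∀ p, R < ‖p‖ → h p = 0) :
    Tendsto (fun t : ℝ => ∫⁻ x : Space s,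
      ‖∫ p : Spacetime s, Complex.exp (Complex.I * (minkowski p (t, x) : ℂ)) * h p‖ₑ ^ 2)
      atTop (𝓝 0) := by
  have hM0 : 0 ≤ M := (norm_nonneg _).trans (hM 0)
  obtain ⟨c, hc, hpl⟩ := exists_lintegral_expFourier_sq_le (Space s)
  set f : ℝ → Space s → ℂ := fun t q => ∫ E : ℝ, Complex.exp (Complex.I * (E * t : ℝ)) * h (E, q)
    with hf
  set b : Space s → ℝ := (Metric.closedBall (0 : Space s) R).indicator
    fun _ => M * (volume (Metric.closedBall (0 : ℝ) R)).toReal with hb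
  have hfm : ∀ t, Measurable (f t) := by
    intro t
    have : StronglyMeasurable fun z : Space s × ℝ =>
        Complex.exp (Complex.I * (z.2 * t : ℝ)) * h (z.2, z.1) :=
      Measurable.stronglyMeasurable (by fun_prop)
    exact this.integral_prod_right.measurable
  have hexp : ∀ E t : ℝ, ‖Complex.exp (Complex.I * (E * t : ℝ))‖ = 1 := fun E t => by
    rw [mul_comm, Complex.norm_exp_ofReal_mul_I]
  have hfb : ∀ t q, ‖f t q‖ ≤ b q := by
    intro t q
    by_cases hq : ‖q‖ ≤ R
    · rw [hb, indicator_of_mem (by simpa using hq)]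
      have : f t q = ∫ E in Metric.closedBall (0 : ℝ) R,
          Complex.exp (Complex.I * (E * t : ℝ)) * h (E, q) := by
        rw [hf, setIntegral_eq_integral_of_forall_compl_eq_zero]
        intro E hE
        rw [hR, mul_zero]
        refine lt_of_lt_of_le ?_ (norm_fst_le (E, q))
        simpa using hE
      rw [this]
      refine (norm_setIntegral_le_of_norm_le_const (C := M) ?_ fun E _ => ?_).trans_eq rfl
      · exact Metric.isBounded_closedBall.measure_lt_top
      · rw [norm_mul, hexp, one_mul]; exact hM _
    · rw [hb, indicator_of_notMem (by simpa using hq)]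
      have : f t q = 0 := by
        rw [hf]
        refine (integral_congr_ae (.of_forall fun E => ?_)).trans (integral_zero ℝ ℂ)
        rw [hR, mul_zero]
        exact lt_of_lt_of_le (not_le.1 hq) (norm_snd_le (E, q))
      rw [this, norm_zero]
  have hbi : Integrable b :=
    (integrableOn_const (hs := Metric.isBounded_closedBall.measure_lt_top.ne)).integrable_indicator
      Metric.isClosed_closedBall.measurableSet
  have hb2 : MemLp b 2 := by
    refine (memLp_indicator_const 2 Metric.isClosed_closedBall.measurableSet _ (.inr ?_))
    exact Metric.isBounded_closedBall.measure_lt_top.ne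
  have hfi : ∀ t, Integrable (f t) := fun t =>
    hbi.mono' (hfm t).aestronglyMeasurable (.of_forall (hfb t))
  have hf2 : ∀ t, MemLp (f t) 2 := fun t =>
    hb2.mono' (hfm t).aestronglyMeasurable (.of_forall (hfb t))
  -- By Fubini the spacetime integral is the spatial Fourier transform of `f t`; the argument `-x`
  -- reflects the Minkowski sign.
  have hi : ∀ (t : ℝ) (x : Space s),
      ∫ p : Spacetime s, Complex.exp (Complex.I * (minkowski p (t, x) : ℂ)) * h p =
        expFourier (f t) (-x) := by
    intro t x
    have hint : Integrable (fun p : Spacetime s =>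
        Complex.exp (Complex.I * (minkowski p (t, x) : ℂ)) * h p) := by
      refine Integrable.mono' (g := (Metric.closedBall (0 : Spacetime s) R).indicator fun _ => M)
        ((integrableOn_const (hs := Metric.isBounded_closedBall.measure_lt_top.ne)
          ).integrable_indicator Metric.isClosed_closedBall.measurableSet) ?_
        (.of_forall fun p => ?_)
      · refine (Measurable.mul ?_ hm).aestronglyMeasurable
        exact Continuous.measurable (by unfold minkowski; fun_prop)
      · rw [norm_mul, mul_comm Complex.I, Complex.norm_exp_ofReal_mul_I, one_mul]
        by_cases hp : ‖p‖ ≤ R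
        · rw [indicator_of_mem (by simpa using hp)]; exact hM p
        · rw [indicator_of_notMem (by simpa using hp), hR p (not_le.1 hp), norm_zero]
    rw [Measure.volume_eq_prod] at hint ⊢
    rw [integral_prod_symm _ hint, expFourier]
    refine integral_congr_ae (.of_forall fun q => ?_)
    simp only [hf]
    rw [← integral_mul_const]
    refine integral_congr_ae (.of_forall fun E => ?_)
    simp only [minkowski]
    rw [mul_right_comm, ← Complex.exp_add]
    congr 2
    simp
    ring
  simp_rw [hi]
  have hlim : Tendsto (fun t => ∫⁻ q, ‖f t q‖ₑ ^ 2) atTop (𝓝 0) := by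
    -- Riemann-Lebesgue in the energy, at each fixed momentum; the bound `b` then permits dominated
    -- convergence in `q`.
    have hrl : ∀ q, Tendsto (fun t => f t q) atTop (𝓝 0) := by
      intro q
      have h1 := Real.tendsto_integral_exp_smul_cocompact (fun E => h (E, q))
      have h2 : Tendsto (fun t : ℝ => -(t / (2 * Real.pi))) atTop (cocompact ℝ) :=
        (tendsto_neg_atTop_atBot.comp (tendsto_id.atTop_div_const (by positivity))).mono_right
          atBot_le_cocompact
      refine (h1.comp h2).congr fun t => ?_
      simp only [hf, Function.comp]
      refine integral_congr_ae (.of_forall fun E => ?_)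
      simp only [Circle.smul_def, smul_eq_mul, Real.fourierChar_apply]
      congr 2
      push_cast
      field_simp
    have := tendsto_lintegral_filter_of_dominated_convergence (μ := (volume : Measure (Space s)))
      (l := atTop) (F := fun (t : ℝ) q => ‖f t q‖ₑ ^ 2) (f := fun _ => 0)
      (fun q => ‖b q‖ₑ ^ 2) (.of_forall fun t => (hfm t).enorm.pow_const 2)
      (.of_forall fun t => .of_forall fun q => ?_) ?_ (.of_forall fun q => ?_)
    · simpa using this
    · gcongr
      rw [enorm_le_iff_norm_le]
      exact (hfb t q).trans (Real.le_norm_self _)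
    · rw [← eLpNorm_two_sq]
      exact ENNReal.pow_ne_top hb2.2.ne
    · have h1 := (hrl q).enorm
      rw [enorm_zero] at h1
      have h2 := ((ENNReal.continuous_pow 2).tendsto 0).comp h1
      simpa [Function.comp_def] using h2
  have hlim' := ENNReal.Tendsto.const_mul hlim (.inr hc)
  rw [mul_zero] at hlim'
  exact tendsto_of_tendsto_of_tendsto_of_le_of_le tendsto_const_nhds hlim' (fun _ => zero_le)
    fun t => hpl _ (hfi t) (hf2 t)

/-! ### Square integrability in space. -/

namespace VacuumSector

variable {s : ℕ} {m : ℝ} {𝒜 : Type*} [CStarAlgebra 𝒜]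
  {H : Type*} [NormedAddCommGroup H] [InnerProductSpace ℂ H] [CompleteSpace H]
  (Q : VacuumSector s m 𝒜 H)

/-- Square integrability in space, from the integrability of the two-point function of `φ`
(Schur's test). -/
theorem lintegral_inner_shift_sq_le {φ : H}
    (hk : Integrable fun x : Space s => inner ℂ φ (Q.shift (0, x) φ)) (χ : H) :
    ∫⁻ x : Space s, ‖inner ℂ χ (Q.shift (0, x) φ)‖ₑ ^ 2 ≤
      ENNReal.ofReal (‖χ‖ ^ 2 * ∫ x : Space s, ‖inner ℂ φ (Q.shift (0, x) φ)‖) := by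
  set f : Space s → ℂ := fun x => inner ℂ χ (Q.shift (0, x) φ) with hf
  set k : Space s → ℂ := fun x => inner ℂ φ (Q.shift (0, x) φ) with hkdef
  have hT : Continuous fun x : Space s => Q.shift (0, x) φ :=
    Q.continuous_shift (by fun_prop) continuous_const
  have hfc : Continuous f := continuous_const.inner hT
  have hkc : Continuous k := continuous_const.inner hT
  set κ := ∫ x, ‖k x‖ with hκ
  -- On a ball the integral `I` is finite, so that a factor `I` can be cancelled from `I² ≤ ‖χ‖² κ
  -- I`. The bound does not depend on the radius.
  have hball : ∀ n : ℕ, ∫ x in Metric.closedBall (0 : Space s) n, ‖f x‖ ^ 2 ≤ ‖χ‖ ^ 2 * κ := by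
    intro n
    set B := Metric.closedBall (0 : Space s) n with hB
    have hBc : IsCompact B := isCompact_closedBall _ _
    have hcI : ∀ {g : Space s → ℝ}, Continuous g → Integrable g (volume.restrict B) :=
      fun hg => hg.continuousOn.integrableOn_compact hBc
    set I := ∫ x in B, ‖f x‖ ^ 2 with hI
    have hI0 : 0 ≤ I := integral_nonneg fun x => by positivity
    -- Duality: `⟨χ, v⟩ = I`, while `‖v‖²` is the quadratic form of the kernel `k (y - x)` evaluated
    -- on `f`.
    set v : H := ∫ x in B, (starRingEnd ℂ (f x)) • Q.shift (0, x) φ with hv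
    have hvi : IntegrableOn (fun x => (starRingEnd ℂ (f x)) • Q.shift (0, x) φ) B :=
      ((Complex.continuous_conj.comp hfc).smul hT).continuousOn.integrableOn_compact hBc
    have hinner : ∀ η : H, inner ℂ η v =
        ∫ x in B, starRingEnd ℂ (f x) * inner ℂ η (Q.shift (0, x) φ) := by
      intro η
      rw [hv, ← integral_inner hvi]
      simp_rw [inner_smul_right]
    have h1 : inner ℂ χ v = (I : ℂ) := by
      rw [hinner, hI, ← integral_complex_ofReal]
      refine integral_congr_ae (.of_forall fun x => ?_)
      simp only
      rw [mul_comm, Complex.mul_conj, Complex.normSq_eq_norm_sq]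
    have h2 : ‖v‖ ^ 2 ≤ κ * I := by
      have hcross : ∀ x y : Space s, inner ℂ (Q.shift (0, x) φ) (Q.shift (0, y) φ) = k (y - x) := by
        intro x y
        rw [inner_shift_left, ← shift_add_apply]
        simp only [hkdef]
        congr 3
        simp [sub_eq_add_neg, add_comm]
      have h3 : ∀ y, ‖inner ℂ v (Q.shift (0, y) φ)‖ ≤ ∫ x in B, ‖f x‖ * ‖k (y - x)‖ := by
        intro y
        rw [← inner_conj_symm, Complex.norm_conj, hinner]
        refine norm_integral_le_of_norm_le (hcI (by fun_prop)) (.of_forall fun x => ?_)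
        rw [norm_mul, Complex.norm_conj, norm_inner_symm (Q.shift (0, y) φ), hcross]
      have hP : ∀ {g : Space s × Space s → ℝ}, Continuous g →
          Integrable g ((volume.restrict B).prod (volume.restrict B)) := fun hg => by
        rw [Measure.prod_restrict]
        exact hg.continuousOn.integrableOn_compact (hBc.prod hBc)
      have hκy : ∀ y, ∫ x in B, ‖k (y - x)‖ ≤ κ := fun y => by
        rw [hκ, ← integral_sub_left_eq_self (fun x => ‖k x‖) _ y]
        exact setIntegral_le_integral (hk.comp_sub_left y).norm (.of_forall fun x => norm_nonneg _)
      have hκx : ∀ x, ∫ y in B, ‖k (y - x)‖ ≤ κ := fun x => by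
        rw [hκ, ← integral_sub_right_eq_self (fun x => ‖k x‖) x]
        exact setIntegral_le_integral (hk.comp_sub_right x).norm
          (.of_forall fun x => norm_nonneg _)
      have hfB : Integrable (fun y => κ * ‖f y‖ ^ 2) (volume.restrict B) := hcI (by fun_prop)
      set P : Space s × Space s → ℝ := fun z => ‖f z.1‖ * (‖f z.2‖ * ‖k (z.1 - z.2)‖) with hPdef
      set P₁ : Space s × Space s → ℝ := fun z => ‖f z.1‖ ^ 2 * ‖k (z.1 - z.2)‖ with hP₁def
      set P₂ : Space s × Space s → ℝ := fun z => ‖f z.2‖ ^ 2 * ‖k (z.1 - z.2)‖ with hP₂def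
      have hPi := hP (g := P) (by fun_prop)
      have hPi₁ := hP (g := P₁) (by fun_prop)
      have hPi₂ := hP (g := P₂) (by fun_prop)
      have hA : ∫ z, P₁ z ∂((volume.restrict B).prod (volume.restrict B)) ≤ κ * I := by
        rw [integral_prod _ hPi₁, hI, ← integral_const_mul]
        refine integral_mono_of_nonneg (.of_forall fun y => integral_nonneg fun x => ?_) hfB
          (.of_forall fun y => ?_)
        · simp only [hP₁def]; positivity
        · simp only [hP₁def]
          rw [integral_const_mul, mul_comm]
          exact mul_le_mul_of_nonneg_right (hκy y) (by positivity)
      have hA' : ∫ z, P₂ z ∂((volume.restrict B).prod (volume.restrict B)) ≤ κ * I := by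
        rw [integral_prod_symm _ hPi₂, hI, ← integral_const_mul]
        refine integral_mono_of_nonneg (.of_forall fun y => integral_nonneg fun x => ?_) hfB
          (.of_forall fun y => ?_)
        · simp only [hP₂def]; positivity
        · simp only [hP₂def]
          rw [integral_const_mul, mul_comm]
          exact mul_le_mul_of_nonneg_right (hκx y) (by positivity)
      calc ‖v‖ ^ 2 = ‖inner ℂ v v‖ := by
            rw [inner_self_eq_norm_sq_to_K, norm_pow, RCLike.norm_ofReal, abs_norm]
        _ ≤ ∫ y in B, ∫ x in B, P (y, x) := by
            rw [hinner]
            refine norm_integral_le_of_norm_le hPi.integral_prod_left (.of_forall fun y => ?_)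
            simp only [hPdef]
            rw [norm_mul, Complex.norm_conj, integral_const_mul]
            exact mul_le_mul_of_nonneg_left (h3 y) (norm_nonneg _)
        _ = ∫ z, P z ∂((volume.restrict B).prod (volume.restrict B)) := (integral_prod _ hPi).symm
        -- By `2ab ≤ a² + b²` only the marginals of `|k (y - x)|` remain, each at most `κ`.
        _ ≤ ∫ z, (1 / 2 * P₁ z + 1 / 2 * P₂ z) ∂((volume.restrict B).prod (volume.restrict B)) := by
            refine integral_mono hPi ((hPi₁.const_mul _).add (hPi₂.const_mul _)) fun z => ?_
            simp only [hPdef, hP₁def, hP₂def]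
            nlinarith [mul_nonneg (sq_nonneg (‖f z.1‖ - ‖f z.2‖)) (norm_nonneg (k (z.1 - z.2)))]
        _ ≤ κ * I := by
            rw [integral_add (hPi₁.const_mul _) (hPi₂.const_mul _), integral_const_mul,
              integral_const_mul]
            linarith
    have h4 : I * I ≤ (‖χ‖ ^ 2 * κ) * I := by
      have h5 : I ≤ ‖χ‖ * ‖v‖ := by
        have := norm_inner_le_norm (𝕜 := ℂ) χ v
        rwa [h1, Complex.norm_real, Real.norm_of_nonneg hI0] at this
      calc I * I ≤ (‖χ‖ * ‖v‖) * (‖χ‖ * ‖v‖) := mul_self_le_mul_self hI0 h5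
        _ = ‖χ‖ ^ 2 * ‖v‖ ^ 2 := by ring
        _ ≤ ‖χ‖ ^ 2 * (κ * I) := by gcongr
        _ = _ := by ring
    rcases hI0.eq_or_lt with h0 | h0
    · rw [← h0]
      exact mul_nonneg (sq_nonneg _) (integral_nonneg fun x => norm_nonneg _)
    · exact le_of_mul_le_mul_right h4 h0
  have hcov : AECover (volume : Measure (Space s)) atTop
      fun n : ℕ => Metric.closedBall (0 : Space s) n :=
    aecover_closedBall tendsto_natCast_atTop_atTop
  refine le_of_tendsto' (hcov.lintegral_tendsto_of_nat
    (Continuous.aemeasurable (by fun_prop))) fun n => ?_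
  simp_rw [enorm_sq_eq_ofReal]
  rw [← ofReal_integral_eq_lintegral_ofReal]
  · exact ENNReal.ofReal_le_ofReal (hball n)
  · exact ContinuousOn.integrableOn_compact (isCompact_closedBall _ _)
      (Continuous.continuousOn (by fun_prop))
  · exact .of_forall fun x => by positivity

end VacuumSector

end HaagKastler

/-! ### Plane waves in `L²(μ)`. -/

namespace HaagKastler

instance (s : ℕ) : SigmaFinite (volume : Measure (Spacetime s)) :=
  inferInstanceAs (SigmaFinite ((volume : Measure ℝ).prod (volume : Measure (Space s))))

section PlaneWave

variable {s : ℕ}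

/-- The plane wave `p ↦ e^{i p·x}`. -/
noncomputable def planeWave (x p : Spacetime s) : ℂ :=
  Complex.exp (Complex.I * (minkowski p x : ℂ))

theorem continuous_planeWave (x : Spacetime s) : Continuous (planeWave x) := by
  unfold planeWave minkowski; fun_prop

theorem norm_planeWave (x p : Spacetime s) : ‖planeWave x p‖ = 1 := by
  rw [planeWave, mul_comm, Complex.norm_exp_ofReal_mul_I]

theorem conj_planeWave (x p : Spacetime s) :
    starRingEnd ℂ (planeWave x p) = planeWave (-x) p := by
  rw [planeWave, planeWave, ← Complex.exp_conj, map_mul, Complex.conj_I, Complex.conj_ofReal]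
  congr 1
  simp [minkowski]
  ring

theorem planeWave_add (x y p : Spacetime s) :
    planeWave (x + y) p = planeWave x p * planeWave y p := by
  rw [planeWave, planeWave, planeWave, ← Complex.exp_add]
  congr 1
  simp [minkowski, inner_add_right]
  ring

theorem planeWave_zero (p : Spacetime s) : planeWave 0 p = 1 := by
  simp [planeWave, minkowski]

theorem Integrable.planeWave_mul {μ : Measure (Spacetime s)} {v : Spacetime s → ℂ}
    (hv : Integrable v μ) (x : Spacetime s) : Integrable (fun p => planeWave x p * v p) μ := by
  refine (Integrable.mul_continuous_bounded hv (continuous_planeWave x) (C := 1)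
    fun p => (norm_planeWave x p).le).congr (.of_forall fun p => mul_comm _ _)

theorem exists_forall_eq_minkowski (L : StrongDual ℝ (Spacetime s)) :
    ∃ x : Spacetime s, ∀ p, L p = minkowski p x := by
  set w : Space s := (InnerProductSpace.toDual ℝ (Space s)).symm
    (L.comp (ContinuousLinearMap.inr ℝ ℝ (Space s))) with hw
  refine ⟨(L (1, 0), -w), fun p => ?_⟩
  have h1 : L (0, p.2) = inner ℝ w p.2 := by
    rw [hw, InnerProductSpace.toDual_symm_apply]; rfl
  have h2 : p = p.1 • ((1, 0) : Spacetime s) + (0, p.2) := by ext <;> simp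
  conv_lhs => rw [h2]
  rw [map_add, map_smul, h1, minkowski, inner_neg_right, sub_neg_eq_add, real_inner_comm,
    smul_eq_mul]

/-- The positive and negative parts of `g` are densities of finite measures with equal
characteristic functions, so the measures coincide. -/
theorem ae_eq_zero_of_integral_planeWave_real {μ : Measure (Spacetime s)} {g : Spacetime s → ℝ}
    (hg : Integrable g μ) (h : ∀ x, ∫ p, planeWave x p * (g p : ℂ) ∂μ = 0) : g =ᵐ[μ] 0 := by
  have hm : AEMeasurable (fun p => ENNReal.ofReal (g p)) μ := hg.aemeasurable.ennreal_ofReal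
  have hm' : AEMeasurable (fun p => ENNReal.ofReal (-g p)) μ := hg.neg.aemeasurable.ennreal_ofReal
  have hfin : IsFiniteMeasure (μ.withDensity fun p => ENNReal.ofReal (g p)) :=
    isFiniteMeasure_withDensity_ofReal hg.2
  have hfin' : IsFiniteMeasure (μ.withDensity fun p => ENNReal.ofReal (-g p)) :=
    isFiniteMeasure_withDensity_ofReal hg.neg.2
  have heq : (μ.withDensity fun p => ENNReal.ofReal (g p)) =
      μ.withDensity fun p => ENNReal.ofReal (-g p) := by
    refine Measure.ext_of_charFunDual (funext fun L => ?_)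
    obtain ⟨x, hx⟩ := exists_forall_eq_minkowski L
    rw [charFunDual_apply, charFunDual_apply,
      integral_withDensity_eq_integral_toReal_smul₀ hm (.of_forall fun p => ENNReal.ofReal_lt_top),
      integral_withDensity_eq_integral_toReal_smul₀ hm' (.of_forall fun p => ENNReal.ofReal_lt_top),
      ← sub_eq_zero]
    have e : ∀ p, Complex.exp (L p * Complex.I) = planeWave x p := fun p => by
      rw [hx, planeWave, mul_comm]
    have hi : ∀ {k : Spacetime s → ℝ}, Integrable k μ → Integrable
        (fun p => (ENNReal.ofReal (k p)).toReal • Complex.exp (L p * Complex.I)) μ := by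
      intro k hk
      have : Integrable (fun p => planeWave x p * ((max (k p) 0 : ℝ) : ℂ)) μ :=
        Integrable.planeWave_mul hk.pos_part.ofReal x
      refine this.congr (.of_forall fun p => ?_)
      simp only
      rw [e, ENNReal.toReal_ofReal', Complex.real_smul, mul_comm]
    have hgn : Integrable (fun p => -g p) μ := hg.neg
    rw [← integral_sub (hi hg) (hi hgn), ← h x]
    refine integral_congr_ae (.of_forall fun p => ?_)
    simp only
    rw [e, ← sub_smul, ENNReal.toReal_ofReal', ENNReal.toReal_ofReal', Complex.real_smul, mul_comm,
      max_zero_sub_max_neg_zero_eq_self]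
  rw [withDensity_eq_iff hm hm' hg.lintegral_lt_top.ne] at heq
  filter_upwards [heq] with p hp
  change g p = 0
  rcases le_total (g p) 0 with h0 | h0
  · rw [ENNReal.ofReal_of_nonpos h0, eq_comm, ENNReal.ofReal_eq_zero] at hp
    exact le_antisymm h0 (by linarith)
  · rw [ENNReal.ofReal_of_nonpos (by linarith : -g p ≤ 0), ENNReal.ofReal_eq_zero] at hp
    exact le_antisymm hp h0

theorem ae_eq_zero_of_integral_planeWave {μ : Measure (Spacetime s)} {v : Spacetime s → ℂ}
    (hv : Integrable v μ) (h : ∀ x, ∫ p, planeWave x p * v p ∂μ = 0) : v =ᵐ[μ] 0 := by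
  have hc : ∀ x, ∫ p, planeWave x p * starRingEnd ℂ (v p) ∂μ = 0 := by
    intro x
    have := congrArg (starRingEnd ℂ) (h (-x))
    rw [← integral_conj, map_zero] at this
    rw [← this]
    refine integral_congr_ae (.of_forall fun p => ?_)
    simp only [map_mul, conj_planeWave, neg_neg]
  have hcv : Integrable (fun p => starRingEnd ℂ (v p)) μ :=
    (LinearIsometryEquiv.integrable_comp_iff Complex.conjLIE).2 hv
  have hre := ae_eq_zero_of_integral_planeWave_real hv.re (fun x => by
    have h1 := integral_add (Integrable.planeWave_mul hv x) (Integrable.planeWave_mul hcv x)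
    rw [h, hc, add_zero] at h1
    have h2 : ∫ p, planeWave x p * ((RCLike.re (v p) : ℝ) : ℂ) ∂μ =
        ∫ p, (1 / 2 : ℂ) * (planeWave x p * v p + planeWave x p * starRingEnd ℂ (v p)) ∂μ := by
      refine integral_congr_ae (.of_forall fun p => ?_)
      simp only [RCLike.re_to_complex]
      rw [Complex.re_eq_add_conj]; ring
    rw [h2, integral_const_mul, h1, mul_zero])
  have him := ae_eq_zero_of_integral_planeWave_real hv.im (fun x => by
    have h1 := integral_sub (Integrable.planeWave_mul hv x) (Integrable.planeWave_mul hcv x)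
    rw [h, hc, sub_zero] at h1
    have h2 : ∫ p, planeWave x p * ((RCLike.im (v p) : ℝ) : ℂ) ∂μ =
        ∫ p, (1 / (2 * Complex.I) : ℂ) *
          (planeWave x p * v p - planeWave x p * starRingEnd ℂ (v p)) ∂μ := by
      refine integral_congr_ae (.of_forall fun p => ?_)
      simp only [RCLike.im_to_complex]
      rw [Complex.im_eq_sub_conj]; ring
    rw [h2, integral_const_mul, h1, mul_zero])
  filter_upwards [hre, him] with p h1 h2
  exact Complex.ext h1 h2

/-- Plane waves as elements of `L²(μ)`. -/
noncomputable def planeWaveLp (μ : Measure (Spacetime s)) [IsFiniteMeasure μ] (x : Spacetime s) :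
    Lp ℂ 2 μ :=
  (MemLp.of_bound (continuous_planeWave x).aestronglyMeasurable 1
    (.of_forall fun p => (norm_planeWave x p).le)).toLp (planeWave x)

variable {μ : Measure (Spacetime s)} [IsFiniteMeasure μ]

theorem coeFn_planeWaveLp (x : Spacetime s) : planeWaveLp μ x =ᵐ[μ] planeWave x :=
  MemLp.coeFn_toLp _

theorem inner_planeWaveLp (x : Spacetime s) (v : Lp ℂ 2 μ) :
    inner ℂ (planeWaveLp μ x) v = ∫ p, planeWave (-x) p * v p ∂μ := by
  rw [L2.inner_def]
  refine integral_congr_ae ?_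
  filter_upwards [coeFn_planeWaveLp (μ := μ) x] with p hp
  rw [hp, RCLike.inner_apply, conj_planeWave, mul_comm]

theorem eq_zero_of_inner_planeWaveLp {v : Lp ℂ 2 μ}
    (h : ∀ x, inner ℂ (planeWaveLp μ x) v = (0 : ℂ)) : v = 0 := by
  rw [Lp.eq_zero_iff_ae_eq_zero]
  refine ae_eq_zero_of_integral_planeWave ((Lp.memLp v).integrable (by norm_num)) fun x => ?_
  rw [← h (-x), inner_planeWaveLp, neg_neg]

theorem denseRange_linearCombination_planeWaveLp :
    DenseRange (Finsupp.linearCombination ℂ (planeWaveLp μ)) := by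
  have h1 : (Submodule.span ℂ (range (planeWaveLp μ)))ᗮ = ⊥ := by
    rw [Submodule.eq_bot_iff]
    intro v hv
    refine eq_zero_of_inner_planeWaveLp fun x => ?_
    exact (Submodule.mem_orthogonal _ _).1 hv _ (Submodule.subset_span ⟨x, rfl⟩)
  rw [← Submodule.topologicalClosure_eq_top_iff, ← Submodule.dense_iff_topologicalClosure_eq_top,
    ← Finsupp.range_linearCombination] at h1
  exact h1

end PlaneWave

/-! ### Spectral representation and dispersion. -/

namespace VacuumSector

variable {s : ℕ} {m : ℝ} {𝒜 : Type*} [CStarAlgebra 𝒜]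
  {H : Type*} [NormedAddCommGroup H] [InnerProductSpace ℂ H] [CompleteSpace H]
  (Q : VacuumSector s m 𝒜 H)

/-- The cyclic subspace of `ψ` is `L²(μ)`, where the translations act as multiplication
operators. -/
theorem exists_spectral_representation {ψ : H} {μ : Measure (Spacetime s)}
    [IsFiniteMeasure μ] (hμ : IsSpectralMeasure Q.U ψ μ) :
    ∃ W : Lp ℂ 2 μ →L[ℂ] H, (∀ f, ‖W f‖ ≤ ‖f‖) ∧ W (planeWaveLp μ 0) = ψ ∧
      ∀ φ : H, ∃ v : Lp ℂ 2 μ, ∀ (f : Lp ℂ 2 μ) (z : Spacetime s),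
        inner ℂ (W f) (Q.shift z φ) = ∫ p, starRingEnd ℂ (f p) * (planeWave z p * v p) ∂μ := by
  set e := Finsupp.linearCombination ℂ (planeWaveLp μ) with he
  set g := Finsupp.linearCombination ℂ (fun x : Spacetime s => Q.shift x ψ) with hg
  have hbasis : ∀ x y, inner ℂ (Q.shift x ψ) (Q.shift y ψ) =
      (inner ℂ (planeWaveLp μ x) (planeWaveLp μ y) : ℂ) := by
    intro x y
    rw [inner_shift_left, ← shift_add_apply, inner_planeWaveLp]
    refine (hμ.2 (-x + y)).trans (integral_congr_ae ?_)
    filter_upwards [coeFn_planeWaveLp (μ := μ) y] with p hp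
    rw [hp, ← planeWave_add]
    rfl
  -- The vectors `U(x)ψ` and the plane waves have the same Gram matrix, so sending one to the other
  -- is isometric on linear combinations and extends to the dense range's closure.
  have hinner : ∀ c d, inner ℂ (g c) (g d) = (inner ℂ (e c) (e d) : ℂ) := by
    intro c d
    induction c using Finsupp.induction_linear with
    | zero => simp
    | add c₁ c₂ h₁ h₂ => simp only [map_add, inner_add_left, h₁, h₂]
    | single x a =>
      induction d using Finsupp.induction_linear with
      | zero => simp
      | add c₁ c₂ h₁ h₂ => simp only [map_add, inner_add_right, h₁, h₂]
      | single y b =>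
        simp only [he, hg, Finsupp.linearCombination_single, inner_smul_left, inner_smul_right,
          hbasis]
  have hnorm : ∀ c, ‖g c‖ ≤ 1 * ‖e c‖ := by
    intro c
    have h1 := hinner c c
    rw [inner_self_eq_norm_sq_to_K, inner_self_eq_norm_sq_to_K] at h1
    have h2 : ‖g c‖ ^ 2 = ‖e c‖ ^ 2 := by exact_mod_cast h1
    rw [one_mul]
    exact ((pow_left_inj₀ (norm_nonneg _) (norm_nonneg _) two_ne_zero).1 h2).le
  have hd : DenseRange e := denseRange_linearCombination_planeWaveLp
  set W : Lp ℂ 2 μ →L[ℂ] H := g.extendOfNorm e with hW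
  have hWe : ∀ x, W (planeWaveLp μ x) = Q.shift x ψ := by
    intro x
    have := LinearMap.extendOfNorm_eq hd ⟨1, hnorm⟩ (Finsupp.single x 1)
    simpa [he, hg] using this
  refine ⟨W, fun f => ?_, ?_, fun φ => ?_⟩
  · simpa using LinearMap.norm_extendOfNorm_apply_le hd 1 hnorm f
  · rw [hWe, shift_zero]; rfl
  · set v := ContinuousLinearMap.adjoint W φ with hv
    refine ⟨v, fun f z => ?_⟩
    have hmem : MemLp (fun p => planeWave z p * v p) 2 μ := by
      refine (Lp.memLp v).of_le
        ((continuous_planeWave z).aestronglyMeasurable.mul (Lp.aestronglyMeasurable v))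
        (.of_forall fun p => ?_)
      rw [norm_mul, norm_planeWave, one_mul]
    -- The adjoint of `W` turns translations into multiplication by plane waves; this is checked
    -- against the total family of plane waves.
    have hz : ContinuousLinearMap.adjoint W (Q.shift z φ) = hmem.toLp _ := by
      rw [← sub_eq_zero]
      refine eq_zero_of_inner_planeWaveLp fun x => ?_
      rw [inner_sub_right, ContinuousLinearMap.adjoint_inner_right, hWe, inner_shift_left,
        ← shift_add_apply, inner_shift_right, ← hWe, ← ContinuousLinearMap.adjoint_inner_right,
        ← hv, inner_planeWaveLp, inner_planeWaveLp, sub_eq_zero]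
      refine integral_congr_ae ?_
      filter_upwards [hmem.coeFn_toLp] with p hp
      rw [hp, neg_neg, planeWave_add, mul_assoc]
    rw [← ContinuousLinearMap.adjoint_inner_right, hz, L2.inner_def]
    refine integral_congr_ae ?_
    filter_upwards [hmem.coeFn_toLp] with p hp
    rw [hp, RCLike.inner_apply, mul_comm]

/-- Dispersion: if `⟨χ, U(0, ·) φ⟩` is square integrable for all `χ`, then its `L²` norm at time
`t` vanishes as `t → ∞` for `χ ∈ H_ac(P)`. -/
theorem tendsto_lintegral_inner_shift {ψ φ : H} (hψ : ψ ∈ absolutelyContinuousSubspace Q.U)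
    {M : ℝ} (hM0 : 0 ≤ M) (hM : ∀ χ : H, ∫⁻ x : Space s, ‖inner ℂ χ (Q.shift (0, x) φ)‖ₑ ^ 2 ≤
      ENNReal.ofReal (‖χ‖ ^ 2 * M)) :
    Tendsto (fun t : ℝ => ∫⁻ x : Space s, ‖inner ℂ ψ (Q.shift (t, x) φ)‖ₑ ^ 2) atTop (𝓝 0) := by
  obtain ⟨μ, hμ, hac⟩ := hψ
  have hfin : IsFiniteMeasure μ := hμ.1
  obtain ⟨W, hW, hW0, hrep⟩ := Q.exists_spectral_representation hμ
  obtain ⟨v, hv⟩ := hrep φ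
  set ρ : Spacetime s → ENNReal := μ.rnDeriv volume with hρ
  have hρm : Measurable ρ := Measure.measurable_rnDeriv _ _
  have hvm : Measurable v := (Lp.stronglyMeasurable v).measurable
  -- On `S n` the Lebesgue density `ρ v` is bounded by `n²` and has bounded support.
  set S : ℕ → Set (Spacetime s) := fun n => {p | ‖v p‖ ≤ n ∧ ρ p ≤ n ∧ ‖p‖ ≤ n} with hS
  have hSm : ∀ n, MeasurableSet (S n) := fun n =>
    (measurableSet_le hvm.norm measurable_const).inter
      ((measurableSet_le hρm measurable_const).inter
        (measurableSet_le measurable_norm measurable_const))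
  -- the truncated vectors
  have hM' : ∀ (t : ℝ) (χ : H), ∫⁻ x : Space s, ‖inner ℂ χ (Q.shift (t, x) φ)‖ₑ ^ 2 ≤
      ENNReal.ofReal (‖χ‖ ^ 2 * M) := by
    intro t χ
    have := hM (Q.shift (-(t, 0)) χ)
    rw [norm_shift_apply] at this
    refine (lintegral_congr fun x => ?_).trans_le this
    rw [← inner_shift_right, ← shift_add_apply]
    simp
  set f : ℕ → Lp ℂ 2 μ := fun n => indicatorConstLp 2 (hSm n) (measure_ne_top μ _) (1 : ℂ) with hf
  have hgood : ∀ n, Tendsto (fun t : ℝ => ∫⁻ x : Space s,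
      ‖inner ℂ (W (f n)) (Q.shift (t, x) φ)‖ₑ ^ 2) atTop (𝓝 0) := by
    intro n
    set h : Spacetime s → ℂ := (S n).indicator fun p => (ρ p).toReal • v p with hh
    have hhm : Measurable h := ((hρm.ennreal_toReal).smul hvm).indicator (hSm n)
    have h1 := tendsto_lintegral_fourier_bounded hhm (M := (n : ℝ) * n) (R := n)
      (fun p => ?_) (fun p hp => ?_)
    · refine h1.congr fun t => lintegral_congr fun x => ?_
      congr 2
      rw [hv, ← integral_rnDeriv_smul hac]
      have hfe : ∀ᵐ p ∂(volume : Measure (Spacetime s)), ρ p ≠ 0 →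
          f n p = (S n).indicator (fun _ => (1 : ℂ)) p := by
        have h2 : ∀ᵐ p ∂((volume : Measure (Spacetime s)).withDensity ρ),
            f n p = (S n).indicator (fun _ => (1 : ℂ)) p := by
          rw [hρ, Measure.withDensity_rnDeriv_eq _ _ hac]
          exact indicatorConstLp_coeFn
        rwa [ae_withDensity_iff hρm] at h2
      refine integral_congr_ae ?_
      filter_upwards [hfe] with p hp
      by_cases h0 : ρ p = 0
      · have : h p = 0 := by
          rw [hh, indicator_apply]
          simp [h0]
        rw [this, ← hρ, h0]
        simp
      · rw [hp h0, hh]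
        by_cases hpS : p ∈ S n
        · rw [indicator_of_mem hpS, indicator_of_mem hpS, ← hρ]
          simp only [planeWave, map_one, one_mul, Complex.real_smul]
          ring
        · rw [indicator_of_notMem hpS, indicator_of_notMem hpS]
          simp
    · by_cases hpS : p ∈ S n
      · rw [hh, indicator_of_mem hpS, norm_smul, Real.norm_of_nonneg ENNReal.toReal_nonneg]
        refine mul_le_mul ?_ hpS.1 (norm_nonneg _) (by positivity)
        exact ENNReal.toReal_le_of_le_ofReal (by positivity) (by simpa using hpS.2.1)
      · rw [hh, indicator_of_notMem hpS, norm_zero]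
        positivity
    · rw [hh, indicator_of_notMem]
      exact fun hpS => absurd hpS.2.2 (not_le.2 hp)
  -- `ψ` corresponds to the constant `1` and `W (f n)` to the indicator of `S n`, so the squared
  -- error is at most `μ (S n)ᶜ`.
  have happrox : Tendsto (fun n => ENNReal.ofReal (‖ψ - W (f n)‖ ^ 2 * M)) atTop (𝓝 0) := by
    have hmeas : Tendsto (fun n => μ (S n)ᶜ) atTop (𝓝 0) := by
      have hanti : Antitone fun n => (S n)ᶜ := by
        intro a b hab
        refine compl_subset_compl.2 fun p hp => ?_
        have hab' : (a : ℝ) ≤ b := by exact_mod_cast hab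
        exact ⟨hp.1.trans hab', hp.2.1.trans (by exact_mod_cast hab), hp.2.2.trans hab'⟩
      have h1 := tendsto_measure_iInter_atTop (μ := μ)
        (fun n => (hSm n).compl.nullMeasurableSet) hanti ⟨0, measure_ne_top _ _⟩
      have h2 : μ (⋂ n, (S n)ᶜ) = 0 := by
        have h3 : ∀ᵐ p ∂μ, ρ p < ⊤ := hac.ae_le (Measure.rnDeriv_lt_top μ volume)
        refine measure_mono_null (t := {p | ¬ ρ p < ⊤}) (fun p hp hlt => ?_) (ae_iff.1 h3)
        obtain ⟨n₁, hn₁⟩ := exists_nat_ge ‖v p‖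
        obtain ⟨n₂, hn₂⟩ := ENNReal.exists_nat_gt hlt.ne
        obtain ⟨n₃, hn₃⟩ := exists_nat_ge ‖p‖
        refine mem_iInter.1 hp (max n₁ (max n₂ n₃)) ⟨?_, ?_, ?_⟩
        · exact hn₁.trans (by exact_mod_cast le_max_left _ _)
        · exact hn₂.le.trans (by exact_mod_cast (le_max_left _ _).trans (le_max_right _ _))
        · exact hn₃.trans (by exact_mod_cast (le_max_right _ _).trans (le_max_right _ _))
      rwa [h2] at h1
    have hnorm : ∀ n, ‖ψ - W (f n)‖ ^ 2 ≤ μ.real (S n)ᶜ := by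
      intro n
      have h1 : planeWaveLp μ 0 - f n =
          indicatorConstLp 2 (hSm n).compl (measure_ne_top μ _) (1 : ℂ) := by
        refine Lp.ext ?_
        filter_upwards [Lp.coeFn_sub (planeWaveLp μ 0) (f n), coeFn_planeWaveLp (μ := μ) 0,
          indicatorConstLp_coeFn (p := 2) (hs := hSm n) (hμs := measure_ne_top μ _) (c := (1 : ℂ)),
          indicatorConstLp_coeFn (p := 2) (hs := (hSm n).compl) (hμs := measure_ne_top μ _)
            (c := (1 : ℂ))] with p h1 h2 h3 h4
        rw [h1, h4, Pi.sub_apply, h2, hf, h3, planeWave_zero]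
        by_cases hp : p ∈ S n <;> simp [hp]
      have h2 : ‖ψ - W (f n)‖ ≤ ‖indicatorConstLp 2 (hSm n).compl (measure_ne_top μ _) (1 : ℂ)‖ := by
        rw [← h1, ← hW0, ← map_sub]
        exact hW _
      have h3 : ‖indicatorConstLp 2 (hSm n).compl (measure_ne_top μ _) (1 : ℂ)‖ ^ 2 =
          μ.real (S n)ᶜ := by
        rw [norm_indicatorConstLp two_ne_zero ENNReal.ofNat_ne_top, norm_one, one_mul,
          ← Real.rpow_natCast, ← Real.rpow_mul measureReal_nonneg]
        simp
      rw [← h3]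
      gcongr
    have hreal : Tendsto (fun n => ENNReal.ofReal (μ.real (S n)ᶜ * M)) atTop (𝓝 0) := by
      have h1 : Tendsto (fun n => μ.real (S n)ᶜ) atTop (𝓝 0) :=
        (ENNReal.tendsto_toReal_zero_iff fun n => measure_ne_top _ _).2 hmeas
      have h2 := ENNReal.tendsto_ofReal (h1.mul_const M)
      simpa using h2
    exact tendsto_of_tendsto_of_tendsto_of_le_of_le tendsto_const_nhds hreal (fun _ => zero_le)
      fun n => ENNReal.ofReal_le_ofReal (by gcongr; exact hnorm n)
  rw [ENNReal.tendsto_nhds_zero]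
  intro ε hε
  -- Both terms of the square estimate carry a factor `2`. The error term is small uniformly in `t`
  -- by `hM'`.
  have hε4 : 0 < ε / 4 := ENNReal.div_pos hε.ne' (by norm_num)
  obtain ⟨n, hn⟩ := (ENNReal.tendsto_nhds_zero.1 happrox (ε / 4) hε4).exists
  filter_upwards [ENNReal.tendsto_nhds_zero.1 (hgood n) (ε / 4) hε4] with t ht
  have hmeasu : Measurable fun x : Space s =>
      2 * ‖inner ℂ (ψ - W (f n)) (Q.shift (t, x) φ)‖ₑ ^ 2 := by
    refine Continuous.measurable ?_
    have : Continuous fun x : Space s => inner ℂ (ψ - W (f n)) (Q.shift (t, x) φ) :=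
      continuous_const.inner (Q.continuous_shift (by fun_prop) continuous_const)
    exact (ENNReal.continuous_const_mul (by norm_num)).comp
      ((ENNReal.continuous_pow 2).comp this.enorm)
  calc _ ≤ ∫⁻ x : Space s, (2 * ‖inner ℂ (ψ - W (f n)) (Q.shift (t, x) φ)‖ₑ ^ 2 +
        2 * ‖inner ℂ (W (f n)) (Q.shift (t, x) φ)‖ₑ ^ 2) := by
        refine lintegral_mono fun x => ?_
        have := enorm_add_sq_le (inner ℂ (ψ - W (f n)) (Q.shift (t, x) φ))
          (inner ℂ (W (f n)) (Q.shift (t, x) φ))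
        rwa [← inner_add_left, sub_add_cancel] at this
    _ ≤ 2 * (ε / 4) + 2 * (ε / 4) := by
        rw [lintegral_add_left hmeasu, lintegral_const_mul' _ _ (by norm_num),
          lintegral_const_mul' _ _ (by norm_num)]
        gcongr
        exact (hM' t _).trans hn
    _ = ε := by
        rw [← two_mul, ← mul_assoc, show (2 : ENNReal) * 2 = 4 by norm_num]
        exact ENNReal.mul_div_cancel (by norm_num) (by norm_num)

/-- Invariance of `Ω` forces its representative `v` in `L²(μ)` to satisfy `(e^{ip₀} - 1) v = 0`. The
hyperplanes `p₀ ∈ 2πℤ` are Lebesgue null, hence `μ`-null, so `v = 0`. -/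
theorem inner_Ω_eq_zero {ψ : H} (hψ : ψ ∈ absolutelyContinuousSubspace Q.U) :
    inner ℂ ψ Q.Ω = (0 : ℂ) := by
  obtain ⟨μ, hμ, hac⟩ := hψ
  have hfin : IsFiniteMeasure μ := hμ.1
  obtain ⟨W, hW, hW0, hrep⟩ := Q.exists_spectral_representation hμ
  obtain ⟨v, hv⟩ := hrep Q.Ω
  have hvi : Integrable v μ := (Lp.memLp v).integrable (by norm_num)
  have hwave : ∀ z, inner ℂ ψ Q.Ω = ∫ p, planeWave z p * v p ∂μ := by
    intro z
    have := hv (planeWaveLp μ 0) z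
    rw [hW0, shift_Ω] at this
    rw [this]
    refine integral_congr_ae ?_
    filter_upwards [coeFn_planeWaveLp (μ := μ) 0] with p hp
    rw [hp, planeWave_zero, map_one, one_mul]
  have hzero : (fun p => (planeWave ((1, 0) : Spacetime s) p - 1) * v p) =ᵐ[μ] 0 := by
    have hi : Integrable (fun p => planeWave ((1, 0) : Spacetime s) p * v p - v p) μ :=
      (Integrable.planeWave_mul hvi _).sub hvi
    refine ae_eq_zero_of_integral_planeWave (hi.congr (.of_forall fun p => by ring)) fun x => ?_
    have h1 := integral_sub (Integrable.planeWave_mul hvi (x + (1, 0)))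
      (Integrable.planeWave_mul hvi x)
    rw [← hwave, ← hwave, sub_self] at h1
    rw [← h1]
    refine integral_congr_ae (.of_forall fun p => ?_)
    simp only [planeWave_add]
    ring
  have hne : ∀ᵐ p ∂μ, planeWave ((1, 0) : Spacetime s) p ≠ 1 := by
    refine hac.ae_le (measure_mono_null (t := ⋃ n : ℤ, {n * (2 * Real.pi)} ×ˢ univ)
      (fun p hp => ?_) (measure_iUnion_null fun n => ?_))
    · obtain ⟨n, hn⟩ := Complex.exp_eq_one_iff.1 (not_not.1 hp)
      refine mem_iUnion.2 ⟨n, ?_, mem_univ _⟩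
      simp only [minkowski, inner_zero_right, mul_one, sub_zero] at hn
      rw [mul_comm, ← mul_assoc] at hn
      exact_mod_cast mul_right_cancel₀ Complex.I_ne_zero hn
    · rw [Measure.volume_eq_prod, Measure.prod_prod, Real.volume_singleton, zero_mul]
  rw [hwave 0, integral_eq_zero_of_ae]
  filter_upwards [hzero, hne] with p h1 h2
  have h3 : v p = 0 := (mul_eq_zero.1 h1).resolve_left (sub_ne_zero.2 h2)
  rw [h3, mul_zero, Pi.zero_apply]

end VacuumSector

end HaagKastler

/-! ### Relative coordinates and conclusion. -/

namespace HaagKastler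

theorem integrable_inv_one_add_norm_pow (s : ℕ) :
    Integrable fun x : Space s => ((1 + ‖x‖) ^ (s + 1))⁻¹ := by
  have h := integrable_one_add_norm (E := Space s) (μ := volume) (r := ((s + 1 : ℕ) : ℝ)) (by
    rw [finrank_euclideanSpace_fin]; exact_mod_cast Nat.lt_succ_self s)
  refine h.congr (.of_forall fun x => ?_)
  simp only
  rw [Real.rpow_neg (by positivity), Real.rpow_natCast]

theorem lintegral_comp_fst_sub_snd {s : ℕ} {G : Space s × Space s → ENNReal} (hG : Measurable G) :
    ∫⁻ z : Space s × Space s, G (z.1, z.2 - z.1) = ∫⁻ u : Space s, ∫⁻ x : Space s, G (x, u) := by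
  have hG' : Measurable fun z : Space s × Space s => G (z.1, z.2 - z.1) :=
    hG.comp (measurable_fst.prodMk (measurable_snd.sub measurable_fst))
  rw [Measure.volume_eq_prod, lintegral_prod _ hG'.aemeasurable,
    ← lintegral_lintegral_swap (f := fun x u => G (x, u)) hG.aemeasurable]
  exact lintegral_congr fun x => lintegral_sub_right_eq_self (fun u => G (x, u)) x

namespace VacuumSector

variable {s : ℕ} {m : ℝ} {𝒜 : Type*} [CStarAlgebra 𝒜]
  {H : Type*} [NormedAddCommGroup H] [InnerProductSpace ℂ H] [CompleteSpace H]
  (Q : VacuumSector s m 𝒜 H)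

theorem continuous_pairVector (A B : H →L[ℂ] H) : Continuous fun u => Q.pairVector A B u := by
  have h : Continuous fun u : Space s => A (Q.translate B (0, u) Q.Ω) :=
    A.continuous.comp (Q.continuous_translate B (by fun_prop) continuous_const)
  unfold pairVector truncate
  exact h.sub ((continuous_const.inner h).smul continuous_const)

theorem twoPointAmplitude_eq {ψ : H} (hψ : inner ℂ ψ Q.Ω = (0 : ℂ)) (B₁ B₂ : H →L[ℂ] H) (t : ℝ)
    (x y : Space s) : Q.twoPointAmplitude B₁ B₂ ψ t x y =
      inner ℂ ψ (Q.shift (t, x) (Q.pairVector (star B₁) (star B₂) (y - x))) := by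
  have h1 : Q.translate (star B₁) (0, x) (Q.translate (star B₂) (0, y) Q.Ω) =
      Q.shift (0, x) (star B₁ (Q.translate (star B₂) (0, y - x) Q.Ω)) := by
    simp only [translate_apply, ← shift_add_apply, shift_Ω]
    simp [sub_eq_neg_add]
  rw [twoPointAmplitude, h1, pairVector, truncate, map_sub, map_smul, shift_Ω, inner_sub_right,
    inner_smul_right, hψ, mul_zero, sub_zero]
  change inner ℂ ψ (Q.shift (t, 0) (Q.shift (0, x) _)) = _
  rw [← shift_add_apply]
  simp

theorem continuous_inner_shift_pairVector (A B : H →L[ℂ] H) (ψ : H) (t : ℝ) :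
    Continuous fun z : Space s × Space s => inner ℂ ψ (Q.shift (t, z.1) (Q.pairVector A B z.2)) :=
  continuous_const.inner (Q.continuous_shift (by fun_prop)
    ((Q.continuous_pairVector A B).comp continuous_snd))

/-- The exponent `s + 1 > s` makes the weight integrable over `ℝ^s`: in `x` for Schur's test, and in
`u` for the final dominated convergence. -/
theorem exists_lintegral_inner_shift_pairVector_le {A B : H →L[ℂ] H} (hA : Q.IsAlmostLocal A)
    (hB : Q.IsAlmostLocal B) (hσA : IsCompact (Q.arvesonSpectrum A))
    (hσB : IsCompact (Q.arvesonSpectrum B)) (hΩ : A Q.Ω = 0) :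
    ∃ C : ℝ, 0 ≤ C ∧ ∀ (u : Space s) (t : ℝ) (χ : H),
      ∫⁻ x : Space s, ‖inner ℂ χ (Q.shift (t, x) (Q.pairVector A B u))‖ₑ ^ 2 ≤
        ENNReal.ofReal (‖χ‖ ^ 2 * (C * ((1 + ‖u‖) ^ (s + 1))⁻¹)) := by
  obtain ⟨K, hK0, hK⟩ := Q.exists_norm_inner_pairVector_le hA hB hσA hσB hΩ (s + 1)
  have hint := integrable_inv_one_add_norm_pow s
  refine ⟨K * ∫ x : Space s, ((1 + ‖x‖) ^ (s + 1))⁻¹,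
    mul_nonneg hK0 (integral_nonneg fun x => by positivity), fun u t χ => ?_⟩
  set φ := Q.pairVector A B u with hφ
  have hle : ∀ x : Space s, ‖inner ℂ φ (Q.shift (0, x) φ)‖ ≤
      K * ((1 + ‖u‖) ^ (s + 1))⁻¹ * ((1 + ‖x‖) ^ (s + 1))⁻¹ := by
    intro x
    have h := hK x u
    rw [← le_div_iff₀ (by positivity)] at h
    refine h.trans_eq ?_
    rw [div_eq_mul_inv, mul_inv]
    ring
  have hcont : Continuous fun x : Space s => inner ℂ φ (Q.shift (0, x) φ) :=
    continuous_const.inner (Q.continuous_shift (by fun_prop) continuous_const)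
  have hk : Integrable fun x : Space s => inner ℂ φ (Q.shift (0, x) φ) :=
    (hint.const_mul (K * ((1 + ‖u‖) ^ (s + 1))⁻¹)).mono' hcont.aestronglyMeasurable
      (.of_forall hle)
  -- The time translation is absorbed into `χ`, whose norm it preserves; the bound is therefore
  -- uniform in `t`.
  have h := Q.lintegral_inner_shift_sq_le hk (Q.shift (-(t, 0)) χ)
  rw [norm_shift_apply] at h
  have h2 : ∫⁻ x : Space s, ‖inner ℂ χ (Q.shift (t, x) φ)‖ₑ ^ 2 =
      ∫⁻ x : Space s, ‖inner ℂ (Q.shift (-(t, 0)) χ) (Q.shift (0, x) φ)‖ₑ ^ 2 := by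
    refine lintegral_congr fun x => ?_
    rw [← inner_shift_right, ← shift_add_apply]
    simp
  rw [h2]
  refine h.trans (ENNReal.ofReal_le_ofReal ?_)
  gcongr
  refine (integral_mono hk.norm (hint.const_mul _) hle).trans_eq ?_
  rw [integral_const_mul]
  ring

theorem lintegral_twoPointAmplitude {ψ : H} (hψ : inner ℂ ψ Q.Ω = (0 : ℂ)) (B₁ B₂ : H →L[ℂ] H)
    (t : ℝ) : ∫⁻ z : Space s × Space s, ‖Q.twoPointAmplitude B₁ B₂ ψ t z.1 z.2‖ₑ ^ 2 =
      ∫⁻ u : Space s, ∫⁻ x : Space s,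
        ‖inner ℂ ψ (Q.shift (t, x) (Q.pairVector (star B₁) (star B₂) u))‖ₑ ^ 2 := by
  have hm : Measurable fun z : Space s × Space s =>
      ‖inner ℂ ψ (Q.shift (t, z.1) (Q.pairVector (star B₁) (star B₂) z.2))‖ₑ ^ 2 :=
    ((ENNReal.continuous_pow 2).comp
      (Q.continuous_inner_shift_pairVector _ _ ψ t).enorm).measurable
  simp only [Q.twoPointAmplitude_eq hψ]
  exact lintegral_comp_fst_sub_snd hm

theorem continuous_twoPointAmplitude {ψ : H} (hψ : inner ℂ ψ Q.Ω = (0 : ℂ)) (B₁ B₂ : H →L[ℂ] H)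
    (t : ℝ) :
    Continuous fun z : Space s × Space s => Q.twoPointAmplitude B₁ B₂ ψ t z.1 z.2 := by
  simp only [Q.twoPointAmplitude_eq hψ]
  have h : Continuous fun z : Space s × Space s => (z.1, z.2 - z.1) :=
    continuous_fst.prodMk (continuous_snd.sub continuous_fst)
  exact (Q.continuous_inner_shift_pairVector (star B₁) (star B₂) ψ t).comp h

end VacuumSector

end HaagKastler

theorem mainTheorem5 {s : ℕ} {m : ℝ} {𝒜 : Type*} [CStarAlgebra 𝒜]
    {H : Type*} [NormedAddCommGroup H] [InnerProductSpace ℂ H] [CompleteSpace H]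
    (Q : HaagKastler.VacuumSector s m 𝒜 H) (B₁ B₂ : H →L[ℂ] H)
    (hB₁ : Q.IsAlmostLocal (star B₁)) (hB₂ : Q.IsAlmostLocal (star B₂))
    (hσ₁ : IsCompact (Q.arvesonSpectrum (star B₁)))
    (hσ₂ : IsCompact (Q.arvesonSpectrum (star B₂)))
    (hΩ : star B₁ Q.Ω = 0)
    (ψ : H) (hψ : ψ ∈ HaagKastler.absolutelyContinuousSubspace Q.U) :
    (∀ t : ℝ, MeasureTheory.Integrable
      (fun z : HaagKastler.Space s × HaagKastler.Space s =>
        ‖Q.twoPointAmplitude B₁ B₂ ψ t z.1 z.2‖ ^ 2)) ∧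
    Filter.Tendsto
      (fun t : ℝ => ∫ x : HaagKastler.Space s, ∫ y : HaagKastler.Space s,
        ‖Q.twoPointAmplitude B₁ B₂ ψ t x y‖ ^ 2)
      Filter.atTop (nhds 0) := by
  have hψΩ := Q.inner_Ω_eq_zero hψ
  obtain ⟨C, hC0, hC⟩ := Q.exists_lintegral_inner_shift_pairVector_le hB₁ hB₂ hσ₁ hσ₂ hΩ
  have hb : ∫⁻ u : HaagKastler.Space s,
      ENNReal.ofReal (‖ψ‖ ^ 2 * (C * ((1 + ‖u‖) ^ (s + 1))⁻¹)) ≠ ⊤ :=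
    (((HaagKastler.integrable_inv_one_add_norm_pow s).const_mul C).const_mul
      (‖ψ‖ ^ 2)).lintegral_lt_top.ne
  have hfin : ∀ t, ∫⁻ z : HaagKastler.Space s × HaagKastler.Space s,
      ‖Q.twoPointAmplitude B₁ B₂ ψ t z.1 z.2‖ₑ ^ 2 ≠ ⊤ := by
    intro t
    rw [Q.lintegral_twoPointAmplitude hψΩ]
    exact ne_top_of_le_ne_top hb (lintegral_mono fun u => hC u t ψ)
  have hint : ∀ t : ℝ, Integrable
      (fun z : HaagKastler.Space s × HaagKastler.Space s =>
        ‖Q.twoPointAmplitude B₁ B₂ ψ t z.1 z.2‖ ^ 2) := by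
    intro t
    refine ⟨((Q.continuous_twoPointAmplitude hψΩ B₁ B₂ t).norm.pow 2).aestronglyMeasurable, ?_⟩
    refine lt_of_eq_of_lt (lintegral_congr fun z => ?_) (lt_top_iff_ne_top.2 (hfin t))
    rw [enorm_pow, enorm_norm]
  refine ⟨hint, ?_⟩
  have hlim : Tendsto (fun t : ℝ => ∫⁻ u : HaagKastler.Space s, ∫⁻ x : HaagKastler.Space s,
      ‖inner ℂ ψ (Q.shift (t, x) (Q.pairVector (star B₁) (star B₂) u))‖ₑ ^ 2) atTop
      (𝓝 (∫⁻ _ : HaagKastler.Space s, 0)) := by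
    -- For each `u` the integral over `x` vanishes in the limit by dispersion, and `hC` dominates it
    -- by an integrable function of `u` independent of `t`.
    refine tendsto_lintegral_filter_of_dominated_convergence _ (.of_forall fun t => ?_)
      (.of_forall fun t => .of_forall fun u => hC u t ψ) hb (.of_forall fun u => ?_)
    · exact Measurable.lintegral_prod_left' ((ENNReal.continuous_pow 2).comp
        (Q.continuous_inner_shift_pairVector (star B₁) (star B₂) ψ t).enorm).measurable
    · exact Q.tendsto_lintegral_inner_shift hψ (by positivity) (hC u 0)
  rw [lintegral_zero] at hlim
  have hlim' := (ENNReal.tendsto_toReal ENNReal.zero_ne_top).comp hlim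
  rw [ENNReal.toReal_zero] at hlim'
  refine hlim'.congr fun t => ?_
  have h1 : ∫ x : HaagKastler.Space s, ∫ y : HaagKastler.Space s,
      ‖Q.twoPointAmplitude B₁ B₂ ψ t x y‖ ^ 2 =
      ∫ z : HaagKastler.Space s × HaagKastler.Space s,
        ‖Q.twoPointAmplitude B₁ B₂ ψ t z.1 z.2‖ ^ 2 := (integral_prod _ (hint t)).symm
  rw [h1, integral_eq_lintegral_of_nonneg_ae (.of_forall fun z => by positivity) (hint t).1,
    Function.comp_apply, ← Q.lintegral_twoPointAmplitude hψΩ]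
  congr 1
  refine lintegral_congr fun z => ?_
  rw [HaagKastler.enorm_sq_eq_ofReal]
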